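/- Let $V$ be a finite set, and let $\mathcal G,\mathcal H$ be maximal ancestral graphs with vertex set $V$ (simple mixed graphs with undirected, directed and bidirected edges that are ancestral, and in which any two distinct non-adjacent vertices are m-separated by some set). Let $\mathcal I(\mathcal G)$ be the collection of all statements $X_i\perp\!\!\!\perp X_j\mid X_C$ ($i\ne j$, $C\subseteq V\setminus\{i,j\}$) such that $i$ and $j$ are m-separated given $C$ in $\mathcal G$, and let the Gaussian model $\mathcal M(\mathcal G)$ be the set of positive definite matrices $\Sigma\in\mathbb R^{V\times V}$ such that all statements of $\mathcal I(\mathcal G)$ hold for $X\sim N(0,\Sigma)$; similarly for $\mathcal H$. For $c>0$, two sets of matrices $\mathcal M_1,\mathcal M_2$ are called $c$-equivalent (respectively $c$-near-equivalent) at $\theta\in\mathcal M_1\cap\mathcal M_2$ if the Hausdorff distance, for the Euclidean (Frobenius) norm, between $\mathcal M_1\cap N_\varepsilon(\theta)$ and $\mathcal M_2\cap N_\varepsilon(\theta)$ is $o(\varepsilon^c)$ (respectively $O(\varepsilon^c)$) as $\varepsilon\downarrow 0$, where $N_\varepsilon(\theta)$ is the open ball of radius $\varepsilon$ around $\theta$.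 Then: 1. Adjacency has the same meaning in the graph and in its independence model: two vertices $i\neq j$ are joined by an edge of $\mathcal G$ if and only if $\mathcal I(\mathcal G)$ contains no independence statement between $X_i$ and $X_j$; likewise for $\mathcal H$. 2. If $\mathcal G$ and $\mathcal H$ have the same adjacencies, then $\mathcal M(\mathcal G)$ and $\mathcal M(\mathcal H)$ are 2-near-equivalent at every point of total independence, that is, at every diagonal matrix with positive diagonal entries. 3. If $\mathcal G$ and $\mathcal H$ do not have the same adjacencies, then $\mathcal M(\mathcal G)$ and $\mathcal M(\mathcal H)$ are 1-equivalent almost nowhere on any irreducible algebraic model containing a point of total independence. Precisely: call a set of positive definite matrices algebraic if it is cut out, within the positive definite matrices, by polynomial equations in the entries, and irreducible if moreover it is not the union of two algebraic sets neither of which contains the other. If $\mathcal M$ is irreducible algebraic and contains a diagonal matrix, then the set of $\Sigma\in\mathcal M$ at which $\mathcal M(\mathcal G)$ and $\mathcal M(\mathcal H)$ are 1-equivalent has $d$-dimensional Hausdorff measure zero, where $d$ is the (Hausdorff) dimension of $\mathcal M$. (This applies in particular to every irreducible model defined by conditional independence statements, and to every irreducible component through a point of total independence of an arbitrary such model.)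 -/

import Mathlib

open MeasureTheory ProbabilityTheory Filter Topology
open scoped Matrix.Norms.Frobenius

noncomputable section

/-! ### Local equivalence of models -/

/-- The Hausdorff distance between the parts of `M₁` and `M₂` in the open ball of radius `ε`
around `θ`.  If `θ` is in both sets, both parts are nonempty and bounded, so that this is the
genuine (finite) Hausdorff distance. -/
def localHausdorffDist {E : Type*} [PseudoMetricSpace E] (M₁ M₂ : Set E) (θ : E) (ε : ℝ) : ℝ :=
  Metric.hausdorffDist (M₁ ∩ Metric.ball θ ε) (M₂ ∩ Metric.ball θ ε)

/-- `M₁` and `M₂` are `c`-equivalent at the common point `θ`. -/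
def EquivalentAt {E : Type*} [PseudoMetricSpace E] (c : ℝ) (M₁ M₂ : Set E) (θ : E) : Prop :=
  θ ∈ M₁ ∩ M₂ ∧
    Tendsto (fun ε : ℝ => ε ^ (-c) * localHausdorffDist M₁ M₂ θ ε) (𝓝[>] 0) (𝓝 0)

/-- `M₁` and `M₂` are `c`-near-equivalent at the common point `θ`. -/
def NearEquivalentAt {E : Type*} [PseudoMetricSpace E] (c : ℝ) (M₁ M₂ : Set E) (θ : E) : Prop :=
  θ ∈ M₁ ∩ M₂ ∧
    (fun ε : ℝ => localHausdorffDist M₁ M₂ θ ε) =O[𝓝[>] 0] (fun ε : ℝ => ε ^ c)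

/-- `W` is a null subset of `M`: the part of `W` in `M` has measure zero for the Hausdorff measure
whose exponent is the Hausdorff dimension of `M`.  (For a semialgebraic set `M` this is its usual
dimension, and the measure is the surface measure of that dimension.) -/
def IsNullWithin {E : Type*} [MetricSpace E] (W M : Set E) : Prop :=
  letI : MeasurableSpace E := borel E
  haveI : BorelSpace E := ⟨rfl⟩
  Measure.hausdorffMeasure (dimH M).toReal (W ∩ M) = 0

/-! ### Gaussian conditional independence models -/

/-- A conditional independence statement `X_i ⊥ X_j | X_C`. -/
structure CIStatement (ι : Type*) where
  i : ι
  j : ι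
  C : Finset ι
  i_ne_j : i ≠ j
  i_notMem : i ∉ C
  j_notMem : j ∉ C

/-- An independence model is a collection of conditional independence statements. -/
abbrev IndepModel (ι : Type*) := Set (CIStatement ι)

/-- Two distinct vertices are adjacent in an independence model if it contains no independence
statement between them. -/
def IndepModel.Adjacent {ι : Type*} (J : IndepModel ι) (a b : ι) : Prop :=
  a ≠ b ∧ ¬ ∃ s ∈ J, (s.i = a ∧ s.j = b) ∨ (s.i = b ∧ s.j = a)

/-- The subvector `x_C`. -/
def subvector {ι : Type*} (C : Finset ι) (x : EuclideanSpace ℝ ι) : C → ℝ := fun k => x k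

theorem measurable_subvector {ι : Type*} [Fintype ι] (C : Finset ι) :
    Measurable (subvector C : EuclideanSpace ℝ ι → C → ℝ) := by
  unfold subvector
  fun_prop

/-- The conditional independence statement `s` holds for a random vector `X` with the centred
Gaussian distribution `N(0, S)`. -/
def CIStatement.HoldsFor {ι : Type*} [Fintype ι] [DecidableEq ι] (s : CIStatement ι)
    (S : Matrix ι ι ℝ) : Prop :=
  CondIndepFun (MeasurableSpace.comap (subvector s.C) inferInstance)
    (measurable_subvector s.C).comap_le
    (fun x : EuclideanSpace ℝ ι => x s.i) (fun x : EuclideanSpace ℝ ι => x s.j)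
    (multivariateGaussian 0 S)

/-- The Gaussian model of an independence model: all positive definite covariance matrices for
which all of its independence statements hold. -/
def IndepModel.gaussianModel {ι : Type*} [Fintype ι] [DecidableEq ι] (J : IndepModel ι) :
    Set (Matrix ι ι ℝ) :=
  {S | S.PosDef ∧ ∀ s ∈ J, s.HoldsFor S}

/-- A set of positive definite covariance matrices cut out by polynomial equations in the
entries. -/
def IsAlgebraicModel {ι : Type*} [Fintype ι] (M : Set (Matrix ι ι ℝ)) : Prop :=
  ∃ F : Set (MvPolynomial (ι × ι) ℝ),
    M = {S | S.PosDef ∧ ∀ f ∈ F, MvPolynomial.eval (fun e : ι × ι => S e.1 e.2) f = 0}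

/-- An algebraic model that is not the union of two incomparable algebraic models. -/
def IsIrreducibleModel {ι : Type*} [Fintype ι] (M : Set (Matrix ι ι ℝ)) : Prop :=
  IsAlgebraicModel M ∧
    ¬ ∃ M₁ M₂ : Set (Matrix ι ι ℝ), IsAlgebraicModel M₁ ∧ IsAlgebraicModel M₂ ∧
      M = M₁ ∪ M₂ ∧ ¬ M₁ ⊆ M₂ ∧ ¬ M₂ ⊆ M₁

/-! ### Maximal ancestral graphs -/

/-- A simple mixed graph.  `head a b` says that the edge between `a` and `b` has an arrowhead
at `b`; an edge with no arrowhead is undirected, one with a single arrowhead is directed, and one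
with two arrowheads is bidirected. -/
structure MixedGraph (ι : Type*) where
  skeleton : SimpleGraph ι
  head : ι → ι → Prop
  adj_of_head : ∀ a b, head a b → skeleton.Adj a b

namespace MixedGraph

variable {ι : Type*} (G : MixedGraph ι)

/-- The edge `a - b`. -/
def Undirected (a b : ι) : Prop := G.skeleton.Adj a b ∧ ¬ G.head a b ∧ ¬ G.head b a

/-- The edge `a → b`. -/
def Directed (a b : ι) : Prop := G.head a b ∧ ¬ G.head b a

/-- The edge `a ↔ b`. -/
def Bidirected (a b : ι) : Prop := G.head a b ∧ G.head b a

/-- `a` is anterior to `b`: there is a (possibly trivial) path from `a` to `b` each of whose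
edges is undirected or directed towards `b`. -/
def Anterior (a b : ι) : Prop :=
  Relation.ReflTransGen (fun x y => G.Undirected x y ∨ G.Directed x y) a b

/-- A mixed graph is ancestral if no vertex is anterior to one of its parents or spouses, and a
vertex with an undirected edge has neither parents nor spouses. -/
def IsAncestral : Prop :=
  (∀ a b, G.Directed b a ∨ G.Bidirected b a → ¬ G.Anterior a b) ∧
    ∀ a b c, G.Undirected a b → ¬ (G.Directed c a ∨ G.Bidirected c a)

/-- The edges of `G` between `a, k` and between `k, b` meet in a collider at `k`. -/
def Collider (a k b : ι) : Prop := G.head a k ∧ G.head b k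

/-- The path `p` is m-connecting given `Z`: every noncollider on it is outside `Z`, and every
collider on it is anterior to some vertex of `Z`. -/
def MConnecting {a b : ι} (p : G.skeleton.Walk a b) (Z : Finset ι) : Prop :=
  ∀ n, n + 1 < p.length →
    (G.Collider (p.getVert n) (p.getVert (n + 1)) (p.getVert (n + 2)) →
      ∃ z ∈ Z, G.Anterior (p.getVert (n + 1)) z) ∧
    (¬ G.Collider (p.getVert n) (p.getVert (n + 1)) (p.getVert (n + 2)) →
      p.getVert (n + 1) ∉ Z)

/-- `a` and `b` are m-separated given `Z`. -/
def MSeparated (a b : ι) (Z : Finset ι) : Prop :=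
  ∀ p : G.skeleton.Walk a b, p.IsPath → ¬ G.MConnecting p Z

/-- The independence model given by the (global) Markov property of `G`. -/
def indepModel : IndepModel ι := {s | G.MSeparated s.i s.j s.C}

/-- Each pair of distinct nonadjacent vertices is m-separated by some set. -/
def IsMaximal : Prop :=
  ∀ a b, a ≠ b → ¬ G.skeleton.Adj a b → ∃ Z : Finset ι, a ∉ Z ∧ b ∉ Z ∧ G.MSeparated a b Z

/-- Maximal ancestral graphs. -/
def IsMAG : Prop := G.IsAncestral ∧ G.IsMaximal

/-- The Gaussian model of a graph. -/
def gaussianModel [Fintype ι] [DecidableEq ι] : Set (Matrix ι ι ℝ) :=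
  G.indepModel.gaussianModel

end MixedGraph

end

/-! Let D be a positive diagonal matrix. Near D a graph model agrees to first order with a linear
space that only sees the adjacencies. A separation of a nonadjacent pair i, j is a polynomial
equation (`regressionPoly`) whose derivative at D is a positive multiple of the entry (j, i), so
this entry is of second order on the model (`IsMAG.isBigO_sub_pattern`). Conversely, perturbing a
recursion along the directed edges, a concentration matrix along the undirected ones and a
covariance matrix along the bidirected ones gives an analytic family `chart` inside the model, and
its derivative at D is the projection onto the adjacent entries (`chartDeriv_diagonal`). If the
adjacencies agree, projecting a point of one model onto these entries and applying the chart of the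
other moves it by O(ε²) (`exists_dist_le`).

If i, j are adjacent in one graph only, 1-equivalence at S forces curves through S in that model to
be tangent to the equation of the other model (`EquivalentAt.deriv_eq_zero`). For the chart centred
at S, the derivative of the equation in the direction of the edge is a rational function of S,
regular on all positive definite matrices and nonzero at D. So the exceptional points lie in a
proper algebraic subset of M, which has smaller dimension because M is irreducible
(`dimH_lt_of_vanishing_isPrime`). The dimension theory rests on `exists_isLocalGraph`: near a
generic real zero, the zero set of a prime ideal is a graph over as many coordinates as the
transcendence degree.

Charts exist at every point of the model because each Markov covariance matrix comes from a
recursion on the graph (`IsMarkov.isErrorCov`); there maximality enters as the absence of inducing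
paths. They stay in the model by the global Markov property (`partialUncorrelated_of_mseparated`).
`CIStatement.holdsFor_iff` turns Gaussian conditional independence into linear algebra. -/

/-! ### Dimension of real algebraic sets -/

section TranscendenceDegree

open Polynomial

/-- A surjection of domains that preserves a finite transcendence degree is injective. -/
theorem AlgHom.injective_of_surjective_of_trdeg_le {k A B : Type} [Field k] [CommRing A] [IsDomain A]
    [CommRing B] [IsDomain B] [Algebra k A] [Algebra k B] (f : A →ₐ[k] B)
    (hf : Function.Surjective f) (hfin : Algebra.trdeg k A < Cardinal.aleph0)
    (hle : Algebra.trdeg k A ≤ Algebra.trdeg k B) : Function.Injective f := by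
  obtain ⟨s, hs⟩ := exists_isTranscendenceBasis k B
  obtain ⟨x, hx⟩ : ∃ x : s → A, ∀ i, f (x i) = i := ⟨_, fun i => (hf i).choose_spec⟩
  have hfx : (f ∘ x) = ((↑) : s → B) := funext hx
  have hind : AlgebraicIndependent k x := by
    refine AlgebraicIndependent.of_comp f ?_
    rw [hfx]; exact hs.1
  have htb : IsTranscendenceBasis k x :=
    hind.isTranscendenceBasis_of_trdeg_le hfin (hle.trans hs.cardinalMk_eq_trdeg.ge)
  have halg := htb.isAlgebraic
  rw [injective_iff_map_eq_zero]
  intro a ha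
  by_contra hne
  -- A nonzero algebraic element divides a nonzero element of the base. Here the base is generated
  -- by the lifted basis, and `f` is injective on it.
  obtain ⟨⟨r, hr⟩, hr0, hrt⟩ := (halg.isAlgebraic a).exists_nonzero_dvd
    (mem_nonZeroDivisors_of_ne_zero hne)
  obtain ⟨t, hrt⟩ := hrt
  change r = a * t at hrt
  have hfr : f r = 0 := by rw [hrt, map_mul, ha, zero_mul]
  rw [Algebra.adjoin_range_eq_range_aeval] at hr
  obtain ⟨p, rfl⟩ := hr
  have hp : MvPolynomial.aeval ((↑) : s → B) p = 0 := by
    rw [← hfx, ← hfr]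
    exact (MvPolynomial.comp_aeval_apply _ f p).symm
  have := (injective_iff_map_eq_zero _).1 hs.1 p hp
  subst this
  exact hr0 (Subtype.ext (by simp))

/-- Adjoining an algebraic element does not change the transcendence degree, adjoining a
transcendental one increases it by one. -/
theorem trdeg_quotient_polynomial {k R : Type} [Field k] [CommRing R] [Algebra k R] (P : Ideal R[X])
    [P.IsPrime] :
    Algebra.trdeg k (R[X] ⧸ P) = Algebra.trdeg k (R ⧸ P.under R) +
      (open Classical in if ∀ p ∈ P, ∀ i, p.coeff i ∈ P.under R then 1 else 0) := by
  have : IsScalarTower k (R ⧸ P.under R) (R[X] ⧸ P) := by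
    infer_instance
  rw [← _root_.trdeg_add_eq k (R ⧸ P.under R) (A := R[X] ⧸ P)]
  congr 1
  set x : R[X] ⧸ P := Ideal.Quotient.mk P X with hx
  have hae : ∀ f : R[X], aeval x (f.map (Ideal.Quotient.mk (P.under R))) = Ideal.Quotient.mk P f := by
    intro f
    induction f using Polynomial.induction_on' with
    | add p q hp hq => simp [hp, hq]
    | monomial n a =>
      rw [map_monomial, aeval_monomial, ← C_mul_X_pow_eq_monomial, map_mul, map_pow]
      rfl
  have hsurj : Function.Surjective (aeval x : (R ⧸ P.under R)[X] →ₐ[R ⧸ P.under R] R[X] ⧸ P) := by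
    intro y
    obtain ⟨f, rfl⟩ := Ideal.Quotient.mk_surjective y
    exact ⟨_, hae f⟩
  split_ifs with h
  · have hinj : Function.Injective
        (aeval x : (R ⧸ P.under R)[X] →ₐ[R ⧸ P.under R] R[X] ⧸ P) := by
      rw [injective_iff_map_eq_zero]
      intro g hg
      obtain ⟨f, rfl⟩ := Polynomial.map_surjective _ (Ideal.Quotient.mk_surjective (I := P.under R)) g
      rw [hae, Ideal.Quotient.eq_zero_iff_mem] at hg
      ext i
      rw [coeff_map, coeff_zero, Ideal.Quotient.eq_zero_iff_mem]
      exact h f hg i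
    rw [← (AlgEquiv.ofBijective _ ⟨hinj, hsurj⟩).trdeg_eq, Polynomial.trdeg_of_isDomain]
  · push Not at h
    obtain ⟨p, hp, i, hi⟩ := h
    have halg : IsAlgebraic (R ⧸ P.under R) x := by
      refine ⟨p.map (Ideal.Quotient.mk (P.under R)), ?_, ?_⟩
      · intro h0
        apply hi
        have := congrArg (fun q => q.coeff i) h0
        simpa [coeff_map, Ideal.Quotient.eq_zero_iff_mem] using this
      · rw [hae, Ideal.Quotient.eq_zero_iff_mem]; exact hp
    have htop : Algebra.adjoin (R ⧸ P.under R) {x} = ⊤ := by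
      rw [Algebra.adjoin_singleton_eq_range_aeval, AlgHom.range_eq_top]
      exact hsurj
    have h1 := Algebra.isAlgebraic_adjoin_singleton_iff.2 halg
    rw [htop] at h1
    have : Algebra.IsAlgebraic (R ⧸ P.under R) (R[X] ⧸ P) := by
      rw [Subalgebra.isAlgebraic_iff, Algebra.isAlgebraic_def] at h1
      exact ⟨fun y => (h1 ⟨y, trivial⟩).algHom (Subalgebra.val ⊤)⟩
    exact _root_.trdeg_eq_zero

end TranscendenceDegree

/-! ### Pseudo-division and generic generators of prime ideals -/

section PseudoDivision

open Polynomial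

/-- Division would invert the leading coefficient of `p`; multiplying `f` by it instead allows the
top term to be cancelled over any commutative ring, and the degree drops. -/
theorem Polynomial.exists_leadingCoeff_pow_mul_eq {R : Type*} [CommRing R] (p : R[X])
    (f : R[X]) : ∃ (N : ℕ) (q r : R[X]), C p.leadingCoeff ^ N * f = q * p + r ∧
      (r = 0 ∨ r.degree < p.degree) := by
  by_cases hp : p = 0
  · exact ⟨1, 0, 0, by simp [hp], Or.inl rfl⟩
  induction hn : f.degree using WellFoundedLT.induction generalizing f with
  | ind n ih =>
  subst hn
  rcases lt_or_ge f.degree p.degree with hlt | hge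
  · exact ⟨0, 0, f, by simp, Or.inr hlt⟩
  by_cases hf : f = 0
  · exact ⟨0, 0, 0, by simp [hf], Or.inl rfl⟩
  set g := C p.leadingCoeff * f - C f.leadingCoeff * X ^ (f.natDegree - p.natDegree) * p with hg
  have hnd : p.natDegree ≤ f.natDegree := natDegree_le_natDegree hge
  have hgd : g.degree < f.degree := by
    rw [degree_eq_natDegree hf, degree_lt_iff_coeff_zero]
    intro m hm
    rw [hg, coeff_sub, coeff_C_mul, mul_assoc, coeff_C_mul, coeff_X_pow_mul']
    rw [if_pos (by omega)]
    rcases eq_or_lt_of_le hm with rfl | hlt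
    · rw [Nat.sub_sub_self hnd, coeff_natDegree, coeff_natDegree, mul_comm, sub_self]
    · rw [coeff_eq_zero_of_natDegree_lt hlt, coeff_eq_zero_of_natDegree_lt (p := p) (by omega)]
      simp
  obtain ⟨N, q, r, h1, h2⟩ := ih g.degree hgd g rfl
  refine ⟨N + 1, q + C p.leadingCoeff ^ N * (C f.leadingCoeff * X ^ (f.natDegree - p.natDegree)),
    r, ?_, h2⟩
  calc C p.leadingCoeff ^ (N + 1) * f
      = C p.leadingCoeff ^ N * g + C p.leadingCoeff ^ N *
        (C f.leadingCoeff * X ^ (f.natDegree - p.natDegree)) * p := by rw [hg]; ring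
    _ = _ := by rw [h1]; ring

/-- A prime ideal of `R[X]` that is not extended from `R` is generated by a single polynomial,
up to its trace on `R` and a power of the leading coefficient. -/
theorem Polynomial.exists_generic_generator {R : Type*} [CommRing R] [Algebra ℚ R] (P : Ideal R[X])
    [P.IsPrime] (h : ∃ p ∈ P, ∃ i, p.coeff i ∉ P.under R) :
    ∃ p ∈ P, p.leadingCoeff ∉ P.under R ∧ p.derivative ∉ P ∧
      ∀ f ∈ P, ∃ (N : ℕ) (q r : R[X]), C p.leadingCoeff ^ N * f = q * p + r ∧
        ∀ i, r.coeff i ∈ P.under R := by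
  have hC : ∀ a, a ∈ P.under R ↔ C a ∈ P := fun a => Iff.rfl
  -- Top terms with coefficient in the trace can be stripped without leaving `P`, so some element
  -- has its leading coefficient outside the trace. One of least degree is chosen below.
  have hex : ∃ n, ∃ p ∈ P, p.leadingCoeff ∉ P.under R ∧ p.natDegree = n := by
    obtain ⟨p, hp, i, hi⟩ := h
    induction hn : p.natDegree using Nat.strong_induction_on generalizing p with
    | _ n ih =>
    by_cases hl : p.leadingCoeff ∈ P.under R
    · have hmem : p.eraseLead ∈ P := by
        rw [← self_sub_C_mul_X_pow]
        exact P.sub_mem hp (P.mul_mem_right _ ((hC _).1 hl))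
      have hne : i ≠ p.natDegree := by
        rintro rfl; exact hi hl
      have hi' : p.eraseLead.coeff i ∉ P.under R := by rwa [eraseLead_coeff_of_ne _ hne]
      have hlt : p.eraseLead.natDegree < n := by
        rcases eraseLead_natDegree_lt_or_eraseLead_eq_zero p with h | h
        · omega
        · rw [h] at hi'
          simp at hi'
      exact ih _ hlt _ hmem hi' rfl
    · exact ⟨n, p, hp, hl, hn⟩
  classical
  obtain ⟨p, hp, hl, hn⟩ := Nat.find_spec hex
  have hmin : ∀ q ∈ P, q.natDegree < p.natDegree → q.leadingCoeff ∈ P.under R := by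
    intro q hq hlt
    by_contra hc
    exact Nat.find_min hex (hn ▸ hlt) ⟨q, hq, hc, rfl⟩
  have hsmall : ∀ n, ∀ q ∈ P, q.natDegree = n → q.natDegree < p.natDegree →
      ∀ i, q.coeff i ∈ P.under R := by
    intro n
    induction n using Nat.strong_induction_on with
    | _ n ih =>
    intro q hq hqn hlt i
    have hl := hmin q hq hlt
    have hmem : q.eraseLead ∈ P := by
      rw [← self_sub_C_mul_X_pow]
      exact P.sub_mem hq (P.mul_mem_right _ ((hC _).1 hl))
    by_cases hi : i = q.natDegree
    · rw [hi]; exact hl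
    rw [← eraseLead_coeff_of_ne _ hi]
    rcases eraseLead_natDegree_lt_or_eraseLead_eq_zero q with h | h
    · exact ih _ (by omega) _ hmem rfl (by omega) i
    · rw [h]; simp
  have hdeg : 1 ≤ p.natDegree := by
    by_contra h0
    apply hl
    have h0 : p.natDegree = 0 := by omega
    rw [hC, leadingCoeff, h0, ← eq_C_of_natDegree_eq_zero h0]
    exact hp
  refine ⟨p, hp, hl, ?_, ?_⟩
  -- The coefficient of the derivative in degree `p.natDegree - 1` is `p.natDegree` times the
  -- leading coefficient, and the former factor is invertible in a ℚ-algebra.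
  · intro hd
    have hc := hsmall _ _ hd rfl (natDegree_derivative_lt (by omega)) (p.natDegree - 1)
    rw [coeff_derivative, Nat.sub_add_cancel hdeg, coeff_natDegree] at hc
    apply hl
    have hk : ((p.natDegree - 1 : ℕ) + 1 : R) = algebraMap ℚ R p.natDegree := by
      rw [map_natCast, ← Nat.cast_succ, Nat.succ_eq_add_one, Nat.sub_add_cancel hdeg]
    rw [hk] at hc
    have := (P.under R).mul_mem_right (algebraMap ℚ R (p.natDegree : ℚ)⁻¹) hc
    rwa [mul_assoc, ← map_mul, mul_inv_cancel₀ (by positivity), map_one, mul_one] at this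
  · intro f hf
    obtain ⟨N, q, r, h1, h2⟩ := exists_leadingCoeff_pow_mul_eq p f
    refine ⟨N, q, r, h1, ?_⟩
    have hr : r ∈ P := by
      have : r = C p.leadingCoeff ^ N * f - q * p := by rw [h1]; ring
      rw [this]
      exact P.sub_mem (P.mul_mem_left _ hf) (P.mul_mem_left _ hp)
    rcases h2 with rfl | h2
    · simp
    · by_cases hr0 : r = 0
      · subst hr0; simp
      exact hsmall _ r hr rfl (natDegree_lt_natDegree hr0 h2)

end PseudoDivision

/-! ### Real zeros of a prime ideal near a generic point -/

section LocalStructure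

open MvPolynomial

/-- The common real zeros of a set of polynomials. -/
def realZeros {σ : Type*} (P : Set (MvPolynomial σ ℝ)) : Set (σ → ℝ) :=
  {x | ∀ f ∈ P, eval x f = 0}

/-- Near `x₀` the set `V` is the image of a strictly differentiable retraction that keeps the
coordinates in `T` and only depends on them. -/
def IsLocalGraph {σ : Type*} [Fintype σ] (V : Set (σ → ℝ)) (T : Finset σ) (x₀ : σ → ℝ) : Prop :=
  ∃ φ : (σ → ℝ) → σ → ℝ, (∃ φ' : (σ → ℝ) →L[ℝ] σ → ℝ, HasStrictFDerivAt φ φ' x₀) ∧ φ x₀ = x₀ ∧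
    (∀ᶠ x in 𝓝 x₀, φ x ∈ V) ∧ (∀ᶠ x in 𝓝 x₀, x ∈ V → φ x = x) ∧
    (∀ x, ∀ t ∈ T, φ x t = x t) ∧ ∀ x y, (∀ t ∈ T, x t = y t) → φ x = φ y

/-- A simple real root of a polynomial depends smoothly on the coefficients. -/
theorem exists_implicit_root {n : ℕ} (f : MvPolynomial (Fin (n + 1)) ℝ) (y₀ : Fin n → ℝ) (t₀ : ℝ)
    (hf : eval (Fin.cons t₀ y₀) f = 0)
    (hd : ((finSuccEquiv ℝ n f).derivative.map (eval y₀)).eval t₀ ≠ 0) :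
    ∃ ψ : (Fin n → ℝ) → ℝ, (∃ ψ' : (Fin n → ℝ) →L[ℝ] ℝ, HasStrictFDerivAt ψ ψ' y₀) ∧ ψ y₀ = t₀ ∧
      (∀ᶠ y in 𝓝 y₀, eval (Fin.cons (ψ y) y) f = 0) ∧
      (∀ᶠ v in 𝓝 (y₀, t₀), eval (Fin.cons v.2 v.1) f = 0 → ψ v.1 = v.2) := by
  let L : (Fin n → ℝ) × ℝ → Fin (n + 1) → ℝ := fun v => Fin.cons v.2 v.1
  have hL : ContDiff ℝ 1 L := by
    rw [contDiff_pi]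
    intro i
    refine Fin.cases ?_ (fun j => ?_) i
    · exact contDiff_snd
    · exact (contDiff_apply ℝ ℝ j).comp contDiff_fst
  have hF : ContDiff ℝ 1 (fun v => eval (L v) f) := by
    have : ContDiff ℝ 1 (fun x => eval x f) := by
      rw [← contDiffOn_univ]
      exact (AnalyticOnNhd.eval_mvPolynomial f).contDiffOn uniqueDiffOn_univ
    exact this.comp hL
  obtain ⟨F', hF'⟩ : ∃ F', HasStrictFDerivAt (fun v => eval (L v) f) F' (y₀, t₀) :=
    ⟨_, hF.contDiffAt.hasStrictFDerivAt (by norm_num)⟩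
  have h1 : F' (0, 1) = ((finSuccEquiv ℝ n f).derivative.map (eval y₀)).eval t₀ := by
    have hc : HasDerivAt (fun t : ℝ => (y₀, t)) (0, 1) t₀ :=
      (hasDerivAt_const t₀ y₀).prodMk (hasDerivAt_id t₀)
    have h2 := hF'.hasFDerivAt.comp_hasDerivAt t₀ hc
    have h3 := ((finSuccEquiv ℝ n f).map (eval y₀)).hasDerivAt t₀
    rw [← Polynomial.derivative_map]
    refine h2.unique (h3.congr_of_eventuallyEq (Eventually.of_forall fun t => ?_))
    exact eval_eq_eval_mv_eval' y₀ t f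
  set c := ((finSuccEquiv ℝ n f).derivative.map (eval y₀)).eval t₀
  have hinv : (F' ∘L .inr ℝ (Fin n → ℝ) ℝ).IsInvertible := by
    refine ⟨ContinuousLinearEquiv.smulLeft (Units.mk0 c hd), ?_⟩
    ext
    simp [h1]
  refine ⟨hF'.implicitFunctionOfProdDomain hinv,
    ⟨_, hF'.hasStrictFDerivAt_implicitFunctionOfProdDomain hinv⟩, ?_, ?_, ?_⟩
  · exact (hF'.eventually_apply_eq_iff_implicitFunctionOfProdDomain hinv).self_of_nhds.mp rfl
  · filter_upwards [hF'.eventually_apply_implicitFunctionOfProdDomain hinv] with y hy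
    exact hy.trans hf
  · filter_upwards [hF'.eventually_apply_eq_iff_implicitFunctionOfProdDomain hinv] with v hv h0
    exact hv.1 (h0.trans hf.symm)

theorem exists_hasStrictFDerivAt_finCons {n : ℕ} {E : Type*} [NormedAddCommGroup E] [NormedSpace ℝ E]
    {a : E → ℝ} {b : E → Fin n → ℝ} {x : E} (ha : ∃ a' : E →L[ℝ] ℝ, HasStrictFDerivAt a a' x)
    (hb : ∃ b' : E →L[ℝ] Fin n → ℝ, HasStrictFDerivAt b b' x) :
    ∃ c' : E →L[ℝ] Fin (n + 1) → ℝ,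
      HasStrictFDerivAt (fun y => (Fin.cons (a y) (b y) : Fin (n + 1) → ℝ)) c' x := by
  obtain ⟨a', ha⟩ := ha
  obtain ⟨b', hb⟩ := hb
  rw [hasStrictFDerivAt_pi'] at hb
  refine ⟨ContinuousLinearMap.pi
    (Fin.cons a' (fun i => (ContinuousLinearMap.proj i).comp b') : Fin (n + 1) → E →L[ℝ] ℝ), ?_⟩
  rw [hasStrictFDerivAt_pi]
  intro i
  refine Fin.cases ?_ (fun j => ?_) i
  · exact ha
  · exact hb j

/-- Induction on the number of variables, splitting off coordinate 0. If all coefficients of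
elements of `P` lie in its trace, coordinate 0 is free and joins `T`. Otherwise, where the leading
coefficient and the derivative of a generic generator `p` do not vanish, `p = 0` determines
coordinate 0 smoothly from the others, and pseudo-division makes the rest of `P` vanish along with
`p`. The transcendence degree grows exactly when `T` does. -/
theorem exists_isLocalGraph (n : ℕ) (P : Ideal (MvPolynomial (Fin n) ℝ)) [P.IsPrime] :
    ∃ T : Finset (Fin n), (T.card : Cardinal) = Algebra.trdeg ℝ (MvPolynomial (Fin n) ℝ ⧸ P) ∧
      ∃ e ∉ P, ∀ x₀ ∈ realZeros (P : Set (MvPolynomial (Fin n) ℝ)), eval x₀ e ≠ 0 →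
        IsLocalGraph (realZeros (P : Set (MvPolynomial (Fin n) ℝ))) T x₀ := by
  induction n with
  | zero =>
    refine ⟨∅, ?_, 1, (Ideal.ne_top_iff_one P).1 ‹P.IsPrime›.ne_top, ?_⟩
    · have := _root_.trdeg_le_of_surjective
        (Ideal.Quotient.mkₐ ℝ P) (Ideal.Quotient.mkₐ_surjective ℝ P)
      rw [MvPolynomial.trdeg_of_isDomain] at this
      simp at this
      simp [this]
    · intro x₀ hx₀ _
      have hsub : ∀ x : Fin 0 → ℝ, x = x₀ := fun x => Subsingleton.elim _ _
      exact ⟨id, ⟨_, hasStrictFDerivAt_id x₀⟩, rfl, Eventually.of_forall fun x => by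
        rw [hsub x]; exact hx₀, by simp, by simp, fun x y _ => by rw [hsub x, hsub y]⟩
  | succ n ih =>
    set Φ := finSuccEquiv ℝ n
    set P' : Ideal (Polynomial (MvPolynomial (Fin n) ℝ)) := P.comap (Φ.symm : _ →+* _) with hP'
    have hmem : ∀ f, f ∈ P ↔ Φ f ∈ P' := fun f => by simp [hP', Ideal.mem_comap]
    have hP'p : P'.IsPrime := Ideal.comap_isPrime _ _
    have hev : ∀ y t f, eval (Fin.cons t y : Fin (n + 1) → ℝ) f =
      ((Φ f).map (eval y)).eval t := eval_eq_eval_mv_eval'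
    have hz : ∀ y t, (Fin.cons t y : Fin (n + 1) → ℝ) ∈ realZeros (P : Set (MvPolynomial _ ℝ)) ↔
        ∀ g ∈ P', (g.map (eval y)).eval t = 0 := by
      intro y t
      constructor
      · intro h g hg
        have := h (Φ.symm g) ((hmem _).2 (by simpa using hg))
        rwa [hev, AlgEquiv.apply_symm_apply] at this
      · intro h f hf
        rw [hev]; exact h _ ((hmem f).1 hf)
    have hzt : ∀ y t, (Fin.cons t y : Fin (n + 1) → ℝ) ∈ realZeros (P : Set (MvPolynomial _ ℝ)) →
        y ∈ realZeros ((P'.under (MvPolynomial (Fin n) ℝ) : Ideal _) : Set (MvPolynomial _ ℝ)) := by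
      intro y t h a ha
      have := (hz y t).1 h (Polynomial.C a) ha
      simpa using this
    have htr : Algebra.trdeg ℝ (MvPolynomial (Fin (n + 1)) ℝ ⧸ P) =
        Algebra.trdeg ℝ (Polynomial (MvPolynomial (Fin n) ℝ) ⧸ P') := by
      refine (Ideal.quotientEquivAlg P P' Φ ?_).trdeg_eq
      refine le_antisymm (fun g hg => ?_) (Ideal.map_le_iff_le_comap.2 fun f hf => (hmem f).1 hf)
      rw [← Φ.apply_symm_apply g]
      exact Ideal.mem_map_of_mem _ hg
    rw [htr, trdeg_quotient_polynomial]
    obtain ⟨T, hT, e, he, hgraph⟩ := ih (P'.under (MvPolynomial (Fin n) ℝ))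
    have hproj : ∀ x₀ : Fin (n + 1) → ℝ,
        HasStrictFDerivAt (fun x : Fin (n + 1) → ℝ => Fin.tail x)
          (ContinuousLinearMap.pi fun i => ContinuousLinearMap.proj i.succ) x₀ := fun x₀ =>
      (ContinuousLinearMap.pi fun i : Fin n =>
        (ContinuousLinearMap.proj i.succ : (Fin (n + 1) → ℝ) →L[ℝ] ℝ)).hasStrictFDerivAt
    have htail : ∀ x₀ : Fin (n + 1) → ℝ, Tendsto (fun x : Fin (n + 1) → ℝ => Fin.tail x) (𝓝 x₀)
        (𝓝 (Fin.tail x₀)) := fun x₀ => (hproj x₀).continuousAt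
    have hcons : ∀ x : Fin (n + 1) → ℝ, x = Fin.cons (x 0) (Fin.tail x) := fun x =>
      (Fin.cons_self_tail x).symm
    have hsucc : ∀ i : Fin n, ∀ x : Fin (n + 1) → ℝ, Fin.tail x i = x i.succ := fun _ _ => rfl
    by_cases h : ∀ p ∈ P', ∀ i, p.coeff i ∈ P'.under (MvPolynomial (Fin n) ℝ)
    · refine ⟨insert 0 (T.map (Fin.succEmb n)), ?_, Φ.symm (Polynomial.C e), ?_, ?_⟩
      · rw [Finset.card_insert_of_notMem (by simp [Fin.succ_ne_zero]), Finset.card_map, if_pos h,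
          ← hT]
        push_cast; rfl
      · rw [hmem, AlgEquiv.apply_symm_apply]
        exact he
      · intro x₀ hx₀ hne
        rw [hcons x₀] at hx₀ hne
        rw [hev, AlgEquiv.apply_symm_apply, Polynomial.map_C, Polynomial.eval_C] at hne
        obtain ⟨φ, ⟨φ', hφ'⟩, h0, hin, hret, hkeep, hdep⟩ := hgraph _ (hzt _ _ hx₀) hne
        refine ⟨fun x => Fin.cons (x 0) (φ (Fin.tail x)), ?_, ?_, ?_, ?_, ?_, ?_⟩
        · exact exists_hasStrictFDerivAt_finCons
            ⟨_, (ContinuousLinearMap.proj (R := ℝ) (φ := fun _ : Fin (n + 1) => ℝ)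
              0).hasStrictFDerivAt⟩ ⟨_, HasStrictFDerivAt.comp x₀ hφ' (hproj x₀)⟩
        · change Fin.cons (x₀ 0) (φ (Fin.tail x₀)) = x₀
          rw [h0, ← hcons]
        · filter_upwards [(htail x₀).eventually hin] with x hx
          rw [hz]
          intro g hg
          have : g.map (eval (φ (Fin.tail x))) = 0 := by
            ext i
            rw [Polynomial.coeff_map]
            exact hx _ (h g hg i)
          rw [this, Polynomial.eval_zero]
        · filter_upwards [(htail x₀).eventually hret] with x hx hxz
          rw [hcons x] at hxz
          rw [hx (hzt _ _ hxz), ← hcons]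
        · intro x t ht
          rw [Finset.mem_insert, Finset.mem_map] at ht
          rcases ht with rfl | ⟨i, hi, rfl⟩
          · rfl
          · exact hkeep (Fin.tail x) i hi
        · intro x y hxy
          have h1 := hxy 0 (Finset.mem_insert_self _ _)
          have h2 : φ (Fin.tail x) = φ (Fin.tail y) := hdep _ _ fun t ht =>
            hxy t.succ (Finset.mem_insert_of_mem (Finset.mem_map_of_mem (Fin.succEmb n) ht))
          simp only [h1, h2]
    · have h' := h
      push Not at h'
      obtain ⟨p, hp, hl, hd, hgen⟩ := Polynomial.exists_generic_generator P' h'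
      refine ⟨T.map (Fin.succEmb n), ?_,
        Φ.symm (Polynomial.C e * Polynomial.C p.leadingCoeff * p.derivative), ?_, ?_⟩
      · rw [Finset.card_map, if_neg h, ← hT, add_zero]
      · rw [hmem, AlgEquiv.apply_symm_apply]
        exact hP'p.mul_notMem (hP'p.mul_notMem he hl) hd
      · intro x₀ hx₀ hne
        rw [hcons x₀] at hx₀ hne
        rw [hev, AlgEquiv.apply_symm_apply] at hne
        simp only [Polynomial.map_mul, Polynomial.map_C, Polynomial.eval_mul, Polynomial.eval_C]
          at hne
        have hne1 : eval (Fin.tail x₀) e ≠ 0 := fun h => hne (by rw [h]; ring)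
        have hne2 : eval (Fin.tail x₀) p.leadingCoeff ≠ 0 := fun h => hne (by rw [h]; ring)
        have hne3 : (p.derivative.map (eval (Fin.tail x₀))).eval (x₀ 0) ≠ 0 :=
          fun h => hne (by rw [h]; ring)
        obtain ⟨φ, ⟨φ', hφ'⟩, h0, hin, hret, hkeep, hdep⟩ := hgraph _ (hzt _ _ hx₀) hne1
        obtain ⟨ψ, ⟨ψ', hψ'⟩, hψ0, hroot, huniq⟩ := exists_implicit_root (Φ.symm p) (Fin.tail x₀)
          (x₀ 0) (hx₀ _ ((hmem _).2 (by rwa [AlgEquiv.apply_symm_apply])))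
          (by rwa [AlgEquiv.apply_symm_apply])
        have hφt : Tendsto (fun x : Fin (n + 1) → ℝ => φ (Fin.tail x)) (𝓝 x₀)
            (𝓝 (Fin.tail x₀)) := by
          have := hφ'.continuousAt.tendsto.comp (htail x₀)
          rwa [h0] at this
        rw [← h0] at hψ'
        refine ⟨fun x => Fin.cons (ψ (φ (Fin.tail x))) (φ (Fin.tail x)), ?_, ?_, ?_, ?_, ?_, ?_⟩
        · have hc := HasStrictFDerivAt.comp x₀ hφ' (hproj x₀)
          exact exists_hasStrictFDerivAt_finCons ⟨_, HasStrictFDerivAt.comp x₀ hψ' hc⟩ ⟨_, hc⟩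
        · change Fin.cons (ψ (φ (Fin.tail x₀))) (φ (Fin.tail x₀)) = x₀
          rw [h0, hψ0, ← hcons]
        · have hlc : ∀ᶠ y in 𝓝 (Fin.tail x₀), eval y p.leadingCoeff ≠ 0 :=
            (MvPolynomial.continuous_eval p.leadingCoeff).continuousAt.eventually_ne hne2
          filter_upwards [(htail x₀).eventually hin, hφt.eventually hroot,
            hφt.eventually hlc] with x hx hrx hlx
          rw [hz]
          intro g hg
          obtain ⟨N, q, r, h1, h2⟩ := hgen g hg
          set y := φ (Fin.tail x)
          have hr : r.map (eval y) = 0 := by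
            ext i
            rw [Polynomial.coeff_map]
            exact hx _ (h2 i)
          rw [hev, AlgEquiv.apply_symm_apply] at hrx
          -- At the root a power of the leading coefficient times the value of `g` is zero, and the
          -- leading coefficient stays nonzero near `x₀`.
          have h3 := congrArg (fun f => (f.map (eval y)).eval (ψ y)) h1
          simp only [Polynomial.map_mul, Polynomial.map_add, Polynomial.map_pow, Polynomial.map_C,
            Polynomial.eval_mul, Polynomial.eval_pow, Polynomial.eval_C, hrx, hr, mul_zero, add_zero] at h3
          exact (mul_eq_zero.1 h3).resolve_left (pow_ne_zero _ hlx)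
        · have hpair : Tendsto (fun x : Fin (n + 1) → ℝ => (Fin.tail x, x 0)) (𝓝 x₀)
              (𝓝 (Fin.tail x₀, x₀ 0)) := (htail x₀).prodMk_nhds ((continuous_apply 0).continuousAt)
          filter_upwards [(htail x₀).eventually hret, hpair.eventually huniq] with x hx hux hxz
          rw [hcons x] at hxz
          rw [hx (hzt _ _ hxz)]
          have : ψ (Fin.tail x) = x 0 :=
            hux (hxz _ ((hmem _).2 (by rwa [AlgEquiv.apply_symm_apply])))
          rw [this, ← hcons]
        · intro x t ht
          rw [Finset.mem_map] at ht
          obtain ⟨i, hi, rfl⟩ := ht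
          exact hkeep (Fin.tail x) i hi
        · intro x y hxy
          have h2 : φ (Fin.tail x) = φ (Fin.tail y) := hdep _ _ fun t ht =>
            hxy t.succ (Finset.mem_map_of_mem (Fin.succEmb n) ht)
          simp only [h2]

end LocalStructure

/-! ### Hausdorff dimension and transcendence degree -/

section HausdorffDimension

open MvPolynomial

variable {n : ℕ}

/-- Overwriting the coordinates in `T` of a point. -/
theorem overwrite_tendsto {σ : Type*} [Fintype σ] [DecidableEq σ] (T : Finset σ) (x₀ : σ → ℝ) :
    Tendsto (fun u : T → ℝ => fun i => if h : i ∈ T then u ⟨i, h⟩ else x₀ i)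
      (𝓝 fun t : T => x₀ t) (𝓝 x₀) := by
  rw [tendsto_pi_nhds]
  intro i
  by_cases h : i ∈ T
  · simpa [h] using (continuous_apply (⟨i, h⟩ : T)).tendsto (fun t : T => x₀ t)
  · simp [h]

/-- The retraction keeps the coordinates in `T`, so the projection of `V ∩ O` to them contains an
open set, and a Lipschitz map does not raise the dimension. -/
theorem IsLocalGraph.le_dimH {σ : Type*} [Fintype σ] [DecidableEq σ] {V O : Set (σ → ℝ)}
    {T : Finset σ} {x₀ : σ → ℝ} (h : IsLocalGraph V T x₀) (hO : O ∈ 𝓝 x₀) :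
    (T.card : ENNReal) ≤ dimH (V ∩ O) := by
  obtain ⟨φ, ⟨φ', hφ'⟩, h0, hin, -, hkeep, -⟩ := h
  let π : (σ → ℝ) →L[ℝ] (T → ℝ) := ContinuousLinearMap.pi fun t => ContinuousLinearMap.proj t.1
  have hφ : Tendsto φ (𝓝 x₀) (𝓝 x₀) := by simpa [h0] using hφ'.continuousAt.tendsto
  have hev : ∀ᶠ x in 𝓝 x₀, φ x ∈ V ∩ O := hin.and (hφ.eventually hO)
  have hmem : π '' (V ∩ O) ∈ 𝓝 (fun t : T => x₀ t) := by
    filter_upwards [(overwrite_tendsto T x₀).eventually hev] with u hu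
    refine ⟨_, hu, ?_⟩
    funext t
    change φ _ t.1 = u t
    rw [hkeep _ _ t.2, dif_pos t.2]
  have := Real.dimH_of_mem_nhds hmem
  rw [Module.finrank_fintype_fun_eq_card, Fintype.card_coe] at this
  rw [← this]
  exact (ContinuousLinearMap.lipschitz π).dimH_image_le _

/-- Hausdorff dimension can be tested near points. Near each of its points `X` is contained in a
Lipschitz image of a piece of `T → ℝ`, because `φ` fixes `X` and depends only on the coordinates in
`T`. -/
theorem dimH_le_of_isLocalGraph {σ : Type*} [Fintype σ] [DecidableEq σ] {V X : Set (σ → ℝ)}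
    {T : Finset σ} (hX : X ⊆ V) (h : ∀ x ∈ X, IsLocalGraph V T x) :
    dimH X ≤ T.card := by
  by_contra hlt
  rw [not_le] at hlt
  obtain ⟨x, hx, hbig⟩ := exists_mem_nhdsWithin_lt_dimH_of_lt_dimH hlt
  obtain ⟨φ, ⟨φ', hφ'⟩, h0, -, hret, -, hdep⟩ := h x hx
  obtain ⟨K, U, hU, hlip⟩ := hφ'.exists_lipschitzOnWith
  let E : (T → ℝ) → σ → ℝ := fun u i => if h : i ∈ T then u ⟨i, h⟩ else x i
  have hE : LipschitzWith 1 E := by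
    refine LipschitzWith.of_dist_le_mul fun u v => ?_
    rw [NNReal.coe_one, one_mul, dist_pi_le_iff dist_nonneg]
    intro i
    by_cases h : i ∈ T
    · simpa [E, h] using dist_le_pi_dist u v ⟨i, h⟩
    · simp [E, h]
  have hπ : Tendsto (fun y : σ → ℝ => fun t : T => y t) (𝓝 x) (𝓝 fun t : T => x t) := by
    rw [tendsto_pi_nhds]
    exact fun t => (continuous_apply t.1).continuousAt
  have hEU : ∀ᶠ y in 𝓝 x, E (fun t : T => y t) ∈ U :=
    ((overwrite_tendsto T x).comp hπ).eventually hU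
  have ht : {y | y ∈ X ∧ φ y = y ∧ E (fun t : T => y t) ∈ U} ∈ 𝓝[X] x := by
    filter_upwards [self_mem_nhdsWithin, nhdsWithin_le_nhds hret, nhdsWithin_le_nhds hEU]
      with y hy h1 h2
    exact ⟨hy, h1 (hX hy), h2⟩
  refine absurd (hbig _ ht) (not_lt.2 ?_)
  have hsub : {y | y ∈ X ∧ φ y = y ∧ E (fun t : T => y t) ∈ U} ⊆ (φ ∘ E) '' (E ⁻¹' U) := by
    rintro y ⟨-, h1, h2⟩
    refine ⟨fun t => y t, h2, ?_⟩
    rw [Function.comp_apply, ← h1]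
    refine hdep _ _ fun t ht => ?_
    simp [E, ht, h1]
  refine (dimH_mono hsub).trans ?_
  have hl : LipschitzOnWith (K * 1) (φ ∘ E) (E ⁻¹' U) :=
    hlip.comp hE.lipschitzOnWith (Set.mapsTo_preimage _ _)
  refine hl.dimH_image_le.trans ((dimH_mono (Set.subset_univ _)).trans ?_)
  rw [Real.dimH_univ_pi, Fintype.card_coe]

/-- The Hausdorff dimension of a real algebraic set is at most its algebraic dimension. -/
theorem dimH_realZeros_le (d : ℕ) (I : Ideal (MvPolynomial (Fin n) ℝ))
    (hI : ∀ Q : Ideal (MvPolynomial (Fin n) ℝ), Q.IsPrime → I ≤ Q →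
      Algebra.trdeg ℝ (MvPolynomial (Fin n) ℝ ⧸ Q) ≤ d) :
    dimH (realZeros (I : Set (MvPolynomial (Fin n) ℝ))) ≤ d := by
  -- Noetherian induction: for a prime ideal the generic points are handled by local graphs and the
  -- others satisfy one more equation; the zeros of a nonprime ideal are covered by those of two
  -- larger ideals.
  induction I using WellFoundedGT.induction with
  | ind I ih =>
  have hstep : ∀ f ∉ I, dimH (realZeros ((I ⊔ Ideal.span {f} : Ideal _) : Set (MvPolynomial (Fin n) ℝ)))
      ≤ d := by
    intro f hf
    refine ih _ (lt_of_le_of_ne le_sup_left fun h => hf ?_)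
      fun Q hQ hle => hI Q hQ (le_sup_left.trans hle)
    rw [h]
    exact Ideal.mem_sup_right (Ideal.mem_span_singleton_self f)
  have hadd : ∀ f x, x ∈ realZeros (I : Set (MvPolynomial (Fin n) ℝ)) → eval x f = 0 →
      x ∈ realZeros ((I ⊔ Ideal.span {f} : Ideal _) : Set (MvPolynomial (Fin n) ℝ)) := by
    intro f x hx hfx g hg
    obtain ⟨a, ha, b, hb, rfl⟩ := Submodule.mem_sup.1 hg
    obtain ⟨c, rfl⟩ := Ideal.mem_span_singleton'.1 hb
    rw [map_add, map_mul, hx a ha, hfx, mul_zero, add_zero]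
  by_cases htop : I = ⊤
  · have : realZeros (I : Set (MvPolynomial (Fin n) ℝ)) = ∅ := by
      refine Set.eq_empty_of_forall_notMem fun x hx => ?_
      simpa using hx 1 (by rw [htop]; trivial)
    rw [this, dimH_empty]
    exact zero_le
  by_cases hp : I.IsPrime
  · obtain ⟨T, hT, e, he, hloc⟩ := exists_isLocalGraph n I
    have hcard : T.card ≤ d := by
      have := hI I hp le_rfl
      rw [← hT] at this
      exact_mod_cast this
    have hsub : realZeros (I : Set (MvPolynomial (Fin n) ℝ)) ⊆
        {x | x ∈ realZeros (I : Set (MvPolynomial (Fin n) ℝ)) ∧ eval x e ≠ 0} ∪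
          realZeros ((I ⊔ Ideal.span {e} : Ideal _) : Set (MvPolynomial (Fin n) ℝ)) := by
      intro x hx
      by_cases hex : eval x e = 0
      · exact Or.inr (hadd e x hx hex)
      · exact Or.inl ⟨hx, hex⟩
    refine (dimH_mono hsub).trans ?_
    rw [dimH_union]
    refine max_le ?_ (hstep e he)
    refine (dimH_le_of_isLocalGraph (fun x hx => hx.1) fun x hx => hloc x hx.1 hx.2).trans ?_
    exact_mod_cast hcard
  · rw [Ideal.isPrime_iff, not_and_or] at hp
    rcases hp with hp | hp
    · exact absurd htop hp
    push Not at hp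
    obtain ⟨f, g, hfg, hf, hg⟩ := hp
    have hsub : realZeros (I : Set (MvPolynomial (Fin n) ℝ)) ⊆
        realZeros ((I ⊔ Ideal.span {f} : Ideal _) : Set (MvPolynomial (Fin n) ℝ)) ∪
          realZeros ((I ⊔ Ideal.span {g} : Ideal _) : Set (MvPolynomial (Fin n) ℝ)) := by
      intro x hx
      have := hx _ hfg
      rw [map_mul, mul_eq_zero] at this
      exact this.imp (hadd f x hx) (hadd g x hx)
    refine (dimH_mono hsub).trans ?_
    rw [dimH_union]
    exact max_le (hstep f hf) (hstep g hg)

/-- The ideal of the polynomials that vanish on a set of points. -/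
def vanishing {σ : Type*} (X : Set (σ → ℝ)) : Ideal (MvPolynomial σ ℝ) where
  carrier := {f | ∀ x ∈ X, eval x f = 0}
  add_mem' hf hg x hx := by rw [map_add, hf x hx, hg x hx, add_zero]
  zero_mem' x _ := map_zero _
  smul_mem' c f hf x hx := by rw [smul_eq_mul, map_mul, hf x hx, mul_zero]

/-- A proper algebraic subset of an irreducible algebraic set has smaller dimension. -/
theorem dimH_lt_of_vanishing_isPrime {O M W : Set (Fin n → ℝ)} (hO : IsOpen O)
    (hM : M = realZeros (vanishing M : Set (MvPolynomial (Fin n) ℝ)) ∩ O)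
    (hprime : (vanishing M).IsPrime) (hlt : vanishing M < vanishing W) :
    W = ∅ ∨ dimH W < dimH M := by
  obtain ⟨T, hT, e, he, hloc⟩ := exists_isLocalGraph n (vanishing M)
  have hMdim : (T.card : ENNReal) ≤ dimH M := by
    -- A prime ideal may have too few real zeros, but an ideal of all polynomials vanishing on `M`
    -- leaves a point of `M` where `e` is nonzero.
    have : ∃ x ∈ M, eval x e ≠ 0 := by
      by_contra hc
      push Not at hc
      exact he hc
    obtain ⟨x, hx, hex⟩ := this
    have hx' := hx
    rw [hM] at hx' ⊢
    exact (hloc x hx'.1 hex).le_dimH (hO.mem_nhds hx'.2)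
  -- Were the transcendence degree not smaller, the surjection of coordinate rings would be
  -- injective and the two ideals would coincide.
  have hdrop : ∀ Q : Ideal (MvPolynomial (Fin n) ℝ), Q.IsPrime → vanishing W ≤ Q →
      Algebra.trdeg ℝ (MvPolynomial (Fin n) ℝ ⧸ Q) < T.card := by
    intro Q hQ hle
    have hPQ : vanishing M < Q := hlt.trans_le hle
    rw [hT]
    by_contra hc
    rw [not_lt] at hc
    have hinj := AlgHom.injective_of_surjective_of_trdeg_le
      (Ideal.Quotient.factorₐ ℝ hPQ.le) (Ideal.Quotient.factor_surjective hPQ.le)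
      (by rw [← hT]; exact Cardinal.natCast_lt_aleph0) hc
    refine hPQ.not_ge fun f hf => ?_
    rw [← Ideal.Quotient.eq_zero_iff_mem]
    apply hinj
    rw [map_zero, Ideal.Quotient.factorₐ_apply_mk, Ideal.Quotient.eq_zero_iff_mem]
    exact hf
  have hWsub : W ⊆ realZeros (vanishing W : Set (MvPolynomial (Fin n) ℝ)) :=
    fun x hx f hf => hf x hx
  -- In dimension zero there is no smaller dimension: no prime ideal contains the ideal of `W`, so
  -- `W` is empty.
  rcases Nat.eq_zero_or_pos T.card with h0 | hpos
  · left
    have htop : vanishing W = ⊤ := by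
      by_contra hne
      obtain ⟨Q, hQ, hle⟩ := Ideal.exists_le_maximal _ hne
      have := hdrop Q hQ.isPrime hle
      rw [h0, Nat.cast_zero] at this
      exact absurd this not_lt_zero
    refine Set.eq_empty_of_forall_notMem fun x hx => ?_
    have h1 : (1 : MvPolynomial (Fin n) ℝ) ∈ vanishing W := by rw [htop]; trivial
    simpa using h1 x hx
  · right
    have hle : dimH W ≤ (T.card - 1 : ℕ) := by
      refine (dimH_mono hWsub).trans (dimH_realZeros_le _ _ fun Q hQ hle => ?_)
      have := hdrop Q hQ hle
      obtain ⟨m, hm⟩ := Cardinal.lt_aleph0.1 (this.trans Cardinal.natCast_lt_aleph0)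
      rw [hm] at this ⊢
      have : m < T.card := by exact_mod_cast this
      exact_mod_cast Nat.le_sub_one_of_lt this
    refine (hle.trans_lt ?_).trans_le hMdim
    exact_mod_cast Nat.sub_lt hpos one_pos

end HausdorffDimension

/-! ### Algebraic models of positive definite matrices -/

section IrreducibleModels

open Matrix

variable {ι : Type*} [Fintype ι]

theorem Matrix.posDef_iff_forall_sphere {A : Matrix ι ι ℝ} (hA : A.IsHermitian) :
    A.PosDef ↔ ∀ x ∈ Metric.sphere (0 : ι → ℝ) 1, 0 < x ⬝ᵥ A *ᵥ x := by
  constructor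
  · intro h x hx
    have hx0 : x ≠ 0 := by
      rintro rfl
      simp at hx
    simpa using h.dotProduct_mulVec_pos hx0
  · intro h
    refine PosDef.of_dotProduct_mulVec_pos hA fun x hx => ?_
    have hn : 0 < ‖x‖ := norm_pos_iff.2 hx
    have := h (‖x‖⁻¹ • x) (by
      rw [mem_sphere_zero_iff_norm, norm_smul, norm_inv, norm_norm, inv_mul_cancel₀ hn.ne'])
    rw [mulVec_smul, smul_dotProduct, dotProduct_smul, smul_smul, smul_eq_mul] at this
    have h2 : 0 < ‖x‖⁻¹ * ‖x‖⁻¹ := by positivity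
    simpa using (mul_pos_iff_of_pos_left h2).1 this

theorem Matrix.eventually_forall_sphere_pos {A : Matrix ι ι ℝ}
    (hA : ∀ x ∈ Metric.sphere (0 : ι → ℝ) 1, 0 < x ⬝ᵥ A *ᵥ x) :
    ∀ᶠ B in 𝓝 A, ∀ x ∈ Metric.sphere (0 : ι → ℝ) 1, 0 < x ⬝ᵥ B *ᵥ x := by
  refine (isCompact_sphere (0 : ι → ℝ) 1).eventually_forall_of_forall_eventually fun x hx => ?_
  have hc : Continuous fun p : Matrix ι ι ℝ × (ι → ℝ) => p.2 ⬝ᵥ p.1 *ᵥ p.2 := by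
    fun_prop
  exact hc.continuousAt.eventually (lt_mem_nhds (hA x hx))

/-- Positive definiteness is an open condition on symmetric matrices. -/
theorem Matrix.PosDef.eventually_nhds {A : Matrix ι ι ℝ} (hA : A.PosDef) :
    ∀ᶠ B in 𝓝 A, B.IsHermitian → B.PosDef := by
  filter_upwards [eventually_forall_sphere_pos ((posDef_iff_forall_sphere hA.1).1 hA)] with B hB hh
  exact (posDef_iff_forall_sphere hh).2 hB

/-- Matrices as points of a coordinate space. -/
noncomputable def matrixCoords (ι : Type*) [Fintype ι] :
    Matrix ι ι ℝ ≃L[ℝ] (Fin (Fintype.card (ι × ι)) → ℝ) :=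
  LinearEquiv.toContinuousLinearEquiv
    { toFun := fun S k => S ((Fintype.equivFin (ι × ι)).symm k).1 ((Fintype.equivFin (ι × ι)).symm k).2
      invFun := fun x => Matrix.of fun i j => x (Fintype.equivFin (ι × ι) (i, j))
      map_add' := fun _ _ => rfl
      map_smul' := fun _ _ => rfl
      left_inv := fun S => by ext i j; simp
      right_inv := fun x => by ext k; simp }

theorem eval_matrixCoords (S : Matrix ι ι ℝ) (f : MvPolynomial (ι × ι) ℝ) :
    MvPolynomial.eval (matrixCoords ι S) (MvPolynomial.rename (Fintype.equivFin (ι × ι)) f) =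
      MvPolynomial.eval (fun e : ι × ι => S e.1 e.2) f := by
  rw [MvPolynomial.eval_rename]
  congr 2
  funext e
  change S ((Fintype.equivFin (ι × ι)).symm (Fintype.equivFin (ι × ι) e)).1 _ = _
  simp

/-- The part of an algebraic model cut out by one more polynomial. -/
theorem IsAlgebraicModel.inter_zero {M : Set (Matrix ι ι ℝ)} (hM : IsAlgebraicModel M)
    (h : MvPolynomial (ι × ι) ℝ) :
    IsAlgebraicModel {S | S ∈ M ∧ MvPolynomial.eval (fun e : ι × ι => S e.1 e.2) h = 0} := by
  obtain ⟨F, rfl⟩ := hM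
  refine ⟨insert h F, ?_⟩
  ext S
  simp only [Set.mem_ofPred_eq, Set.forall_mem_insert]
  tauto

/-- If `f * g` vanishes on `M` and neither factor does, the loci of `f` and `g` cover `M`. A point
where `f` is nonzero lies in the second locus only, and vice versa, so the loci are incomparable. -/
theorem isPrime_vanishing_of_isIrreducibleModel {M : Set (Matrix ι ι ℝ)} (hM : IsIrreducibleModel M)
    (hne : M.Nonempty) : (vanishing (matrixCoords ι '' M)).IsPrime := by
  have hmem : ∀ f : MvPolynomial (Fin (Fintype.card (ι × ι))) ℝ,
      f ∈ vanishing (matrixCoords ι '' M) ↔ ∀ S ∈ M, MvPolynomial.eval (fun e : ι × ι => S e.1 e.2)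
        (MvPolynomial.rename (Fintype.equivFin (ι × ι)).symm f) = 0 := by
    intro f
    change (∀ x ∈ _, _) ↔ _
    rw [Set.forall_mem_image]
    refine forall₂_congr fun S _ => ?_
    rw [← eval_matrixCoords, MvPolynomial.rename_rename, Equiv.self_comp_symm, MvPolynomial.rename_id,
      AlgHom.id_apply]
  rw [Ideal.isPrime_iff]
  constructor
  · obtain ⟨S, hS⟩ := hne
    rw [Ideal.ne_top_iff_one, hmem]
    intro h
    simpa using h S hS
  · intro f g hfg
    by_contra hc
    rw [not_or, hmem, hmem] at hc
    rw [hmem] at hfg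
    push Not at hc
    obtain ⟨⟨A, hA, hAf⟩, B, hB, hBg⟩ := hc
    have hAg := hfg A hA
    have hBf := hfg B hB
    rw [map_mul, map_mul, mul_eq_zero] at hAg hBf
    refine hM.2 ⟨_, _, hM.1.inter_zero (MvPolynomial.rename (Fintype.equivFin (ι × ι)).symm f),
      hM.1.inter_zero (MvPolynomial.rename (Fintype.equivFin (ι × ι)).symm g), ?_, ?_, ?_⟩
    · ext S
      constructor
      · intro hS
        have := hfg S hS
        rw [map_mul, map_mul, mul_eq_zero] at this
        exact this.imp (fun h => ⟨hS, h⟩) (fun h => ⟨hS, h⟩)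
      · rintro (h | h) <;> exact h.1
    · exact fun h => hBg (h ⟨hB, hBf.resolve_right hBg⟩).2
    · exact fun h => hAf (h ⟨hA, hAg.resolve_left hAf⟩).2

/-- Positive definiteness splits into symmetry, which consists of equations in the vanishing ideal,
and positivity on the unit sphere, which is open by compactness. -/
theorem IsAlgebraicModel.image_matrixCoords {M : Set (Matrix ι ι ℝ)} (hM : IsAlgebraicModel M) :
    ∃ O, IsOpen O ∧ matrixCoords ι '' M =
      realZeros (vanishing (matrixCoords ι '' M) : Set (MvPolynomial _ ℝ)) ∩ O := by
  obtain ⟨F, hF⟩ := hM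
  refine ⟨{x | ∀ y ∈ Metric.sphere (0 : ι → ℝ) 1, 0 < y ⬝ᵥ (matrixCoords ι).symm x *ᵥ y}, ?_, ?_⟩
  · rw [isOpen_iff_eventually]
    intro x hx
    exact (matrixCoords ι).symm.continuous.continuousAt.eventually (eventually_forall_sphere_pos hx)
  · apply Set.Subset.antisymm
    · rintro _ ⟨S, hS, rfl⟩
      refine ⟨fun f hf => hf _ ⟨S, hS, rfl⟩, ?_⟩
      change ∀ y ∈ _, _
      rw [ContinuousLinearEquiv.symm_apply_apply]
      rw [hF] at hS
      exact (posDef_iff_forall_sphere hS.1.1).1 hS.1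
    · rintro x ⟨hx, hpos⟩
      obtain ⟨S, rfl⟩ := (matrixCoords ι).surjective x
      refine ⟨S, ?_, rfl⟩
      change ∀ y ∈ _, _ at hpos
      rw [ContinuousLinearEquiv.symm_apply_apply] at hpos
      have key : ∀ f : MvPolynomial (ι × ι) ℝ,
          (∀ A ∈ M, MvPolynomial.eval (fun e : ι × ι => A e.1 e.2) f = 0) →
          MvPolynomial.eval (fun e : ι × ι => S e.1 e.2) f = 0 := by
        intro f hf
        rw [← eval_matrixCoords]
        refine hx _ ?_
        rintro _ ⟨A, hA, rfl⟩
        rw [eval_matrixCoords, hf A hA]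
      have hsymm : S.IsHermitian := by
        ext i j
        rw [conjTranspose_apply, star_trivial]
        have := key (MvPolynomial.X (j, i) - MvPolynomial.X (i, j)) fun A hA => by
          rw [hF] at hA
          have := hA.1.1.apply i j
          simp only [star_trivial] at this
          simp [this]
        simpa [sub_eq_zero] using this
      rw [hF]
      refine ⟨(posDef_iff_forall_sphere hsymm).2 hpos, fun f hf => key f fun A hA => ?_⟩
      rw [hF] at hA
      exact hA.2 f hf

/-- The empty case stands apart because the zero-dimensional Hausdorff measure counts points. -/
theorem isNullWithin_of_dimH_lt {E : Type*} [MetricSpace E] {W M : Set E} (hM : dimH M ≠ ⊤)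
    (h : W ∩ M = ∅ ∨ dimH (W ∩ M) < dimH M) : IsNullWithin W M := by
  let _ : MeasurableSpace E := borel E
  have : BorelSpace E := ⟨rfl⟩
  change Measure.hausdorffMeasure (dimH M).toReal (W ∩ M) = 0
  rcases h with h0 | hlt
  · rw [h0, measure_empty]
  · rw [← ENNReal.coe_toNNReal hM] at hlt
    exact hausdorffMeasure_of_dimH_lt hlt

/-- A subset of an irreducible algebraic model that satisfies a polynomial equation which does not
hold on the whole model is a null set. -/
theorem isNullWithin_of_eval_eq_zero {M W : Set (Matrix ι ι ℝ)} (hM : IsIrreducibleModel M)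
    (h : MvPolynomial (ι × ι) ℝ) {D : Matrix ι ι ℝ} (hD : D ∈ M)
    (hDh : MvPolynomial.eval (fun e : ι × ι => D e.1 e.2) h ≠ 0)
    (hW : ∀ S ∈ W, S ∈ M → MvPolynomial.eval (fun e : ι × ι => S e.1 e.2) h = 0) :
    IsNullWithin W M := by
  obtain ⟨O, hO, hMO⟩ := hM.1.image_matrixCoords
  have hlt : vanishing (matrixCoords ι '' M) < vanishing (matrixCoords ι '' (W ∩ M)) := by
    refine lt_of_le_not_ge (fun f hf x hx => hf x (Set.image_mono Set.inter_subset_right hx))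
      fun hle => hDh ?_
    rw [← eval_matrixCoords]
    refine hle (x := MvPolynomial.rename _ h) ?_ _ ⟨D, hD, rfl⟩
    rintro _ ⟨S, hS, rfl⟩
    rw [eval_matrixCoords]
    exact hW S hS.1 hS.2
  have hdim := dimH_lt_of_vanishing_isPrime hO hMO
    (isPrime_vanishing_of_isIrreducibleModel hM ⟨D, hD⟩) hlt
  have himage : ∀ X : Set (Matrix ι ι ℝ), dimH (matrixCoords ι '' X) = dimH X := fun X =>
    ContinuousLinearEquiv.dimH_image (matrixCoords ι) X
  rw [Set.image_eq_empty, himage, himage] at hdim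
  exact isNullWithin_of_dimH_lt (Real.dimH_ne_top M) hdim

end IrreducibleModels

/-! ### Edges, anterior paths and m-connecting walks -/

namespace MixedGraph

variable {ι : Type*} {G : MixedGraph ι} {i j : ι} {Z : Finset ι}

theorem directed_or_bidirected_iff {a b : ι} : G.Directed a b ∨ G.Bidirected a b ↔ G.head a b := by
  unfold Directed Bidirected
  tauto

theorem IsAncestral.not_anterior (hG : G.IsAncestral) {a b : ι} (h : G.head b a) :
    ¬ G.Anterior a b :=
  hG.1 a b (directed_or_bidirected_iff.2 h)

theorem IsAncestral.not_head_of_undirected (hG : G.IsAncestral) {a b : ι} (h : G.Undirected a b)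
    (c : ι) : ¬ G.head c a :=
  fun hc => hG.2 a b c h (directed_or_bidirected_iff.2 hc)

theorem Undirected.symm {a b : ι} (h : G.Undirected a b) : G.Undirected b a :=
  ⟨h.1.symm, h.2.2, h.2.1⟩

/-- Traversing an edge away from a tail is a step of an anterior path. -/
theorem step_of_not_head {a b : ι} (hadj : G.skeleton.Adj a b) (h : ¬ G.head b a) :
    G.Undirected a b ∨ G.Directed a b := by
  by_cases hab : G.head a b
  · exact Or.inr ⟨hab, h⟩
  · exact Or.inl ⟨hadj, hab, h⟩

theorem not_head_of_step {a b : ι} (h : G.Undirected a b ∨ G.Directed a b) :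
    G.skeleton.Adj a b ∧ ¬ G.head b a := by
  rcases h with h | h
  · exact ⟨h.1, h.2.2⟩
  · exact ⟨G.adj_of_head _ _ h.1, h.2⟩

theorem anterior_of_not_head {a b : ι} (hadj : G.skeleton.Adj a b) (h : ¬ G.head b a) :
    G.Anterior a b :=
  Relation.ReflTransGen.single (step_of_not_head hadj h)

/-- The condition that an m-connecting walk has to satisfy at an inner vertex. -/
def Passable (G : MixedGraph ι) (Z : Finset ι) (a k b : ι) : Prop :=
  (G.Collider a k b → ∃ z ∈ Z, G.Anterior k z) ∧ (¬ G.Collider a k b → k ∉ Z)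

theorem mconnecting_nil (a : ι) : G.MConnecting (SimpleGraph.Walk.nil : G.skeleton.Walk a a) Z := by
  intro n hn
  simp at hn

theorem mconnecting_cons {a b c : ι} (h : G.skeleton.Adj a b) {p : G.skeleton.Walk b c}
    (hp : G.MConnecting p Z) (hb : 0 < p.length → G.Passable Z a b (p.getVert 1)) :
    G.MConnecting (SimpleGraph.Walk.cons h p) Z := by
  intro n hn
  rw [SimpleGraph.Walk.length_cons] at hn
  cases n with
  | zero =>
    have := hb (by omega)
    simpa [Passable] using this
  | succ n =>
    have := hp n (by omega)
    simpa only [SimpleGraph.Walk.getVert_cons_succ] using this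

/-! #### From walks to paths -/

/-- A sequence of vertices that forms an m-connecting walk of length `L`. -/
def ConnectingSeq (G : MixedGraph ι) (Z : Finset ι) (f : ℕ → ι) (L : ℕ) : Prop :=
  (∀ n < L, G.skeleton.Adj (f n) (f (n + 1))) ∧
    ∀ n, n + 1 < L → G.Passable Z (f n) (f (n + 1)) (f (n + 2))

/-- As `f m` carries an arrowhead, leaving it by a tail means leaving along a directed edge. The
loop follows directed edges until it meets a collider, which is anterior to `Z`; without a collider
it would be a directed cycle. -/
theorem ConnectingSeq.anterior_of_loop (hG : G.IsAncestral) {f : ℕ → ι} {L m n : ℕ}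
    (hf : G.ConnectingSeq Z f L) (hmn : m < n) (hn : n ≤ L) (hv : f m = f n) {a : ι}
    (ha : G.head a (f m)) (hb : ¬ G.head (f (m + 1)) (f m)) : ∃ z ∈ Z, G.Anterior (f m) z := by
  by_contra hc
  have key : ∀ t, m + t < n → G.Anterior (f m) (f (m + t)) ∧ (∃ c, G.head c (f (m + t))) ∧
      ¬ G.head (f (m + t + 1)) (f (m + t)) := by
    intro t
    induction t with
    | zero => exact fun _ => ⟨.refl, ⟨a, ha⟩, hb⟩
    | succ t ih =>
      intro ht
      obtain ⟨h1, ⟨c, h2⟩, h3⟩ := ih (by omega)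
      have hadj := hf.1 (m + t) (by omega)
      have hstep := step_of_not_head hadj h3
      have hdir : G.Directed (f (m + t)) (f (m + t + 1)) :=
        hstep.resolve_left fun h => hG.not_head_of_undirected h c h2
      have hant : G.Anterior (f m) (f (m + t + 1)) := h1.tail (Or.inr hdir)
      refine ⟨hant, ⟨_, hdir.1⟩, fun h4 => hc ?_⟩
      obtain ⟨z, hz, hz'⟩ := (hf.2 (m + t) (by omega)).1 ⟨hdir.1, h4⟩
      exact ⟨z, hz, hant.trans hz'⟩
  obtain ⟨h1, ⟨c, h2⟩, h3⟩ := key (n - m - 1) (by omega)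
  have hlast : m + (n - m - 1) + 1 = n := by omega
  have hadj := hf.1 (m + (n - m - 1)) (by omega)
  have hdir := (step_of_not_head hadj h3).resolve_left
    fun h => hG.not_head_of_undirected h c h2
  rw [hlast, ← hv] at hdir
  exact hG.not_anterior hdir.1 h1

/-- A loop between two visits to a vertex is cut out, and only the junction needs a check. A new
collider there is an old one or is covered by `anterior_of_loop`. If the junction lies in `Z`, both
old visits were colliders, hence so is the new one. -/
theorem ConnectingSeq.exists_injOn (hG : G.IsAncestral) {f : ℕ → ι} {L : ℕ}
    (hf : G.ConnectingSeq Z f L) :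
    ∃ g L', G.ConnectingSeq Z g L' ∧ g 0 = f 0 ∧ g L' = f L ∧
      ∀ m n, m < n → n ≤ L' → g m ≠ g n := by
  induction L using Nat.strong_induction_on generalizing f with
  | _ L ih =>
  by_cases hinj : ∀ m n, m < n → n ≤ L → f m ≠ f n
  · exact ⟨f, L, hf, rfl, rfl, hinj⟩
  push Not at hinj
  obtain ⟨m, n, hmn, hn, hv⟩ := hinj
  set g : ℕ → ι := fun k => if k ≤ m then f k else f (k + (n - m)) with hg
  have hlow : ∀ k, k ≤ m → g k = f k := fun k hk => if_pos hk
  have hhigh : ∀ k, m ≤ k → g k = f (k + (n - m)) := by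
    intro k hk
    rcases eq_or_lt_of_le hk with rfl | hlt
    · rw [hlow _ le_rfl, hv]; congr 1; omega
    · exact if_neg (by omega)
  have hgc : G.ConnectingSeq Z g (L - (n - m)) := by
    constructor
    · intro k hk
      rcases lt_or_ge k m with h | h
      · rw [hlow k h.le, hlow (k + 1) h]
        exact hf.1 k (by omega)
      · rw [hhigh k h, hhigh (k + 1) (by omega), Nat.add_right_comm]
        exact hf.1 _ (by omega)
    · intro k hk
      rcases lt_trichotomy (k + 1) m with h | h | h
      · rw [hlow k (by omega), hlow (k + 1) (by omega), hlow (k + 2) (by omega)]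
        exact hf.2 k (by omega)
      · rw [hlow k (by omega), hlow (k + 1) h.le, hhigh (k + 2) (by omega)]
        have e1 : k + 2 + (n - m) = n + 1 := by omega
        rw [e1]
        have o1 := hf.2 k (by omega)
        have o2 := hf.2 (n - 1) (by omega)
        have e2 : n - 1 + 1 = n := by omega
        have e3 : n - 1 + 2 = n + 1 := by omega
        rw [e2, e3, ← hv] at o2
        rw [h] at o1 ⊢
        have e4 : k + 2 = m + 1 := by omega
        rw [e4] at o1
        constructor
        · rintro ⟨h1, h2⟩
          by_cases hb : G.head (f (m + 1)) (f m)
          · exact o1.1 ⟨h1, hb⟩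
          · exact hf.anterior_of_loop hG hmn hn hv h1 hb
        · intro hnc hz
          have c1 : G.Collider (f k) (f m) (f (m + 1)) := by
            by_contra hc
            exact o1.2 hc hz
          have c2 : G.Collider (f (n - 1)) (f m) (f (n + 1)) := by
            by_contra hc
            exact o2.2 hc hz
          exact hnc ⟨c1.1, c2.2⟩
      · rw [hhigh k (by omega), hhigh (k + 1) (by omega), hhigh (k + 2) (by omega),
          Nat.add_right_comm k 1, Nat.add_right_comm k 2]
        exact hf.2 _ (by omega)
  obtain ⟨g', L', h1, h2, h3, h4⟩ := ih (L - (n - m)) (by omega) hgc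
  refine ⟨g', L', h1, ?_, ?_, h4⟩
  · rw [h2, hlow 0 (by omega)]
  · rw [h3, hhigh _ (by omega)]; congr 1; omega

theorem exists_walk_of_seq (H : SimpleGraph ι) (L : ℕ) (f : ℕ → ι)
    (hf : ∀ n < L, H.Adj (f n) (f (n + 1))) :
    ∃ p : H.Walk (f 0) (f L), p.length = L ∧ ∀ n ≤ L, p.getVert n = f n := by
  induction L generalizing f with
  | zero =>
    refine ⟨.nil, rfl, fun n hn => ?_⟩
    rw [Nat.le_zero.1 hn]; rfl
  | succ L ih =>
    obtain ⟨p, h1, h2⟩ := ih (fun n => f (n + 1)) fun n hn => hf (n + 1) (by omega)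
    refine ⟨.cons (hf 0 (by omega)) p, by simp [h1], fun n hn => ?_⟩
    cases n with
    | zero => simp
    | succ n => rw [SimpleGraph.Walk.getVert_cons_succ]; exact h2 n (by omega)

/-- An m-connecting walk in an ancestral graph can be shortened to an m-connecting path. -/
theorem not_mseparated_of_walk (hG : G.IsAncestral) (p : G.skeleton.Walk i j)
    (hp : G.MConnecting p Z) : ¬ G.MSeparated i j Z := by
  have hf : G.ConnectingSeq Z p.getVert p.length := ⟨fun n hn => p.adj_getVert_succ hn, hp⟩
  obtain ⟨g, L, h1, h2, h3, h4⟩ := hf.exists_injOn hG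
  obtain ⟨q, hq1, hq2⟩ := exists_walk_of_seq G.skeleton L g h1.1
  rw [SimpleGraph.Walk.getVert_zero] at h2
  rw [SimpleGraph.Walk.getVert_length] at h3
  subst h2 h3
  intro hsep
  refine hsep q ?_ fun n hn => ?_
  · rw [← SimpleGraph.Walk.IsPath.getVert_injOn_iff]
    intro m hm n hn hmn
    simp only [Set.mem_ofPred_eq, hq1] at hm hn
    rw [hq2 m hm, hq2 n hn] at hmn
    rcases lt_trichotomy m n with h | h | h
    · exact absurd hmn (h4 m n h hn)
    · exact h
    · exact absurd hmn.symm (h4 n m h hm)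
  · rw [hq1] at hn
    rw [hq2 n (by omega), hq2 (n + 1) (by omega), hq2 (n + 2) (by omega)]
    exact h1.2 n hn

/-! #### Walks with colliders that are anterior to the endpoints -/

/-- `v` is anterior to an endpoint or to the conditioning set. -/
def InAnterior (G : MixedGraph ι) (i j : ι) (Z : Finset ι) (v : ι) : Prop :=
  G.Anterior v i ∨ G.Anterior v j ∨ ∃ z ∈ Z, G.Anterior v z

theorem InAnterior.of_anterior {v w : ι} (h : G.InAnterior i j Z w) (hvw : G.Anterior v w) :
    G.InAnterior i j Z v :=
  h.imp hvw.trans (Or.imp hvw.trans fun ⟨z, hz, h⟩ => ⟨z, hz, hvw.trans h⟩)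

/-- The anterior path itself has no colliders and avoids `Z`. The tail at `v` is recorded so that
`v` becomes a noncollider when an edge is prepended. -/
theorem exists_mconnecting_of_anterior {v : ι} (h : G.Anterior v j)
    (hv : ¬ ∃ z ∈ Z, G.Anterior v z) :
    ∃ p : G.skeleton.Walk v j, G.MConnecting p Z ∧ (0 < p.length → ¬ G.head (p.getVert 1) v) := by
  induction h using Relation.ReflTransGen.head_induction_on with
  | refl => exact ⟨.nil, mconnecting_nil _, by simp⟩
  | @head a b hab hbj ih =>
    have hb : ¬ ∃ z ∈ Z, G.Anterior b z := fun ⟨z, hz, h⟩ => hv ⟨z, hz, .head hab h⟩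
    obtain ⟨p, hp1, hp2⟩ := ih hb
    obtain ⟨hadj, htail⟩ := not_head_of_step hab
    refine ⟨.cons hadj p, mconnecting_cons hadj hp1 fun hl => ?_, fun _ => by simpa using htail⟩
    exact ⟨fun hc => absurd hc.2 (hp2 hl), fun _ hz => hb ⟨b, hz, .refl⟩⟩

/-- The anterior path to `i`, traversed backwards, is put in front of `p`; its tails make each
junction a noncollider, and none of these vertices is in `Z`. -/
theorem exists_mconnecting_of_anterior_left {v : ι} (h : G.Anterior v i)
    (hv : ¬ ∃ z ∈ Z, G.Anterior v z) (p : G.skeleton.Walk v j) (hp : G.MConnecting p Z) :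
    ∃ q : G.skeleton.Walk i j, G.MConnecting q Z := by
  induction h using Relation.ReflTransGen.head_induction_on with
  | refl => exact ⟨p, hp⟩
  | @head a b hab hbi ih =>
    obtain ⟨hadj, htail⟩ := not_head_of_step hab
    refine ih (fun ⟨z, hz, h⟩ => hv ⟨z, hz, .head hab h⟩) (.cons hadj.symm p)
      (mconnecting_cons _ hp fun _ => ?_)
    exact ⟨fun hc => absurd hc.1 htail, fun _ hz => hv ⟨a, hz, .refl⟩⟩

/-- There is an m-connecting walk from `v` to `j`, or else one from `i` to `j`. -/
def ReachFrom (G : MixedGraph ι) (i j : ι) (Z : Finset ι) (v : ι) : Prop :=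
  (∃ q : G.skeleton.Walk i j, G.MConnecting q Z) ∨ ∃ p : G.skeleton.Walk v j, G.MConnecting p Z

/-- There is an m-connecting walk from `u` to `j` that starts with the edge from `u` to `v`, or
else one from `i` to `j`. -/
def ReachVia (G : MixedGraph ι) (i j : ι) (Z : Finset ι) (u v : ι) : Prop :=
  (∃ q : G.skeleton.Walk i j, G.MConnecting q Z) ∨
    ∃ p : G.skeleton.Walk u j, G.MConnecting p Z ∧ 0 < p.length ∧ p.getVert 1 = v

theorem ReachVia.reachFrom {u v : ι} (h : G.ReachVia i j Z u v) : G.ReachFrom i j Z u :=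
  h.imp_right fun ⟨p, hp, _⟩ => ⟨p, hp⟩

/-- Here a collider that is anterior to an endpoint instead of `Z` is tolerated. If `v` is anterior
to `Z`, the edge is prepended to `p`. If not, an anterior path to `i` completes a walk from `i` to
`j`, while an anterior path to `j` replaces `p` and makes `v` a noncollider. -/
theorem reachVia_of_walk {u v : ι} (hv : G.InAnterior i j Z v) (hadj : G.skeleton.Adj u v)
    (p : G.skeleton.Walk v j) (hp : G.MConnecting p Z)
    (h : v ∉ Z ∨ (0 < p.length ∧ G.head (p.getVert 1) v ∧ G.head u v)) : G.ReachVia i j Z u v := by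
  by_cases hZ : ∃ z ∈ Z, G.Anterior v z
  · refine Or.inr ⟨.cons hadj p, mconnecting_cons hadj hp fun _ => ⟨fun _ => hZ, fun hnc => ?_⟩,
      by simp, by simp⟩
    exact h.resolve_right fun h => hnc ⟨h.2.2, h.2.1⟩
  · rcases hv with hv | hv | hv
    · exact Or.inl (exists_mconnecting_of_anterior_left hv hZ p hp)
    · obtain ⟨q, hq1, hq2⟩ := exists_mconnecting_of_anterior hv hZ
      refine Or.inr ⟨.cons hadj q, mconnecting_cons hadj hq1 fun hl =>
        ⟨fun hc => absurd hc.2 (hq2 hl), fun _ hz => hZ ⟨v, hz, .refl⟩⟩, by simp, by simp⟩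
    · exact absurd hv hZ

/-- `v` is reached, and the walk can be continued along an edge with an arrowhead at `v`. -/
def ReachHead (G : MixedGraph ι) (i j : ι) (Z : Finset ι) (v : ι) : Prop :=
  (v ∉ Z ∧ G.ReachFrom i j Z v) ∨ ∃ w, G.ReachVia i j Z v w ∧ G.head w v

theorem ReachFrom.reachVia {u v : ι} (hv : G.InAnterior i j Z v) (hZ : v ∉ Z)
    (h : G.ReachFrom i j Z v) (hadj : G.skeleton.Adj u v) : G.ReachVia i j Z u v := by
  rcases h with h | ⟨p, hp⟩
  · exact Or.inl h
  · exact reachVia_of_walk hv hadj p hp (Or.inl hZ)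

theorem ReachHead.reachVia {u v : ι} (h : G.ReachHead i j Z v) (hv : G.InAnterior i j Z v)
    (hu : G.head u v) : G.ReachVia i j Z u v := by
  rcases h with ⟨hZ, h⟩ | ⟨w, h, hw⟩
  · exact h.reachVia hv hZ (G.adj_of_head _ _ hu)
  · rcases h with h | ⟨p, hp, hl, rfl⟩
    · exact Or.inl h
    · exact reachVia_of_walk hv (G.adj_of_head _ _ hu) p hp (Or.inr ⟨hl, hw, hu⟩)

theorem ReachHead.reachFrom {v : ι} (h : G.ReachHead i j Z v) : G.ReachFrom i j Z v := by
  rcases h with h | ⟨w, h, -⟩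
  · exact h.2
  · exact h.reachFrom

/-- Arrowheads at both ends carry `ReachHead` along an edge. -/
theorem ReachHead.of_bidirected {u v : ι} (h : G.ReachHead i j Z v) (hv : G.InAnterior i j Z v)
    (hu : G.Bidirected u v) : G.ReachHead i j Z u :=
  Or.inr ⟨v, h.reachVia hv hu.1, hu.2⟩

theorem reachFrom_self : G.ReachFrom i j Z j :=
  Or.inr ⟨.nil, mconnecting_nil _⟩

theorem ReachFrom.not_mseparated (hG : G.IsAncestral) (h : G.ReachFrom i j Z i) :
    ¬ G.MSeparated i j Z := by
  rcases h with ⟨p, hp⟩ | ⟨p, hp⟩ <;> exact not_mseparated_of_walk hG p hp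

end MixedGraph

/-! ### Separations in ancestral and maximal ancestral graphs -/

namespace MixedGraph

variable {ι : Type*} {G : MixedGraph ι} {i j : ι} {Z : Finset ι}

/-- `v` has no arrowheads. -/
def IsHeadless (G : MixedGraph ι) (v : ι) : Prop := ∀ c, ¬ G.head c v

theorem IsAncestral.isHeadless_of_undirected (hG : G.IsAncestral) {a b : ι} (h : G.Undirected a b) :
    G.IsHeadless a :=
  fun c => hG.not_head_of_undirected h c

theorem IsAncestral.isHeadless_of_anterior (hG : G.IsAncestral) {a b : ι} (h : G.Anterior a b)
    (hb : G.IsHeadless b) : G.IsHeadless a := by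
  induction h using Relation.ReflTransGen.head_induction_on with
  | refl => exact hb
  | head hab _ ih =>
    rcases hab with h | h
    · exact hG.isHeadless_of_undirected h
    · exact absurd h.1 (ih _)

theorem IsHeadless.undirected {a b : ι} (ha : G.IsHeadless a) (hb : G.IsHeadless b)
    (h : G.skeleton.Adj a b) : G.Undirected a b :=
  ⟨h, hb a, ha b⟩

/-- A vertex with an arrowhead is not anterior to a vertex that is anterior to it. -/
theorem IsAncestral.eq_of_anterior (hG : G.IsAncestral) {a b : ι} (hab : G.Anterior a b)
    (hba : G.Anterior b a) (hb : ¬ G.IsHeadless b) : a = b := by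
  rcases Relation.ReflTransGen.cases_tail hab with h | ⟨c, hac, hcb⟩
  · exact h.symm
  · rcases hcb with h | h
    · exact absurd (hG.isHeadless_of_undirected h.symm) hb
    · exact absurd (hba.trans hac) (hG.not_anterior h.1)

/-- Leaving `f k` by a tail, the sequence takes anterior steps up to its end or its first collider,
which is anterior to `Z`. The vertex after an undirected edge has no arrowheads, so the next edge
again leaves by a tail. -/
theorem ConnectingSeq.anterior (hG : G.IsAncestral) {f : ℕ → ι} {L : ℕ}
    (hf : G.ConnectingSeq Z f L) (k : ℕ) (hk : k < L) (htail : ¬ G.head (f (k + 1)) (f k)) :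
    G.Anterior (f k) (f L) ∨ ∃ z ∈ Z, G.Anterior (f k) z := by
  obtain ⟨m, hm⟩ : ∃ m, L = k + 1 + m := ⟨L - (k + 1), by omega⟩
  induction m generalizing k with
  | zero =>
    left
    have : L = k + 1 := by omega
    rw [this]
    exact anterior_of_not_head (hf.1 k hk) htail
  | succ m ih =>
    have hstep := anterior_of_not_head (hf.1 k hk) htail
    by_cases hc : G.Collider (f k) (f (k + 1)) (f (k + 2))
    · obtain ⟨z, hz, h⟩ := (hf.2 k (by omega)).1 hc
      exact Or.inr ⟨z, hz, hstep.trans h⟩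
    · have hnext : ¬ G.head (f (k + 2)) (f (k + 1)) := by
        intro h
        by_cases h' : G.head (f k) (f (k + 1))
        · exact hc ⟨h', h⟩
        · exact hG.isHeadless_of_undirected ⟨(hf.1 k hk).symm, htail, h'⟩ _ h
      exact (ih (k + 1) (by omega) hnext (by omega)).imp hstep.trans
        fun ⟨z, hz, h⟩ => ⟨z, hz, hstep.trans h⟩

theorem ConnectingSeq.reverse {f : ℕ → ι} {L : ℕ} (hf : G.ConnectingSeq Z f L) :
    G.ConnectingSeq Z (fun n => f (L - n)) L := by
  constructor
  · intro n hn
    have := hf.1 (L - (n + 1)) (by omega)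
    rw [show L - (n + 1) + 1 = L - n by omega] at this
    exact this.symm
  · intro n hn
    have := hf.2 (L - (n + 2)) (by omega)
    rw [show L - (n + 2) + 1 = L - (n + 1) by omega,
      show L - (n + 2) + 2 = L - n by omega] at this
    exact ⟨fun h => this.1 h.symm, fun h => this.2 fun h' => h h'.symm⟩

theorem mseparated_of_seq (h : ∀ f L, G.ConnectingSeq Z f L → f 0 = i → f L = j →
    (∀ m n, m ≤ L → n ≤ L → f m = f n → m = n) → False) : G.MSeparated i j Z := by
  intro p hp hc
  refine h p.getVert p.length ⟨fun n hn => p.adj_getVert_succ hn, hc⟩ (by simp) (by simp) ?_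
  intro m n hm hn hmn
  exact (SimpleGraph.Walk.IsPath.getVert_injOn_iff p).2 hp hm hn hmn

/-- A connecting path would leave `i` by a tail, making `i` anterior to `j` or to a member of the
empty set. -/
theorem mseparated_empty (hG : G.IsAncestral) (hi : G.IsHeadless i) (hij : ¬ G.Anterior i j) :
    G.MSeparated i j ∅ := by
  refine mseparated_of_seq fun f L hf h0 hL _ => ?_
  subst h0 hL
  rcases Nat.eq_zero_or_pos L with rfl | hpos
  · exact hij .refl
  · rcases hf.anterior hG 0 hpos (hi _) with h | ⟨z, hz, -⟩
    · exact hij h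
    · simp at hz

/-- On a connecting path the second vertex cannot be headless, as it would be a noncollider in `Z`.
Otherwise it is anterior to `Z` or `j`, by the collider condition or along tails, and hence headless
after all. -/
theorem mseparated_headless (hG : G.IsAncestral) (hi : G.IsHeadless i) (hj : G.IsHeadless j)
    (hne : i ≠ j) (hadj : ¬ G.skeleton.Adj i j)
    (hZ : ∀ v, v ∈ Z ↔ G.IsHeadless v ∧ v ≠ i ∧ v ≠ j) : G.MSeparated i j Z := by
  refine mseparated_of_seq fun f L hf h0 hL hinj => ?_
  subst h0 hL
  have hL : 2 ≤ L := by
    by_contra h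
    interval_cases L
    · exact hne rfl
    · exact hadj (hf.1 0 one_pos)
  have hp := hf.2 0 (by omega)
  rw [zero_add] at hp
  have hanc : ∀ z ∈ Z, G.Anterior (f 1) z → G.IsHeadless (f 1) := fun z hz h =>
    hG.isHeadless_of_anterior h ((hZ z).1 hz).1
  by_cases h1 : G.IsHeadless (f 1)
  · refine hp.2 (fun hc => h1 _ hc.1) ((hZ _).2 ⟨h1, fun h => ?_, fun h => ?_⟩)
    · have := hinj 1 0 (by omega) (by omega) h
      omega
    · have := hinj 1 L (by omega) (by omega) h
      omega
  · by_cases hc : G.Collider (f 0) (f 1) (f 2)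
    · obtain ⟨z, hz, h⟩ := hp.1 hc
      exact h1 (hanc z hz h)
    · have h2 : ¬ G.head (f 2) (f 1) := by
        intro h
        by_cases h' : G.head (f 0) (f 1)
        · exact hc ⟨h', h⟩
        · exact h1 (hG.isHeadless_of_undirected ⟨(hf.1 0 (by omega)).symm, hi _, h'⟩)
      rcases hf.anterior hG 1 (by omega) h2 with h | ⟨z, hz, h⟩
      · exact h1 (hG.isHeadless_of_anterior h hj)
      · exact h1 (hanc z hz h)

/-- In a maximal ancestral graph there is no primitive inducing path between nonadjacent
vertices. -/
theorem IsMAG.not_reachHead (hG : G.IsMAG) (hne : i ≠ j) (hadj : ¬ G.skeleton.Adj i j)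
    (h : ∀ Z : Finset ι, j ∉ Z → G.ReachHead i j Z j → G.ReachFrom i j Z i) : False := by
  obtain ⟨Z, -, hj, hsep⟩ := hG.2 i j hne hadj
  exact (h Z hj (Or.inl ⟨hj, reachFrom_self⟩)).not_mseparated hG.1 hsep

/-- The chain together with the edge from `d` to `j` would be an inducing path: all inner vertices
are colliders anterior to an endpoint, so it transports a connection from `j` back to `i` for every
`Z` without `j`. -/
theorem IsMAG.not_bidirected_chain (hG : G.IsMAG) (hne : i ≠ j) (hadj : ¬ G.skeleton.Adj i j) {d : ι}
    (hd : Relation.ReflTransGen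
      (fun x y => G.Bidirected x y ∧ (G.Anterior y i ∨ G.Anterior y j)) i d) :
    ¬ G.Bidirected d j := by
  intro hdj
  refine hG.not_reachHead hne hadj fun Z hj hreach => ReachHead.reachFrom (?_ : G.ReachHead i j Z i)
  have h1 : G.ReachHead i j Z d := hreach.of_bidirected (Or.inr (Or.inl .refl)) hdj
  have key : ∀ x, Relation.ReflTransGen
      (fun x y => G.Bidirected x y ∧ (G.Anterior y i ∨ G.Anterior y j)) x d →
      G.ReachHead i j Z x := by
    intro x hx
    induction hx using Relation.ReflTransGen.head_induction_on with
    | refl => exact h1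
    | head hxy _ ih => exact ih.of_bidirected (hxy.2.imp_right Or.inl) hxy.1
  exact key i hd

/-- Nonadjacent vertices of a maximal ancestral graph are separated by the other vertices that are
anterior to them. -/
theorem IsMAG.mseparated_anterior (hG : G.IsMAG) (hne : i ≠ j) (hadj : ¬ G.skeleton.Adj i j)
    (hZ : ∀ v, v ∈ Z ↔ (G.Anterior v i ∨ G.Anterior v j) ∧ v ≠ i ∧ v ≠ j) :
    G.MSeparated i j Z := by
  refine mseparated_of_seq fun f L hf h0 hL hinj => ?_
  subst h0 hL
  have hantZ : ∀ v, (∃ z ∈ Z, G.Anterior v z) → G.Anterior v (f 0) ∨ G.Anterior v (f L) :=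
    fun v ⟨z, hz, h⟩ => ((hZ z).1 hz).1.imp h.trans h.trans
  -- A noncollider has a tail on the path, so it is anterior to an endpoint or to `Z`. It then
  -- belongs to `Z`, which it must avoid.
  have hcoll : ∀ n, n + 1 < L → G.Collider (f n) (f (n + 1)) (f (n + 2)) := by
    intro n hn
    by_contra hc
    have hnZ := (hf.2 n hn).2 hc
    have hnot : ¬ (G.Anterior (f (n + 1)) (f 0) ∨ G.Anterior (f (n + 1)) (f L)) := by
      intro h
      refine hnZ ((hZ _).2 ⟨h, fun h => ?_, fun h => ?_⟩)
      · have := hinj _ _ (by omega) (by omega) h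
        omega
      · have := hinj _ _ (by omega) (by omega) h
        omega
    by_cases hr : G.head (f (n + 2)) (f (n + 1))
    · have hl : ¬ G.head (f n) (f (n + 1)) := fun h => hc ⟨h, hr⟩
      have := hf.reverse.anterior hG.1 (L - (n + 1)) (by omega) (by
        rw [show L - (L - (n + 1) + 1) = n by omega, show L - (L - (n + 1)) = n + 1 by omega]
        exact hl)
      rw [show L - (L - (n + 1)) = n + 1 by omega, Nat.sub_self] at this
      exact hnot (this.elim Or.inl fun h => hantZ _ h)
    · have := hf.anterior hG.1 (n + 1) (by omega) hr
      exact hnot (this.elim Or.inr fun h => hantZ _ h)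
  -- All inner vertices are colliders anterior to an endpoint, so the path is inducing and defeats
  -- every candidate separator `Z'`.
  refine hG.not_reachHead hne hadj fun Z' hj hreach => ?_
  have key : ∀ m, m < L → G.ReachVia (f 0) (f L) Z' (f (L - (m + 1))) (f (L - m)) := by
    intro m
    induction m with
    | zero =>
      intro hm
      refine reachFrom_self.reachVia (Or.inr (Or.inl .refl)) hj ?_
      have := hf.1 (L - 1) (by omega)
      rwa [show L - 1 + 1 = L - 0 by omega] at this
    | succ m ih =>
      intro hm
      have hc := hcoll (L - (m + 2)) (by omega)
      have ho := (hf.2 (L - (m + 2)) (by omega)).1 hc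
      rw [show L - (m + 2) + 1 = L - (m + 1) by omega] at hc ho
      rw [show L - (m + 2) + 2 = L - m by omega] at hc
      have hr : G.ReachHead (f 0) (f L) Z' (f (L - (m + 1))) := Or.inr ⟨_, ih (by omega), hc.2⟩
      refine hr.reachVia ?_ hc.1
      rcases hantZ _ ho with h | h
      · exact Or.inl h
      · exact Or.inr (Or.inl h)
  rcases Nat.eq_zero_or_pos L with rfl | hpos
  · exact absurd rfl hne
  · have := (key (L - 1) (by omega)).reachFrom
    rwa [show L - (L - 1 + 1) = 0 by omega] at this

/-- Adjacency in a maximal ancestral graph is adjacency in its independence model. -/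
theorem IsMAG.adj_iff_adjacent (hG : G.IsMAG) (a b : ι) :
    G.skeleton.Adj a b ↔ G.indepModel.Adjacent a b := by
  have hedge : ∀ (a b : ι) (Z : Finset ι), G.skeleton.Adj a b → ¬ G.MSeparated a b Z := by
    intro a b Z h hsep
    refine not_mseparated_of_walk hG.1 (.cons h .nil) (mconnecting_cons h (mconnecting_nil _) ?_) hsep
    simp
  constructor
  · refine fun h => ⟨h.ne, ?_⟩
    rintro ⟨s, hs, ⟨rfl, rfl⟩ | ⟨rfl, rfl⟩⟩
    · exact hedge _ _ _ h hs
    · exact hedge _ _ _ h.symm hs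
  · rintro ⟨hne, h⟩
    by_contra hadj
    obtain ⟨Z, ha, hb, hsep⟩ := hG.2 a b hne hadj
    exact h ⟨⟨a, b, Z, hne, ha, hb⟩, hsep, Or.inl ⟨rfl, rfl⟩⟩

end MixedGraph

/-! ### Partial correlations and concentration matrices -/

open Matrix in
/-- Vectorial form of conditional independence: some linear combination of `X_i` and the variables
in `Z` in which `X_i` has coefficient one is uncorrelated with `X_j` and with the variables
in `Z`. -/
def PartialUncorrelated {ι : Type*} [Fintype ι] (S : Matrix ι ι ℝ) (i j : ι) (Z : Finset ι) : Prop :=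
  ∃ w : ι → ℝ, w i = 1 ∧ (∀ k, k ≠ i → k ∉ Z → w k = 0) ∧ (∀ k ∈ Z, (S *ᵥ w) k = 0) ∧
    (S *ᵥ w) j = 0

namespace Matrix

/-- The inverse of a matrix that vanishes between `s` and its complement also does so. -/
theorem inv_eq_zero_of_block {n : Type*} [Fintype n] [DecidableEq n] {M : Matrix n n ℝ}
    (hM : IsUnit M) (s : n → Prop) (h : ∀ a b, s a → ¬ s b → M a b = 0) {a b : n} (ha : s a)
    (hb : ¬ s b) : M⁻¹ a b = 0 := by
  classical
  have hu := hM.invertible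
  have hbt : M.BlockTriangular fun x => if s x then (1 : ℕ) else 0 := by
    intro x y hxy
    by_cases hx : s x <;> by_cases hy : s y <;> simp [hx, hy] at hxy
    exact h x y hx hy
  exact blockTriangular_inv_of_blockTriangular hbt (by simp [ha, hb])

theorem mulVec_eq_submatrix {n : Type*} [Fintype n] (A : n → Prop) [DecidablePred A]
    (M : Matrix n n ℝ) (x : n → ℝ) (a : n) (h : ∀ b, ¬ A b → M a b * x b = 0) :
    (M *ᵥ x) a = ∑ b : {b // A b}, M a b * x b := by
  rw [mulVec, dotProduct, ← Fintype.sum_subtype_add_sum_subtype A, add_eq_left]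
  exact Finset.sum_eq_zero fun b _ => h b b.2

/-- The global Markov property of a concentration matrix with respect to one separation. -/
theorem partialUncorrelated_of_inverse {n : Type*} [Fintype n] [DecidableEq n] {S K : Matrix n n ℝ}
    (hSK : S * K = 1) (hK : K.PosDef) (I : n → Prop) {i j : n} {Z : Finset n} (hi : I i)
    (hj : ¬ I j) (hZ : ∀ k ∈ Z, ¬ I k) (h : ∀ a b, I a → ¬ I b → b ∉ Z → K b a = 0) :
    PartialUncorrelated S i j Z := by
  classical
  set K' := K.submatrix (Subtype.val : {a // I a} → n) Subtype.val
  have hK' : K'.PosDef := hK.submatrix Subtype.val_injective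
  -- Let `u` be column `i` of the inverse of the block of `K` on `I`, extended by zero. Then `K u`
  -- is supported on `i` and `Z`, while `S (K u) = u` vanishes at `j` and on `Z`.
  set u' : {a // I a} → ℝ := K'⁻¹ *ᵥ Pi.single ⟨i, hi⟩ 1
  have hu' : K' *ᵥ u' = Pi.single ⟨i, hi⟩ 1 := by
    rw [mulVec_mulVec, mul_nonsing_inv _ ((isUnit_iff_isUnit_det _).1 hK'.isUnit), one_mulVec]
  set u : n → ℝ := fun a => if h : I a then u' ⟨a, h⟩ else 0 with hu
  have hKu : ∀ a, (K *ᵥ u) a = ∑ b : {b // I b}, K a b * u' b := by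
    intro a
    rw [mulVec_eq_submatrix I K u a fun b hb => by simp [hu, hb]]
    exact Finset.sum_congr rfl fun b _ => by simp [hu, b.2]
  have hin : ∀ a (ha : I a), (K *ᵥ u) a = (Pi.single ⟨i, hi⟩ 1 : {a // I a} → ℝ) ⟨a, ha⟩ := by
    intro a ha
    rw [hKu, ← hu']
    rfl
  have hS : S *ᵥ (K *ᵥ u) = u := by rw [mulVec_mulVec, hSK, one_mulVec]
  refine ⟨K *ᵥ u, ?_, ?_, ?_, ?_⟩
  · rw [hin i hi, Pi.single_eq_same]
  · intro k hki hkZ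
    by_cases hk : I k
    · rw [hin k hk, Pi.single_eq_of_ne]
      simpa using hki
    · rw [hKu]
      exact Finset.sum_eq_zero fun b _ => by rw [h b k b.2 hk hkZ, zero_mul]
  · intro k hk
    rw [hS]
    simp [hu, hZ k hk]
  · rw [hS]
    simp [hu, hj]

end Matrix

open Matrix

/-! ### Gaussian recursions and the global Markov property -/

namespace MixedGraph

variable {ι : Type*} {G : MixedGraph ι} {i j : ι} {Z : Finset ι}

section Rank

variable [Fintype ι]

open Classical in
/-- The number of vertices that are anterior to `a`. -/
noncomputable def rank (G : MixedGraph ι) (a : ι) : ℕ := (Finset.univ.filter (G.Anterior · a)).card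

theorem IsAncestral.rank_lt (hG : G.IsAncestral) {a b : ι} (h : G.Directed a b) :
    G.rank a < G.rank b := by
  classical
  refine Finset.card_lt_card (Finset.ssubset_iff_subset_ne.2 ⟨fun x hx => ?_, fun he => ?_⟩)
  · simp only [Finset.mem_filter, Finset.mem_univ, true_and] at hx ⊢
    exact hx.tail (Or.inr h)
  · have : b ∈ Finset.univ.filter (G.Anterior · a) := by
      rw [he]; simp only [Finset.mem_filter, Finset.mem_univ, true_and]; exact .refl
    simp only [Finset.mem_filter, Finset.mem_univ, true_and] at this
    exact hG.not_anterior h.1 this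

end Rank

/-- `T` is the matrix of a linear recursion along the directed edges: row `i` holds the
coefficients of `X_i - ∑ β_k X_k`, the sum running over the parents of `i`. -/
structure IsRecursion (G : MixedGraph ι) (T : Matrix ι ι ℝ) : Prop where
  diag : ∀ i, T i i = 1
  off : ∀ i k, i ≠ k → ¬ G.Directed k i → T i k = 0

namespace IsRecursion

theorem anterior {T : Matrix ι ι ℝ} (hT : G.IsRecursion T) {a b : ι} (h : T a b ≠ 0) :
    G.Anterior b a := by
  by_cases hab : a = b
  · subst hab; exact .refl
  · by_contra hc
    exact h (hT.off a b hab fun hd => hc (.single (Or.inr hd)))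

variable [Fintype ι]

/-- Back substitution from the sinks: at a vertex of greatest rank outside `A` with `v` nonzero,
only the diagonal term of `Tᵀ *ᵥ v` survives. With `A` empty this gives the invertibility of `T`. -/
theorem eq_zero_of_vecMul {T : Matrix ι ι ℝ} (hG : G.IsAncestral) (hT : G.IsRecursion T)
    (A : ι → Prop) (hA : ∀ a b, G.Anterior a b → A b → A a) {v : ι → ℝ}
    (hv : ∀ b, ¬ A b → (Tᵀ *ᵥ v) b = 0) {b : ι} (hb : ¬ A b) : v b = 0 := by
  classical
  by_contra hne
  obtain ⟨c, hc, hmax⟩ := Finset.exists_max_image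
    (Finset.univ.filter fun x => ¬ A x ∧ v x ≠ 0) G.rank ⟨b, by simp [hb, hne]⟩
  simp only [Finset.mem_filter, Finset.mem_univ, true_and] at hc hmax
  apply hc.2
  have h0 := hv c hc.1
  rw [mulVec, dotProduct, Finset.sum_eq_single c] at h0
  · simpa [hT.diag] using h0
  · intro a _ hac
    rw [transpose_apply]
    by_cases hd : G.Directed c a
    · have hAa : ¬ A a := fun h => hc.1 (hA c a (.single (Or.inr hd)) h)
      by_cases hva : v a = 0
      · rw [hva, mul_zero]
      · exact absurd (hmax a ⟨hAa, hva⟩) (not_le.2 (hG.rank_lt hd))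
    · rw [hT.off a c hac hd, zero_mul]
  · simp

theorem isUnit [DecidableEq ι] {T : Matrix ι ι ℝ} (hG : G.IsAncestral) (hT : G.IsRecursion T) :
    IsUnit T := by
  rw [← Matrix.isUnit_transpose, ← mulVec_injective_iff_isUnit]
  change Function.Injective Tᵀ.mulVecLin
  rw [injective_iff_map_eq_zero]
  intro v hv
  funext b
  refine hT.eq_zero_of_vecMul hG (fun _ => False) (fun _ _ _ h => h) (fun b _ => ?_) (b := b) id
  exact congrFun hv b

/-- Rows of `T` indexed by an anterior set are supported on it, so the marginal distribution on such
a set obeys the restricted recursion. -/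
theorem submatrix {T : Matrix ι ι ℝ} (hT : G.IsRecursion T) (A : ι → Prop) [DecidablePred A]
    (hA : ∀ a b, G.Anterior a b → A b → A a) (S : Matrix ι ι ℝ) :
    T.submatrix (Subtype.val : {a // A a} → ι) (Subtype.val : {a // A a} → ι) *
      S.submatrix (Subtype.val : {a // A a} → ι) (Subtype.val : {a // A a} → ι) *
      (T.submatrix (Subtype.val : {a // A a} → ι) (Subtype.val : {a // A a} → ι))ᵀ =
      (T * S * Tᵀ).submatrix (Subtype.val : {a // A a} → ι) (Subtype.val : {a // A a} → ι) := by
  have hz : ∀ a b, A a → ¬ A b → T a b = 0 := by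
    intro a b ha hb
    by_contra h
    exact hb (hA b a (hT.anterior h) ha)
  ext a b
  simp only [mul_apply, submatrix_apply, transpose_apply]
  rw [← Fintype.sum_subtype_add_sum_subtype A
    (fun x => (∑ y, T a.1 y * S y x) * T b.1 x)]
  rw [Finset.sum_eq_zero (s := Finset.univ (α := {x // ¬ A x}))
    fun x _ => by rw [hz b x b.2 x.2, mul_zero], add_zero]
  refine Finset.sum_congr rfl fun x _ => ?_
  congr 1
  rw [← Fintype.sum_subtype_add_sum_subtype A (fun y => T a.1 y * S y x.1)]
  rw [Finset.sum_eq_zero (s := Finset.univ (α := {x // ¬ A x}))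
    fun y _ => by rw [hz a y a.2 y.2, zero_mul], add_zero]

end IsRecursion

variable [Fintype ι] [DecidableEq ι]

/-- The covariance structure of the error terms of a Gaussian ancestral graph model. -/
structure IsErrorCov (G : MixedGraph ι) (Φ : Matrix ι ι ℝ) : Prop where
  posDef : Φ.PosDef
  mixed : ∀ i j, G.IsHeadless i → ¬ G.IsHeadless j → Φ i j = 0
  bidirected : ∀ i j, ¬ G.IsHeadless i → ¬ G.IsHeadless j → i ≠ j → ¬ G.Bidirected i j → Φ i j = 0
  undirected : ∀ i j, G.IsHeadless i → G.IsHeadless j → i ≠ j → ¬ G.Undirected i j → Φ⁻¹ i j = 0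

namespace IsErrorCov

variable {Φ : Matrix ι ι ℝ}

theorem symm (h : G.IsErrorCov Φ) (a b : ι) : Φ a b = Φ b a := by
  simpa using h.posDef.1.apply b a

theorem inv_mixed (h : G.IsErrorCov Φ) {a b : ι} (ha : ¬ G.IsHeadless a) (hb : G.IsHeadless b) :
    Φ⁻¹ a b = 0 :=
  inv_eq_zero_of_block h.posDef.isUnit (fun x => ¬ G.IsHeadless x)
    (fun x y hx hy => by rw [h.symm]; exact h.mixed y x (not_not.1 hy) hx) ha (not_not.2 hb)

/-- Columns of `Φ⁻¹` at headless vertices of `A` vanish outside `A`, so they are also columns of the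
inverse of the marginal. On the other vertices the marginal covariance splits along the components
of the bidirected edges within `A`, and so does its inverse. -/
theorem eq_or_connected_of_inv_ne_zero (h : G.IsErrorCov Φ) (A : ι → Prop) [DecidablePred A]
    (hA : ∀ a b, G.Anterior a b → A b → A a) {c d : {a // A a}}
    (hcd : (Φ.submatrix (Subtype.val : {a // A a} → ι) Subtype.val)⁻¹ c d ≠ 0) :
    (G.IsHeadless c ∧ G.IsHeadless d ∧ (c = d ∨ G.Undirected c d)) ∨
      (¬ G.IsHeadless c ∧ ¬ G.IsHeadless d ∧
        Relation.ReflTransGen (fun x y => G.Bidirected x y ∧ A y) c.1 d.1) := by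
  set Φ' := Φ.submatrix (Subtype.val : {a // A a} → ι) Subtype.val with hΦ'
  have hpd : Φ'.PosDef := h.posDef.submatrix Subtype.val_injective
  have hdet := (isUnit_iff_isUnit_det _).1 hpd.isUnit
  have hdetΦ := (isUnit_iff_isUnit_det _).1 h.posDef.isUnit
  by_cases hc : G.IsHeadless c <;> by_cases hd : G.IsHeadless d
  · left
    refine ⟨hc, hd, ?_⟩
    by_contra hne
    push Not at hne
    apply hcd
    have hcol : ∀ a, ¬ A a → Φ⁻¹ a d = 0 := by
      intro a ha
      by_cases hla : G.IsHeadless a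
      · refine h.undirected a d hla hd (fun he => ha (he ▸ d.2)) fun hu => ha (hA a d ?_ d.2)
        exact .single (Or.inl hu)
      · exact h.inv_mixed hla hd
    have hmul : Φ' *ᵥ (fun a => Φ⁻¹ a.1 d) = Pi.single d 1 := by
      funext a
      have h1 := mulVec_eq_submatrix A Φ (fun b => Φ⁻¹ b d) a.1
        fun b hb => by rw [hcol b hb, mul_zero]
      have h2 : (Φ *ᵥ (fun b => Φ⁻¹ b d)) a.1 = (Φ * Φ⁻¹) a.1 d := rfl
      rw [mul_nonsing_inv _ hdetΦ] at h2
      change ∑ b : {b // A b}, Φ a.1 b.1 * Φ⁻¹ b.1 d = _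
      rw [← h1, h2, one_apply, Pi.single_apply]
      simp only [Subtype.ext_iff]
    have hinv : Φ'⁻¹ *ᵥ Pi.single d 1 = fun a => Φ⁻¹ a.1 d := by
      rw [← hmul, mulVec_mulVec, nonsing_inv_mul _ hdet, one_mulVec]
    have := congrFun hinv c
    rw [mulVec_single_one] at this
    rw [← h.undirected c d hc hd (fun he => hne.1 (Subtype.ext he)) hne.2]
    exact this
  · exact absurd (inv_eq_zero_of_block hpd.isUnit (fun x => G.IsHeadless x.1)
      (fun x y hx hy => h.mixed x y hx hy) hc hd) hcd
  · exact absurd (inv_eq_zero_of_block hpd.isUnit (fun x => ¬ G.IsHeadless x.1)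
      (fun x y hx hy => by
        change Φ x.1 y.1 = 0
        rw [h.symm]; exact h.mixed y x (not_not.1 hy) hx) hc (not_not.2 hd)) hcd
  · right
    refine ⟨hc, hd, ?_⟩
    by_contra hchain
    refine hcd (inv_eq_zero_of_block hpd.isUnit (fun x => ¬ G.IsHeadless x.1 ∧
      Relation.ReflTransGen (fun x y => G.Bidirected x y ∧ A y) c.1 x.1) ?_ ⟨hc, .refl⟩
      fun h => hchain h.2)
    rintro x y ⟨hx, hx'⟩ hy
    change Φ x.1 y.1 = 0
    by_cases hly : G.IsHeadless y
    · rw [h.symm]; exact h.mixed y x hly hx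
    · refine h.bidirected x y hx hly ?_ fun hb => hy ⟨hly, hx'.tail ⟨hb, y.2⟩⟩
      intro he
      exact hy ⟨hly, he ▸ hx'⟩

end IsErrorCov

/-- The walk in the graph that corresponds to a nonzero entry of a marginal concentration
matrix. -/
theorem reachFrom_of_entries {T Φ : Matrix ι ι ℝ} (hT : G.IsRecursion T)
    (hΦ : G.IsErrorCov Φ) (A : ι → Prop) [DecidablePred A]
    (hA : ∀ a, A a ↔ G.InAnterior i j Z a) {a b c d : {a // A a}} (hca : T c a ≠ 0)
    (hcd : (Φ.submatrix (Subtype.val : {a // A a} → ι) Subtype.val)⁻¹ c d ≠ 0) (hdb : T d b ≠ 0)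
    (hbZ : b.1 ∉ Z) (hb : G.ReachFrom i j Z b) : G.ReachFrom i j Z a := by
  have hdir : ∀ {x y : ι}, T x y ≠ 0 → x = y ∨ G.Directed y x := by
    intro x y h
    by_contra hc
    push Not at hc
    exact h (hT.off x y hc.1 hc.2)
  have hA' : ∀ a b, G.Anterior a b → A b → A a := fun a b hab hb =>
    (hA a).2 (((hA b).1 hb).of_anterior hab)
  -- The three entries spell out a walk: either `a` and `b` coincide or are joined by an undirected
  -- edge, or the walk has the form a → c ↔ … ↔ d ← b, where the outer edges may be absent.
  rcases hΦ.eq_or_connected_of_inv_ne_zero A hA' hcd with ⟨hc, hd, h⟩ | ⟨-, -, h⟩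
  · have hca' : c = a := Subtype.ext ((hdir hca).resolve_right fun h => hc _ h.1)
    have hdb' : d = b := Subtype.ext ((hdir hdb).resolve_right fun h => hd _ h.1)
    subst hca' hdb'
    rcases h with rfl | h
    · exact hb
    · exact (hb.reachVia ((hA d).1 d.2) hbZ h.1).reachFrom
  · have hd : G.ReachHead i j Z d := by
      rcases hdir hdb with h | h
      · rw [h]; exact Or.inl ⟨hbZ, hb⟩
      · exact Or.inr ⟨b, hb.reachVia ((hA b).1 b.2) hbZ (G.adj_of_head _ _ h.1).symm, h.1⟩
    have hc : G.ReachHead i j Z c := by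
      have key : ∀ x : ι, Relation.ReflTransGen (fun x y => G.Bidirected x y ∧ A y) x d.1 →
          G.ReachHead i j Z x := by
        intro x hx
        induction hx using Relation.ReflTransGen.head_induction_on with
        | refl => exact hd
        | head hxy _ ih => exact ih.of_bidirected ((hA _).1 hxy.2) hxy.1
      exact key _ h
    rcases hdir hca with h | h
    · rw [← h]; exact hc.reachFrom
    · exact (hc.reachVia ((hA c).1 c.2) h.1).reachFrom

/-- The global Markov property of a Gaussian recursion on an ancestral graph. -/
theorem partialUncorrelated_of_mseparated (hG : G.IsAncestral) {S T Φ : Matrix ι ι ℝ}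
    (hT : G.IsRecursion T) (hΦ : G.IsErrorCov Φ) (hST : T * S * Tᵀ = Φ) (hi : i ∉ Z)
    (hsep : G.MSeparated i j Z) : PartialUncorrelated S i j Z := by
  classical
  let A : ι → Prop := G.InAnterior i j Z
  have hA : ∀ a b, G.Anterior a b → A b → A a := fun a b hab hb => hb.of_anterior hab
  have hiA : A i := Or.inl .refl
  have hjA : A j := Or.inr (Or.inl .refl)
  have hZA : ∀ z ∈ Z, A z := fun z hz => Or.inr (Or.inr ⟨z, hz, .refl⟩)
  set v : {a // A a} → ι := Subtype.val with hv
  set T' := T.submatrix v v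
  set S' := S.submatrix v v
  set Φ' := Φ.submatrix v v
  have hΦ' : Φ'.PosDef := hΦ.posDef.submatrix Subtype.val_injective
  have hdet := (isUnit_iff_isUnit_det _).1 hΦ'.isUnit
  have hEq : T' * S' * T'ᵀ = Φ' := by
    rw [hT.submatrix A hA S, hST]
  have hT'u : IsUnit T'.det := by
    have h := hdet
    rw [← hEq, det_mul, det_mul] at h
    exact isUnit_of_mul_isUnit_left (isUnit_of_mul_isUnit_left h)
  set K := T'ᵀ * Φ'⁻¹ * T'
  have hSK : S' * K = 1 := by
    have h1 : T' * (S' * K) = T' * 1 := by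
      calc T' * (S' * K) = (T' * S' * T'ᵀ) * Φ'⁻¹ * T' := by simp only [K, Matrix.mul_assoc]
        _ = T' * 1 := by rw [hEq, mul_nonsing_inv _ hdet, one_mul, mul_one]
    have h2 := congrArg (T'⁻¹ * ·) h1
    simpa only [← Matrix.mul_assoc, nonsing_inv_mul _ hT'u, Matrix.one_mul] using h2
  have hKpd : K.PosDef := by
    have h1 : (Φ'⁻¹).PosDef := hΦ'.inv
    have := h1.conjTranspose_mul_mul_same (B := T')
      (mulVec_injective_iff_isUnit.2 ((isUnit_iff_isUnit_det _).2 hT'u))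
    rwa [conjTranspose_eq_transpose_of_trivial] at this
  -- `I` collects the vertices outside `Z` that are not linked to `j`. A nonzero concentration with
  -- a vertex outside both `I` and `Z` would extend a walk into `I`.
  let I : {a // A a} → Prop := fun a => a.1 ∉ Z ∧ ¬ G.ReachFrom i j Z a
  have hP : PartialUncorrelated S' ⟨i, hiA⟩ ⟨j, hjA⟩ (Z.subtype A) := by
    refine partialUncorrelated_of_inverse hSK hKpd I ⟨hi, fun h => h.not_mseparated hG hsep⟩
      (fun h => h.2 reachFrom_self) (fun k hk h => h.1 (Finset.mem_subtype.1 hk)) ?_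
    intro a b ha hb hbZ
    rw [Finset.mem_subtype] at hbZ
    have hbr : G.ReachFrom i j Z b := by
      by_contra h
      exact hb ⟨hbZ, h⟩
    by_contra hne
    have hsymm : K b a = K a b := by simpa using hKpd.1.apply a b
    rw [hsymm] at hne
    simp only [K, mul_apply, transpose_apply, Finset.sum_mul] at hne
    obtain ⟨d, -, hd⟩ := Finset.exists_ne_zero_of_sum_ne_zero hne
    obtain ⟨c, -, hc⟩ := Finset.exists_ne_zero_of_sum_ne_zero hd
    exact ha.2 (reachFrom_of_entries hT hΦ A (fun _ => Iff.rfl)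
      (left_ne_zero_of_mul (left_ne_zero_of_mul hc)) (right_ne_zero_of_mul (left_ne_zero_of_mul hc))
      (right_ne_zero_of_mul hc) hbZ hbr)
  obtain ⟨w, hw1, hw2, hw3, hw4⟩ := hP
  set w' : ι → ℝ := fun a => if h : A a then w ⟨a, h⟩ else 0 with hw'
  have hmul : ∀ a : {a // A a}, (S *ᵥ w') a = (S' *ᵥ w) a := by
    intro a
    rw [mulVec_eq_submatrix A S w' a fun b hb => by simp [hw', hb]]
    exact Finset.sum_congr rfl fun b _ => by simp [hw', b.2, S', hv]
  refine ⟨w', ?_, ?_, ?_, ?_⟩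
  · simp [hw', hiA, hw1]
  · intro k hki hkZ
    by_cases hk : A k
    · simp only [hw', hk, dif_pos]
      exact hw2 ⟨k, hk⟩ (fun h => hki (congrArg Subtype.val h)) (by simpa using hkZ)
    · simp [hw', hk]
  · intro k hk
    rw [hmul ⟨k, hZA k hk⟩]
    exact hw3 _ (by simpa using hk)
  · rw [hmul ⟨j, hjA⟩]
    exact hw4

end MixedGraph

set_option linter.unusedSectionVars false

/-! ### Linear regression -/

section Regression

variable {ι : Type*} [Fintype ι] [DecidableEq ι]

/-- The matrix of the linear system for the regression on the variables in `P`. -/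
def regressionMatrix {R : Type*} [CommRing R] (S : Matrix ι ι R) (P : Finset ι) : Matrix ι ι R :=
  Matrix.of fun a b => if a ∈ P then S a b else (1 : Matrix ι ι R) a b

theorem regressionMatrix_mulVec (S : Matrix ι ι ℝ) (P : Finset ι) (w : ι → ℝ) (a : ι) :
    (regressionMatrix S P *ᵥ w) a = if a ∈ P then (S *ᵥ w) a else w a := by
  by_cases h : a ∈ P
  · simp [regressionMatrix, mulVec, dotProduct, h]
  · simp [regressionMatrix, mulVec, dotProduct, h, one_apply]

/-- For a kernel vector, `w` vanishes off `P` and `S *ᵥ w` vanishes on `P`, so the quadratic form of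
`S` is zero at `w`. -/
theorem regressionMatrix_isUnit {S : Matrix ι ι ℝ} (hS : S.PosDef) (P : Finset ι) :
    IsUnit (regressionMatrix S P) := by
  rw [← mulVec_injective_iff_isUnit]
  change Function.Injective (regressionMatrix S P).mulVecLin
  rw [injective_iff_map_eq_zero]
  intro w hw
  by_contra hne
  have h1 := hS.dotProduct_mulVec_pos hne
  refine h1.ne' ?_
  rw [star_trivial, dotProduct]
  refine Finset.sum_eq_zero fun a _ => ?_
  have := congrFun hw a
  rw [mulVecLin_apply, regressionMatrix_mulVec] at this
  split_ifs at this with h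
  · rw [this]; simp
  · rw [this]; simp

/-- The coefficients of the residual of `X_i` after regression on the variables in `P`. -/
noncomputable def regressionResidual (S : Matrix ι ι ℝ) (P : Finset ι) (i : ι) : ι → ℝ :=
  (regressionMatrix S P)⁻¹ *ᵥ Pi.single i 1

variable {S : Matrix ι ι ℝ} {P : Finset ι} {i j : ι}

theorem regressionMatrix_mulVec_residual (hS : S.PosDef) :
    regressionMatrix S P *ᵥ regressionResidual S P i = Pi.single i 1 := by
  rw [regressionResidual, mulVec_mulVec, mul_nonsing_inv _
    ((isUnit_iff_isUnit_det _).1 (regressionMatrix_isUnit hS P)), one_mulVec]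

theorem regressionResidual_self (hS : S.PosDef) (hi : i ∉ P) : regressionResidual S P i i = 1 := by
  have := congrFun (regressionMatrix_mulVec_residual (P := P) (i := i) hS) i
  rwa [regressionMatrix_mulVec, if_neg hi, Pi.single_eq_same] at this

theorem regressionResidual_of_notMem (hS : S.PosDef) {k : ι} (hki : k ≠ i) (hk : k ∉ P) :
    regressionResidual S P i k = 0 := by
  have := congrFun (regressionMatrix_mulVec_residual (P := P) (i := i) hS) k
  rwa [regressionMatrix_mulVec, if_neg hk, Pi.single_eq_of_ne hki] at this

theorem mulVec_residual_of_mem (hS : S.PosDef) (hi : i ∉ P) {k : ι} (hk : k ∈ P) :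
    (S *ᵥ regressionResidual S P i) k = 0 := by
  have := congrFun (regressionMatrix_mulVec_residual (P := P) (i := i) hS) k
  rwa [regressionMatrix_mulVec, if_pos hk, Pi.single_eq_of_ne (fun h => hi (by rwa [← h]))] at this

theorem eq_residual (hS : S.PosDef) (hi : i ∉ P) {w : ι → ℝ} (h1 : w i = 1)
    (h2 : ∀ k, k ≠ i → k ∉ P → w k = 0) (h3 : ∀ k ∈ P, (S *ᵥ w) k = 0) : w = regressionResidual S P i := by
  apply mulVec_injective_iff_isUnit.2 (regressionMatrix_isUnit hS P)
  rw [regressionMatrix_mulVec_residual hS]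
  funext a
  rw [regressionMatrix_mulVec]
  split_ifs with h
  · rw [h3 a h, Pi.single_eq_of_ne (fun h' => hi (by rwa [← h']))]
  · by_cases ha : a = i
    · rw [ha, h1, Pi.single_eq_same]
    · rw [h2 a ha h, Pi.single_eq_of_ne ha]

theorem partialUncorrelated_iff (hS : S.PosDef) (hi : i ∉ P) :
    PartialUncorrelated S i j P ↔ (S *ᵥ regressionResidual S P i) j = 0 := by
  constructor
  · rintro ⟨w, h1, h2, h3, h4⟩
    rwa [← eq_residual hS hi h1 h2 h3]
  · intro h
    exact ⟨_, regressionResidual_self hS hi, fun k hk hk' => regressionResidual_of_notMem hS hk hk',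
      fun k hk => mulVec_residual_of_mem hS hi hk, h⟩

end Regression

/-! ### Markov covariance matrices come from recursions -/

namespace MixedGraph

variable {ι : Type*} [Fintype ι] [DecidableEq ι] {G : MixedGraph ι} {S : Matrix ι ι ℝ}

open Classical in
/-- The parents of `i`. -/
noncomputable def parents (G : MixedGraph ι) (i : ι) : Finset ι :=
  Finset.univ.filter fun k => G.Directed k i

theorem mem_parents {i k : ι} : k ∈ G.parents i ↔ G.Directed k i := by
  simp [parents]

theorem notMem_parents_self {i : ι} : i ∉ G.parents i := by
  rw [mem_parents]
  exact fun h => h.2 h.1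

/-- The residuals of the regressions of each variable on its parents. -/
noncomputable def recursion (G : MixedGraph ι) (S : Matrix ι ι ℝ) : Matrix ι ι ℝ :=
  Matrix.of fun i => regressionResidual S (G.parents i) i

theorem isRecursion_recursion (hS : S.PosDef) : G.IsRecursion (G.recursion S) where
  diag _ := regressionResidual_self hS notMem_parents_self
  off _ _ hik hk := regressionResidual_of_notMem hS (Ne.symm hik) (fun h => hk (mem_parents.1 h))

theorem recursion_mul_mul (A : Matrix ι ι ℝ) (i j : ι) :
    (A * S * Aᵀ) i j = A i ⬝ᵥ S *ᵥ A j := by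
  rw [Matrix.mul_assoc, mul_apply, dotProduct]
  refine Finset.sum_congr rfl fun k _ => ?_
  rfl

/-- The covariance matrix `S` satisfies the conditional independences that hold in `G`. -/
def IsMarkov (G : MixedGraph ι) (S : Matrix ι ι ℝ) : Prop :=
  ∀ (i j : ι) (Z : Finset ι), i ≠ j → i ∉ Z → j ∉ Z → G.MSeparated i j Z →
    PartialUncorrelated S i j Z

open Classical in
/-- The vertices other than `i`, `j` that are anterior to `i` or `j`. -/
noncomputable def anteriorFinset (G : MixedGraph ι) (i j : ι) : Finset ι :=
  Finset.univ.filter fun v => (G.Anterior v i ∨ G.Anterior v j) ∧ v ≠ i ∧ v ≠ j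

theorem mem_anteriorFinset {i j v : ι} : v ∈ G.anteriorFinset i j ↔
    (G.Anterior v i ∨ G.Anterior v j) ∧ v ≠ i ∧ v ≠ j := by
  simp [anteriorFinset]

theorem IsMarkov.of_anterior (hS : G.IsMarkov S) (hG : G.IsMAG) {i j : ι} (hne : i ≠ j)
    (hadj : ¬ G.skeleton.Adj i j) : PartialUncorrelated S i j (G.anteriorFinset i j) :=
  hS i j _ hne (fun h => (mem_anteriorFinset.1 h).2.1 rfl)
    (fun h => (mem_anteriorFinset.1 h).2.2 rfl) (hG.mseparated_anterior hne hadj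
      fun _ => mem_anteriorFinset)

/-- In an ancestral graph the edges between a vertex with an arrowhead and the vertices that are
anterior to it come from its parents. -/
theorem IsAncestral.directed_of_adj (hG : G.IsAncestral) {i k : ι} (hi : ¬ G.IsHeadless i)
    (hk : G.Anterior k i) (hadj : G.skeleton.Adj i k) : G.Directed k i := by
  have h1 : ¬ G.head i k := fun h => hG.not_anterior h hk
  rcases step_of_not_head hadj.symm h1 with h | h
  · exact absurd (hG.isHeadless_of_undirected h.symm) hi
  · exact h

/-- In the regression of `X_i` on all variables anterior to it, a nonparent `v` has coefficient
zero, because `i` and `v` are independent given the others. By uniqueness the regression on the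
parents has the same residual. -/
theorem IsMarkov.mulVec_recursion (hM : G.IsMarkov S) (hS : S.PosDef) (hG : G.IsMAG) {i k : ι}
    (hi : ¬ G.IsHeadless i) (hk : G.Anterior k i) (hki : k ≠ i) :
    (S *ᵥ G.recursion S i) k = 0 := by
  classical
  set P : Finset ι := Finset.univ.filter fun v => G.Anterior v i ∧ v ≠ i with hP
  have hmem : ∀ v, v ∈ P ↔ G.Anterior v i ∧ v ≠ i := fun v => by simp [hP]
  have hiP : i ∉ P := fun h => ((hmem i).1 h).2 rfl
  have hsupp : ∀ v, v ≠ i → v ∉ G.parents i → regressionResidual S P i v = 0 := by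
    intro v hvi hv
    by_cases hvP : v ∈ P
    · have hva := ((hmem v).1 hvP).1
      have hadj : ¬ G.skeleton.Adj i v := fun h =>
        hv (mem_parents.2 (hG.1.directed_of_adj hi hva h))
      obtain ⟨w, h1, h2, h3, h4⟩ := hM.of_anterior hG (Ne.symm hvi) hadj
      have hset : ∀ x, x ∈ P ↔ x ∈ G.anteriorFinset i v ∨ x = v := by
        intro x
        rw [hmem, mem_anteriorFinset]
        constructor
        · rintro ⟨h, h'⟩
          by_cases hx : x = v
          · exact Or.inr hx
          · exact Or.inl ⟨Or.inl h, h', hx⟩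
        · rintro (⟨h, h', -⟩ | rfl)
          · exact ⟨h.elim id fun h => h.trans hva, h'⟩
          · exact ⟨hva, hvi⟩
      have hw : w = regressionResidual S P i := by
        refine eq_residual hS hiP h1 (fun x hx hxP => h2 x hx fun h => hxP ((hset x).2 (Or.inl h)))
          fun x hx => ?_
        rcases (hset x).1 hx with h | rfl
        · exact h3 x h
        · exact h4
      rw [← hw]
      exact h2 v hvi fun h => (mem_anteriorFinset.1 h).2.2 rfl
    · exact regressionResidual_of_notMem hS hvi hvP
  have hpar : ∀ v ∈ G.parents i, v ∈ P := fun v hv =>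
    (hmem v).2 ⟨.single (Or.inr (mem_parents.1 hv)),
      fun h => notMem_parents_self (G := G) (h ▸ hv)⟩
  have heq : regressionResidual S P i = regressionResidual S (G.parents i) i :=
    eq_residual hS notMem_parents_self (regressionResidual_self hS hiP) hsupp
      fun x hx => mulVec_residual_of_mem hS hiP (hpar x hx)
  change (S *ᵥ regressionResidual S (G.parents i) i) k = 0
  rw [← heq]
  exact mulVec_residual_of_mem hS hiP ((hmem k).2 ⟨hk, hki⟩)

theorem recursion_of_isHeadless (hS : S.PosDef) {i : ι} (hi : G.IsHeadless i) :
    G.recursion S i = Pi.single i 1 := by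
  funext k
  by_cases hk : k = i
  · rw [hk, Pi.single_eq_same]
    exact (isRecursion_recursion hS).diag i
  · rw [Pi.single_eq_of_ne hk]
    exact (isRecursion_recursion hS).off i k (Ne.symm hk) fun h => hi _ h.1

/-- The covariance matrix of the residuals of the regressions on the parents. -/
noncomputable def errorCov (G : MixedGraph ι) (S : Matrix ι ι ℝ) : Matrix ι ι ℝ :=
  G.recursion S * S * (G.recursion S)ᵀ

theorem posDef_errorCov (hS : S.PosDef) (hG : G.IsAncestral) : (G.errorCov S).PosDef := by
  have := hS.mul_mul_conjTranspose_same (B := G.recursion S)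
    (vecMul_injective_iff_isUnit.2 ((isRecursion_recursion hS).isUnit hG))
  rwa [conjTranspose_eq_transpose_of_trivial] at this

theorem errorCov_symm (hS : S.PosDef) (hG : G.IsAncestral) (i j : ι) :
    G.errorCov S i j = G.errorCov S j i := by
  simpa using (posDef_errorCov hS hG).1.apply j i

/-- The error at `j` combines variables anterior to `j`, hence to `i` and different from `i`; the
error at `i` is uncorrelated with all of them. -/
theorem IsMarkov.errorCov_of_anterior (hM : G.IsMarkov S) (hS : S.PosDef) (hG : G.IsMAG) {i j : ι}
    (hi : ¬ G.IsHeadless i) (hj : G.Anterior j i) (hji : j ≠ i) : G.errorCov S i j = 0 := by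
  rw [errorCov_symm hS hG.1, errorCov, recursion_mul_mul, dotProduct]
  refine Finset.sum_eq_zero fun k _ => ?_
  by_cases hk : G.recursion S j k = 0
  · rw [hk, zero_mul]
  · have hkj := (isRecursion_recursion hS).anterior hk
    rw [hM.mulVec_recursion hS hG hi (hkj.trans hj), mul_zero]
    rintro rfl
    exact hji (hG.1.eq_of_anterior hj hkj hi)

/-- If the headless `j` is not anterior to `i`, it is marginally independent of each variable in the
residual of `X_i`, by separation given the empty set. -/
theorem IsMarkov.errorCov_mixed (hM : G.IsMarkov S) (hS : S.PosDef) (hG : G.IsMAG) {i j : ι}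
    (hi : ¬ G.IsHeadless i) (hj : G.IsHeadless j) : G.errorCov S i j = 0 := by
  have hne : j ≠ i := fun h => hi (h ▸ hj)
  by_cases hant : G.Anterior j i
  · exact hM.errorCov_of_anterior hS hG hi hant hne
  · rw [errorCov, recursion_mul_mul, recursion_of_isHeadless hS hj, dotProduct]
    refine Finset.sum_eq_zero fun k _ => ?_
    by_cases hk : G.recursion S i k = 0
    · rw [hk, zero_mul]
    · have hki := (isRecursion_recursion hS).anterior hk
      have hjk : ¬ G.Anterior j k := fun h => hant (h.trans hki)
      obtain ⟨w, h1, h2, -, h4⟩ := hM j k ∅ (fun h => hjk (h ▸ .refl)) (by simp) (by simp)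
        (mseparated_empty hG.1 hj hjk)
      have hw : w = Pi.single j 1 := by
        funext x
        by_cases hx : x = j
        · rw [hx, h1, Pi.single_eq_same]
        · rw [h2 x hx (by simp), Pi.single_eq_of_ne hx]
      rw [hw] at h4
      rw [h4, mul_zero]

-- This is the measure for the induction over pairs: any other pair of vertices anterior to `i` or
-- `j` generates a smaller anterior set.
open Classical in
theorem card_anterior_lt (hG : G.IsAncestral) {i j a b : ι} (hne : i ≠ j) (hi : ¬ G.IsHeadless i)
    (hj : ¬ G.IsHeadless j) (hij : ¬ G.Anterior i j) (hji : ¬ G.Anterior j i)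
    (ha : G.Anterior a i ∨ G.Anterior a j) (hb : G.Anterior b i ∨ G.Anterior b j)
    (h : ¬ (a = i ∧ b = j)) (h' : ¬ (a = j ∧ b = i)) :
    (Finset.univ.filter fun v => G.Anterior v a ∨ G.Anterior v b).card <
      (Finset.univ.filter fun v => G.Anterior v i ∨ G.Anterior v j).card := by
  have key : ∀ c, (G.Anterior c i ∨ G.Anterior c j) → (G.Anterior i c → c = i) ∧
      (G.Anterior j c → c = j) := by
    intro c hc
    refine ⟨fun hic => ?_, fun hjc => ?_⟩
    · rcases hc with hc | hc
      · exact hG.eq_of_anterior hc hic hi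
      · exact absurd (hic.trans hc) hij
    · rcases hc with hc | hc
      · exact absurd (hjc.trans hc) hji
      · exact hG.eq_of_anterior hc hjc hj
  refine Finset.card_lt_card (Finset.ssubset_iff_subset_ne.2 ⟨fun x hx => ?_, fun he => ?_⟩)
  · simp only [Finset.mem_filter, Finset.mem_univ, true_and] at hx ⊢
    rcases hx with hx | hx
    · exact ha.imp hx.trans hx.trans
    · exact hb.imp hx.trans hx.trans
  · have h1 : i ∈ Finset.univ.filter fun v => G.Anterior v a ∨ G.Anterior v b := by
      rw [he]; simp only [Finset.mem_filter, Finset.mem_univ, true_and]; exact Or.inl .refl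
    have h2 : j ∈ Finset.univ.filter fun v => G.Anterior v a ∨ G.Anterior v b := by
      rw [he]; simp only [Finset.mem_filter, Finset.mem_univ, true_and]; exact Or.inr .refl
    simp only [Finset.mem_filter, Finset.mem_univ, true_and] at h1 h2
    have h1' := h1.imp (key a ha).1 (key b hb).1
    have h2' := h2.imp (key a ha).2 (key b hb).2
    rcases h1' with rfl | rfl <;> rcases h2' with rfl | rfl
    · exact hne rfl
    · exact h ⟨rfl, rfl⟩
    · exact h' ⟨rfl, rfl⟩
    · exact hne rfl

/-- The step of the induction in `IsMarkov.errorCov_bidirected`. -/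
theorem IsMarkov.errorCov_of_forall (hM : G.IsMarkov S) (hS : S.PosDef) (hG : G.IsMAG) {i j : ι}
    (hne : i ≠ j) (hi : ¬ G.IsHeadless i) (hj : ¬ G.IsHeadless j) (hij : ¬ G.Anterior i j)
    (hji : ¬ G.Anterior j i) (hadj : ¬ G.skeleton.Adj i j)
    (ih : ∀ a b, ¬ G.IsHeadless a → ¬ G.IsHeadless b → a ≠ b → ¬ G.Bidirected a b →
      (G.Anterior a i ∨ G.Anterior a j) → (G.Anterior b i ∨ G.Anterior b j) →
      ¬ (a = i ∧ b = j) → ¬ (a = j ∧ b = i) → G.errorCov S a b = 0) :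
    G.errorCov S i j = 0 := by
  classical
  set T := G.recursion S with hT
  set Φ := G.errorCov S with hΦ
  have hrec : G.IsRecursion T := isRecursion_recursion hS
  have hpd : Φ.PosDef := posDef_errorCov hS hG.1
  let A : ι → Prop := fun v => G.Anterior v i ∨ G.Anterior v j
  have hA : ∀ a b, G.Anterior a b → A b → A a := fun a b hab hb => hb.imp hab.trans hab.trans
  -- `w` holds the coefficients of the residual of `X_j`; independence of `X_i` makes `S *ᵥ w`
  -- vanish at `i` as well, while `w i = 0`.
  obtain ⟨w, hw1, hw2, hw3, hw4⟩ := hM.of_anterior hG hne.symm (fun h => hadj h.symm)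
  have hmem : ∀ v, v ∈ G.anteriorFinset j i ↔ A v ∧ v ≠ j ∧ v ≠ i := fun v => by
    rw [mem_anteriorFinset, or_comm]
  have hSw : ∀ a, A a → a ≠ j → (S *ᵥ w) a = 0 := by
    intro a ha haj
    by_cases hai : a = i
    · rw [hai]; exact hw4
    · exact hw3 a ((hmem a).2 ⟨ha, haj, hai⟩)
  have hwA : ∀ a, ¬ A a → w a = 0 := fun a ha => hw2 a (fun h => ha (h ▸ Or.inr .refl))
    fun h => ha ((hmem a).1 h).1
  have hwi : w i = 0 := hw2 i hne fun h => ((hmem i).1 h).2.2 rfl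
  have hTu : IsUnit Tᵀ.det := by
    rw [det_transpose]; exact (isUnit_iff_isUnit_det _).1 (hrec.isUnit hG.1)
  -- `v` expresses the same residual in the errors. As `i` and `j` have no children in `A`, it
  -- agrees with `w` at both.
  set v := (Tᵀ)⁻¹ *ᵥ w with hv
  have hTv : Tᵀ *ᵥ v = w := by rw [hv, mulVec_mulVec, mul_nonsing_inv _ hTu, one_mulVec]
  have hvA : ∀ a, ¬ A a → v a = 0 := fun a ha =>
    hrec.eq_zero_of_vecMul hG.1 A hA (fun b hb => by rw [hTv]; exact hwA b hb) ha
  have hsink : ∀ c a, (c = i ∨ c = j) → a ≠ c → T a c * v a = 0 := by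
    intro c a hc hac
    by_cases ha : A a
    · rw [hrec.off a c hac, zero_mul]
      intro hd
      have hca : G.Anterior c a := .single (Or.inr hd)
      rcases hc with rfl | rfl
      · rcases ha with ha | ha
        · exact hac (hG.1.eq_of_anterior ha hca hi)
        · exact hij (hca.trans ha)
      · rcases ha with ha | ha
        · exact hji (hca.trans ha)
        · exact hac (hG.1.eq_of_anterior ha hca hj)
    · rw [hvA a ha, mul_zero]
  have hval : ∀ c, (c = i ∨ c = j) → v c = w c := by
    intro c hc
    rw [← hTv, mulVec, dotProduct, Finset.sum_eq_single c]
    · rw [transpose_apply, hrec.diag, one_mul]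
    · intro a _ hac
      rw [transpose_apply]; exact hsink c a hc hac
    · simp
  have hvi : v i = 0 := by rw [hval i (Or.inl rfl), hwi]
  have hvj : v j = 1 := by rw [hval j (Or.inr rfl), hw1]
  have hΦv : ∀ a, A a → a ≠ j → (Φ *ᵥ v) a = 0 := by
    intro a ha haj
    have h1 : Φ *ᵥ v = T *ᵥ (S *ᵥ w) := by
      have h2 : Φ = T * S * Tᵀ := rfl
      clear_value v
      rw [← hTv, mulVec_mulVec, mulVec_mulVec, h2]
    rw [h1, mulVec, dotProduct]
    refine Finset.sum_eq_zero fun b _ => ?_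
    by_cases hTab : T a b = 0
    · rw [hTab, zero_mul]
    · have hba := hrec.anterior hTab
      rw [hSw b (hA b a hba ha), mul_zero]
      rintro rfl
      rcases ha with ha | ha
      · exact hji (hba.trans ha)
      · exact haj (hG.1.eq_of_anterior ha hba hj)
  -- `Dset` is reached from `i` along bidirected edges within `A` that avoid `j`. By induction `Φ`
  -- vanishes between `Dset` and the rest of `A` apart from `j`; as there is no inducing path, it
  -- also vanishes between `j` and all members of `Dset` other than `i`.
  let R : ι → ι → Prop := fun x y => G.Bidirected x y ∧ A y ∧ y ≠ j
  let Dset : ι → Prop := Relation.ReflTransGen R i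
  have hD : ∀ a, Dset a → A a ∧ a ≠ j ∧ ¬ G.IsHeadless a := by
    intro a ha
    rcases Relation.ReflTransGen.cases_tail ha with rfl | ⟨c, -, hca⟩
    · exact ⟨Or.inl .refl, hne, hi⟩
    · exact ⟨hca.2.1, hca.2.2, fun h => h c hca.1.1⟩
  have hDj : ∀ a, Dset a → ¬ G.Bidirected a j := fun a ha =>
    hG.not_bidirected_chain hne hadj (Relation.ReflTransGen.mono
      (fun x y (h : R x y) => (⟨h.1, h.2.1⟩ : G.Bidirected x y ∧ A y)) i a ha)
  have hΦj : ∀ a, Dset a → a ≠ i → Φ a j = 0 := by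
    intro a ha hai
    obtain ⟨h1, h2, h3⟩ := hD a ha
    exact ih a j h3 hj h2 (hDj a ha) h1 (Or.inr .refl) (fun h => hai h.1) (fun h => h2 h.1)
  set y : ι → ℝ := fun a => if Dset a then v a else 0 with hy
  have hΦy : ∀ a, Dset a → (Φ *ᵥ y) a = - Φ a j := by
    intro a ha
    obtain ⟨h1, h2, h3⟩ := hD a ha
    have h0 := hΦv a h1 h2
    have hsplit : (Φ *ᵥ v) a = (Φ *ᵥ y) a + Φ a j := by
      have hsum : Φ a j = ∑ b, Φ a b * (if b = j then 1 else 0) := by simp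
      rw [hsum, mulVec, mulVec, dotProduct, dotProduct, ← Finset.sum_add_distrib]
      refine Finset.sum_congr rfl fun b _ => ?_
      by_cases hbj : b = j
      · have hnb : ¬ Dset b := fun h => (hD b h).2.1 hbj
        simp only [hy, if_neg hnb, if_pos hbj, mul_zero, mul_one, zero_add]
        rw [hbj, hvj, mul_one]
      · simp only [hy, if_neg hbj, mul_zero, add_zero]
        by_cases hb : Dset b
        · rw [if_pos hb]
        · rw [if_neg hb, mul_zero]
          by_cases hbA : A b
          · have hzero : Φ a b = 0 := by
              by_cases hbl : G.IsHeadless b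
              · exact hM.errorCov_mixed hS hG h3 hbl
              · refine ih a b h3 hbl (fun h => hb (h ▸ ha)) (fun h => hb (ha.tail ⟨h, hbA, hbj⟩))
                  h1 hbA (fun h => hbj h.2) (fun h => h2 h.1)
            rw [hzero, zero_mul]
          · rw [hvA b hbA, mul_zero]
    linarith
  -- On `Dset` the vector `Φ *ᵥ y` is supported at `i`, where `v` is zero. Hence `y = 0`, and the
  -- equation at `i` becomes `Φ i j = 0`.
  have hquad : y ⬝ᵥ Φ *ᵥ y = 0 := by
    rw [dotProduct]
    refine Finset.sum_eq_zero fun a _ => ?_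
    by_cases ha : Dset a
    · by_cases hai : a = i
      · simp [hy, hai, hvi]
      · rw [hΦy a ha, hΦj a ha hai, neg_zero, mul_zero]
    · simp [hy, ha]
  have hy0 : y = 0 := by
    by_contra hne
    have := hpd.dotProduct_mulVec_pos hne
    rw [star_trivial, hquad] at this
    exact lt_irrefl _ this
  have := hΦy i .refl
  rw [hy0, mulVec_zero, Pi.zero_apply] at this
  linarith

theorem IsMarkov.errorCov_bidirected (hM : G.IsMarkov S) (hS : S.PosDef) (hG : G.IsMAG) (i j : ι)
    (hi : ¬ G.IsHeadless i) (hj : ¬ G.IsHeadless j) (hne : i ≠ j) (hb : ¬ G.Bidirected i j) :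
    G.errorCov S i j = 0 := by
  classical
  induction hn : (Finset.univ.filter fun v => G.Anterior v i ∨ G.Anterior v j).card
    using Nat.strong_induction_on generalizing i j with
  | _ n ih =>
  by_cases hji : G.Anterior j i
  · exact hM.errorCov_of_anterior hS hG hi hji hne.symm
  by_cases hij : G.Anterior i j
  · rw [errorCov_symm hS hG.1]
    exact hM.errorCov_of_anterior hS hG hj hij hne
  have hadj : ¬ G.skeleton.Adj i j := by
    intro h
    by_cases h1 : G.head j i
    · by_cases h2 : G.head i j
      · exact hb ⟨h2, h1⟩
      · exact hji (anterior_of_not_head h.symm h2)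
    · exact hij (anterior_of_not_head h h1)
  refine hM.errorCov_of_forall hS hG hne hi hj hij hji hadj ?_
  intro a b ha hb' hab hbi haA hbA h h'
  exact ih _ (hn ▸ card_anterior_lt hG.1 hne hi hj hij hji haA hbA h h') a b ha hb' hab hbi rfl

/-- Regressing `X_j` on the other headless variables but `X_i` gives `w` with `Φ *ᵥ w` supported at
`j`. So `w` is a multiple of column `j` of `Φ⁻¹`, nonzero since `w j = 1`, and it vanishes at `i`.
-/
theorem IsMarkov.inv_errorCov_undirected (hM : G.IsMarkov S) (hS : S.PosDef) (hG : G.IsMAG) {i j : ι}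
    (hi : G.IsHeadless i) (hj : G.IsHeadless j) (hne : i ≠ j) (hu : ¬ G.Undirected i j) :
    (G.errorCov S)⁻¹ i j = 0 := by
  classical
  set Φ := G.errorCov S with hΦ
  have hpd : Φ.PosDef := posDef_errorCov hS hG.1
  have hadj : ¬ G.skeleton.Adj j i := fun h => hu (hi.undirected hj h.symm)
  set Z : Finset ι := Finset.univ.filter fun v => G.IsHeadless v ∧ v ≠ j ∧ v ≠ i with hZ
  have hmem : ∀ v, v ∈ Z ↔ G.IsHeadless v ∧ v ≠ j ∧ v ≠ i := fun v => by simp [hZ]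
  obtain ⟨w, h1, h2, h3, h4⟩ := hM j i Z hne.symm (fun h => ((hmem j).1 h).2.1 rfl)
    (fun h => ((hmem i).1 h).2.2 rfl) (mseparated_headless hG.1 hj hi hne.symm hadj hmem)
  have hw : ∀ v, ¬ G.IsHeadless v → w v = 0 := fun v hv =>
    h2 v (fun h => hv (h ▸ hj)) fun h => hv ((hmem v).1 h).1
  have hΦw : Φ *ᵥ w = Pi.single j ((S *ᵥ w) j) := by
    funext a
    by_cases ha : G.IsHeadless a
    · have hcalc : (Φ *ᵥ w) a = (S *ᵥ w) a := by
        rw [mulVec, mulVec, dotProduct, dotProduct]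
        refine Finset.sum_congr rfl fun b _ => ?_
        by_cases hb : G.IsHeadless b
        · rw [hΦ, errorCov, recursion_mul_mul, recursion_of_isHeadless hS ha,
            recursion_of_isHeadless hS hb, mulVec_single_one, single_one_dotProduct, col_apply]
        · rw [hw b hb, mul_zero, mul_zero]
      rw [hcalc]
      by_cases haj : a = j
      · rw [haj, Pi.single_eq_same]
      · rw [Pi.single_eq_of_ne haj]
        by_cases hai : a = i
        · rw [hai]; exact h4
        · exact h3 a ((hmem a).2 ⟨ha, haj, hai⟩)
    · rw [Pi.single_eq_of_ne (fun h => ha (by rwa [h])), mulVec, dotProduct]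
      refine Finset.sum_eq_zero fun b _ => ?_
      by_cases hb : G.IsHeadless b
      · rw [hΦ, hM.errorCov_mixed hS hG ha hb, zero_mul]
      · rw [hw b hb, mul_zero]
  have hdet := (isUnit_iff_isUnit_det _).1 hpd.isUnit
  have hwe : w = (S *ᵥ w) j • fun a => Φ⁻¹ a j := by
    calc w = Φ⁻¹ *ᵥ (Φ *ᵥ w) := by rw [mulVec_mulVec, nonsing_inv_mul _ hdet, one_mulVec]
      _ = _ := by
        rw [hΦw]
        funext a
        rw [mulVec_single, Pi.smul_apply]
        simp [mul_comm]
  have hwi := congrFun hwe i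
  have hwj := congrFun hwe j
  rw [h2 i hne fun h => ((hmem i).1 h).2.2 rfl, Pi.smul_apply, smul_eq_mul] at hwi
  rw [h1, Pi.smul_apply, smul_eq_mul] at hwj
  rcases mul_eq_zero.1 hwi.symm with h | h
  · rw [h, zero_mul] at hwj
    exact absurd hwj one_ne_zero
  · exact h

/-- Every positive definite matrix that satisfies the conditional independences of a maximal
ancestral graph arises from a recursion on the graph. -/
theorem IsMarkov.isErrorCov (hM : G.IsMarkov S) (hS : S.PosDef) (hG : G.IsMAG) :
    G.IsErrorCov (G.errorCov S) where
  posDef := posDef_errorCov hS hG.1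
  mixed i j hi hj := by
    rw [errorCov_symm hS hG.1]
    exact hM.errorCov_mixed hS hG hj hi
  bidirected := hM.errorCov_bidirected hS hG
  undirected _ _ hi hj hne hu := hM.inv_errorCov_undirected hS hG hi hj hne hu

theorem isMarkov_of_isErrorCov (hG : G.IsAncestral) {T Φ : Matrix ι ι ℝ}
    (hT : G.IsRecursion T) (hΦ : G.IsErrorCov Φ) (hST : T * S * Tᵀ = Φ) : G.IsMarkov S :=
  fun _ _ _ _ hi _ hsep => partialUncorrelated_of_mseparated hG hT hΦ hST hi hsep

end MixedGraph

/-! ### Conditional independence through an independent residual -/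

section Conditional

variable {Ω α : Type*} [MeasurableSpace Ω] [MeasurableSpace α] {μ : Measure Ω}
  [IsProbabilityMeasure μ]

/-- The conditional distribution of `Y + l(U)` given `U` for independent `U`, `Y`. -/
noncomputable def shiftKernel (l : α → ℝ) (ν : Measure ℝ) : Kernel α ℝ :=
  (Kernel.id ×ₖ Kernel.const α ν).map fun p => p.2 + l p.1

theorem map_prodMk_eq_compProd_shiftKernel {U : Ω → α} {Y : Ω → ℝ} (hU : Measurable U)
    (hY : Measurable Y) (hUY : IndepFun U Y μ) {l : α → ℝ} (hl : Measurable l) :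
    μ.map (fun ω => (U ω, Y ω + l (U ω))) = μ.map U ⊗ₘ shiftKernel l (μ.map Y) := by
  have : IsProbabilityMeasure (μ.map Y) := Measure.isProbabilityMeasure_map hY.aemeasurable
  have : IsProbabilityMeasure (μ.map U) := Measure.isProbabilityMeasure_map hU.aemeasurable
  have hφ : Measurable fun p : α × ℝ => p.2 + l p.1 := by fun_prop
  have : IsMarkovKernel (shiftKernel l (μ.map Y)) := by
    unfold shiftKernel; exact Kernel.IsMarkovKernel.map _ hφ
  have hg : Measurable fun p : α × ℝ => (p.1, p.2 + l p.1) := by fun_prop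
  have h1 : μ.map (fun ω => (U ω, Y ω + l (U ω))) =
      ((μ.map U).prod (μ.map Y)).map fun p => (p.1, p.2 + l p.1) := by
    rw [← (indepFun_iff_map_prod_eq_prod_map_map hU.aemeasurable hY.aemeasurable).1 hUY,
      Measure.map_map hg (hU.prodMk hY)]
    rfl
  rw [h1]
  ext s hs
  rw [Measure.map_apply hg hs, Measure.prod_apply (hg hs), Measure.compProd_apply hs]
  refine lintegral_congr fun u => ?_
  rw [shiftKernel, Kernel.map_apply' _ hφ _ (measurable_prodMk_left hs),
    Kernel.prod_apply, Kernel.id_apply, Kernel.const_apply, Measure.dirac_prod,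
    Measure.map_apply measurable_prodMk_left (hφ (measurable_prodMk_left hs))]
  rfl

/-- Given `(k, g)`, the law of `f` is the law of `Y` shifted by `l(k)`. It does not involve `g`, so
it is also the law given `k`. -/
theorem condIndepFun_of_indepFun [StandardBorelSpace Ω] {k : Ω → α} {f g Y : Ω → ℝ} (hk : Measurable k)
    (hf : Measurable f) (hg : Measurable g) (hY : Measurable Y) {l : α → ℝ} (hl : Measurable l)
    (hfY : ∀ ω, f ω = Y ω + l (k ω)) (h : IndepFun (fun ω => (k ω, g ω)) Y μ) :
    CondIndepFun (MeasurableSpace.comap k inferInstance) hk.comap_le f g μ := by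
  have : IsProbabilityMeasure (μ.map Y) := Measure.isProbabilityMeasure_map hY.aemeasurable
  have hφ : Measurable fun p : α × ℝ => p.2 + l p.1 := by fun_prop
  have hM : IsMarkovKernel (shiftKernel l (μ.map Y)) := by
    unfold shiftKernel; exact Kernel.IsMarkovKernel.map _ hφ
  refine CondIndepFun.symm ?_
  rw [condIndepFun_iff_condDistrib_prod_ae_eq_prodMkRight hf hg hk]
  have hfe : f = fun ω => Y ω + l (k ω) := funext hfY
  have h1 : condDistrib f k μ =ᵐ[μ.map k] shiftKernel l (μ.map Y) := by
    refine condDistrib_ae_eq_of_measure_eq_compProd k hf.aemeasurable ?_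
    rw [hfe]
    exact map_prodMk_eq_compProd_shiftKernel hk hY (h.comp measurable_fst measurable_id) hl
  have h2 : condDistrib f (fun ω => (k ω, g ω)) μ =ᵐ[μ.map fun ω => (k ω, g ω)]
      (shiftKernel l (μ.map Y)).prodMkRight ℝ := by
    refine condDistrib_ae_eq_of_measure_eq_compProd _ hf.aemeasurable ?_
    rw [hfe, map_prodMk_eq_compProd_shiftKernel (U := fun ω => (k ω, g ω))
      (l := fun p : α × ℝ => l p.1) (hk.prodMk hg) hY h (by fun_prop)]
    congr 1
    ext p s hs
    have hφ' : Measurable fun p : (α × ℝ) × ℝ => p.2 + l p.1.1 := by fun_prop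
    rw [Kernel.prodMkRight_apply, shiftKernel, shiftKernel, Kernel.map_apply' _ hφ _ hs,
      Kernel.map_apply' _ hφ' _ hs,
      Kernel.prod_apply, Kernel.id_apply, Kernel.const_apply, Measure.dirac_prod,
      Measure.map_apply measurable_prodMk_left (hφ' hs),
      Kernel.prod_apply, Kernel.id_apply, Kernel.const_apply, Measure.dirac_prod,
      Measure.map_apply measurable_prodMk_left (hφ hs)]
    rfl
  have h3 : (fun p : α × ℝ => condDistrib f k μ p.1) =ᵐ[μ.map fun ω => (k ω, g ω)]
      fun p => shiftKernel l (μ.map Y) p.1 := by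
    have hfst : (μ.map fun ω => (k ω, g ω)).map Prod.fst = μ.map k := by
      rw [Measure.map_map measurable_fst (hk.prodMk hg)]; rfl
    exact ae_of_ae_map measurable_fst.aemeasurable (hfst ▸ h1)
  filter_upwards [h2, h3] with p hp2 hp3
  rw [hp2, Kernel.prodMkRight_apply, Kernel.prodMkRight_apply, hp3]

/-- Conditional independence gives E[f | k, g] = E[f | k] = l(k), so `Y` has conditional expectation
zero given `(k, g)` and is orthogonal to `g`. -/
theorem integral_mul_eq_zero_of_condIndepFun [StandardBorelSpace Ω] {k : Ω → α} {f g Y : Ω → ℝ}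
    (hk : Measurable k)
    (hf : Measurable f) (hg : Measurable g) (hY : Measurable Y) {l : α → ℝ} (hl : Measurable l)
    (hfY : ∀ ω, f ω = Y ω + l (k ω)) (hYk : IndepFun k Y μ) (hY0 : ∫ ω, Y ω ∂μ = 0)
    (hYL : MemLp Y 2 μ) (hfL : MemLp f 2 μ) (hgL : MemLp g 2 μ)
    (h : CondIndepFun (MeasurableSpace.comap k inferInstance) hk.comap_le f g μ) :
    ∫ ω, Y ω * g ω ∂μ = 0 := by
  have h0 := (condIndepFun_iff_condDistrib_prod_ae_eq_prodMkRight hf hg hk).1 h.symm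
  have hfi := hfL.integrable one_le_two
  have hYi := hYL.integrable one_le_two
  have hkg : Measurable fun ω => (k ω, g ω) := hk.prodMk hg
  have h1 := condExp_ae_eq_integral_condDistrib' (μ := μ) hkg hfi
  have h2 := condExp_ae_eq_integral_condDistrib' (μ := μ) hk hfi
  have h3 := ae_of_ae_map hkg.aemeasurable h0
  have hlk : (fun ω => l (k ω)) = f - Y := by
    funext ω; rw [Pi.sub_apply, hfY]; ring
  have hli : Integrable (fun ω => l (k ω)) μ := hlk ▸ hfi.sub hYi
  have h4 : μ[f | MeasurableSpace.comap k inferInstance] =ᵐ[μ] fun ω => l (k ω) := by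
    have hfe : f = Y + fun ω => l (k ω) := funext hfY
    have hm : Measurable[MeasurableSpace.comap k inferInstance] fun ω => l (k ω) :=
      hl.comp (comap_measurable k)
    rw [hfe]
    refine (condExp_add hYi hli _).trans ?_
    have hc := condExp_indep_eq (μ := μ) hY.comap_le hk.comap_le
      (comap_measurable Y).stronglyMeasurable (IndepFun.symm hYk)
    rw [condExp_of_stronglyMeasurable hk.comap_le hm.stronglyMeasurable hli]
    filter_upwards [hc] with ω e
    rw [Pi.add_apply, e, hY0, zero_add]
  have h5 : μ[f | MeasurableSpace.comap (fun ω => (k ω, g ω)) inferInstance] =ᵐ[μ]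
      fun ω => l (k ω) := by
    filter_upwards [h1, h2, h3, h4] with ω e1 e2 e3 e4
    rw [e1, e3, ← e4, e2, Kernel.prodMkRight_apply]
  have hYe : μ[Y | MeasurableSpace.comap (fun ω => (k ω, g ω)) inferInstance] =ᵐ[μ] 0 := by
    have hYf : Y = f - fun ω => l (k ω) := by
      funext ω; rw [Pi.sub_apply, hfY]; ring
    have hm : Measurable[MeasurableSpace.comap (fun ω => (k ω, g ω)) inferInstance]
        fun ω => l (k ω) := hl.comp (measurable_fst.comp (comap_measurable fun ω => (k ω, g ω)))
    rw [hYf]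
    refine (condExp_sub hfi hli _).trans ?_
    rw [condExp_of_stronglyMeasurable hkg.comap_le hm.stronglyMeasurable hli]
    filter_upwards [h5] with ω e
    simp [e]
  have hgm : Measurable[MeasurableSpace.comap (fun ω => (k ω, g ω)) inferInstance] g :=
    measurable_snd.comp (comap_measurable fun ω => (k ω, g ω))
  have hYg : Integrable (Y * g) μ := hYL.integrable_mul hgL
  have h6 := condExp_mul_of_stronglyMeasurable_right hgm.stronglyMeasurable hYg hYi
  calc ∫ ω, Y ω * g ω ∂μ
      = ∫ ω, (μ[Y * g | MeasurableSpace.comap (fun ω => (k ω, g ω)) inferInstance]) ω ∂μ :=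
        (integral_condExp hkg.comap_le).symm
    _ = ∫ ω, (0 : ℝ) ∂μ := by
        refine integral_congr_ae ?_
        filter_upwards [h6, hYe] with ω e6 eY
        rw [e6, Pi.mul_apply, eY]; simp
    _ = 0 := by simp

end Conditional

/-! ### Gaussian conditional independence as a linear condition -/

section Gaussian

variable {ι : Type*} [Fintype ι] [DecidableEq ι] {S : Matrix ι ι ℝ}

theorem memLp_coord (i : ι) : MemLp (fun x : EuclideanSpace ℝ ι => x i) 2 (multivariateGaussian 0 S) := by
  have := (IsGaussian.hasGaussianLaw_id (μ := multivariateGaussian (0 : EuclideanSpace ℝ ι) S)).map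
    (EuclideanSpace.proj (𝕜 := ℝ) i)
  exact this.memLp_two

theorem integral_coord (i : ι) : ∫ x : EuclideanSpace ℝ ι, x i ∂(multivariateGaussian 0 S) = 0 := by
  have := (EuclideanSpace.proj (𝕜 := ℝ) i).integral_comp_id_comm
    (IsGaussian.integrable_id (μ := multivariateGaussian (0 : EuclideanSpace ℝ ι) S))
  simpa using this

/-- The linear combination of the coordinates with coefficients `w`. -/
noncomputable def linComb (w : ι → ℝ) (x : EuclideanSpace ℝ ι) : ℝ := ∑ k, w k * x k

theorem measurable_linComb (w : ι → ℝ) : Measurable (linComb w) := by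
  unfold linComb; fun_prop

theorem memLp_linComb (w : ι → ℝ) : MemLp (linComb w) 2 (multivariateGaussian 0 S) := by
  unfold linComb
  exact memLp_finsetSum _ fun k _ => (memLp_coord k).const_mul _

theorem integral_linComb (w : ι → ℝ) : ∫ x, linComb w x ∂(multivariateGaussian 0 S) = 0 := by
  unfold linComb
  rw [integral_finsetSum _ fun k _ => ((memLp_coord k).integrable one_le_two).const_mul _]
  refine Finset.sum_eq_zero fun k _ => ?_
  rw [integral_const_mul, integral_coord, mul_zero]

theorem covariance_coord_linComb (hS : S.PosDef) (w : ι → ℝ) (j : ι) :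
    cov[fun x => x j, linComb w; multivariateGaussian 0 S] = (S *ᵥ w) j := by
  unfold linComb
  rw [covariance_fun_sum_right (fun k => (memLp_coord k).const_mul _) (memLp_coord j), mulVec,
    dotProduct]
  refine Finset.sum_congr rfl fun k _ => ?_
  rw [covariance_const_mul_right, covariance_eval_multivariateGaussian hS.posSemidef, mul_comm]

theorem indepFun_linComb {κ : Type*} [Finite κ] (e : κ → ι) (hS : S.PosDef) {w : ι → ℝ}
    (h : ∀ a, (S *ᵥ w) (e a) = 0) :
    IndepFun (fun (x : EuclideanSpace ℝ ι) a => x (e a)) (linComb w) (multivariateGaussian 0 S) := by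
  have := Fintype.ofFinite κ
  have key : IndepFun (fun (x : EuclideanSpace ℝ ι) a => x (e a))
      (fun x (_ : Unit) => linComb w x) (multivariateGaussian 0 S) := by
    refine HasGaussianLaw.indepFun_of_covariance_eval (ι := κ) (κ := Unit) (X := fun a x => x (e a))
      (Y := fun _ => linComb w) ?_ fun a _ => ?_
    · let L : EuclideanSpace ℝ ι →L[ℝ] (κ → ℝ) × (Unit → ℝ) :=
        (ContinuousLinearMap.pi fun a => EuclideanSpace.proj (e a)).prod
          (ContinuousLinearMap.pi fun _ => ∑ k, w k • EuclideanSpace.proj k)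
      have hL := (IsGaussian.hasGaussianLaw_id
        (μ := multivariateGaussian (0 : EuclideanSpace ℝ ι) S)).map L
      have hLe : (fun x : EuclideanSpace ℝ ι => ((fun a => x (e a)), fun _ : Unit => linComb w x))
          = L ∘ id := by
        funext x
        refine Prod.ext rfl ?_
        funext u
        simp [L, linComb]
      rw [hLe]
      exact hL
    · rw [covariance_coord_linComb hS, h]
  exact key.comp measurable_id (measurable_pi_apply ())

/-- `X_i` is its regression residual plus a linear function of `X_C`, and the residual, being
uncorrelated with `X_C`, is independent of it. What remains of the statement is that the residual is
uncorrelated with `X_j`. -/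
theorem CIStatement.holdsFor_iff (s : CIStatement ι) (hS : S.PosDef) :
    s.HoldsFor S ↔ PartialUncorrelated S s.i s.j s.C := by
  rw [partialUncorrelated_iff hS s.i_notMem]
  set w := regressionResidual S s.C s.i with hw
  let l : (s.C → ℝ) → ℝ := fun u => - ∑ k : s.C, w k * u k
  have hl : Measurable l := by fun_prop
  have hwi : w s.i = 1 := regressionResidual_self hS s.i_notMem
  have hsum : ∀ x : EuclideanSpace ℝ ι, x s.i = linComb w x + l (subvector s.C x) := by
    intro x
    have h1 : linComb w x = x s.i + ∑ k ∈ s.C, w k * x k := by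
      unfold linComb
      rw [← Finset.sum_subset (Finset.subset_univ (insert s.i s.C)), Finset.sum_insert s.i_notMem,
        hwi, one_mul]
      intro k _ hk
      rw [Finset.mem_insert, not_or] at hk
      rw [hw, regressionResidual_of_notMem hS hk.1 hk.2, zero_mul]
    have h2 : l (subvector s.C x) = - ∑ k ∈ s.C, w k * x k := by
      rw [← Finset.sum_coe_sort s.C]; rfl
    rw [h1, h2]; ring
  have hC : ∀ k ∈ s.C, (S *ᵥ w) k = 0 := fun k hk => mulVec_residual_of_mem hS s.i_notMem hk
  unfold CIStatement.HoldsFor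
  constructor
  · intro h
    have h1 := integral_mul_eq_zero_of_condIndepFun (measurable_subvector s.C) (by fun_prop)
      (by fun_prop) (measurable_linComb w) hl hsum
      (indepFun_linComb (fun k : s.C => (k : ι)) hS fun k => hC k k.2) (integral_linComb w)
      (memLp_linComb w) (memLp_coord _) (memLp_coord _) h
    rw [← covariance_coord_linComb hS, covariance_comm, covariance_eq_sub (memLp_linComb w)
      (memLp_coord _), integral_linComb, zero_mul, sub_zero]
    exact h1
  · intro h
    have h1 := indepFun_linComb (fun k : Option s.C => k.elim s.j fun k => (k : ι)) hS (w := w) (by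
      rintro (_ | k)
      · exact h
      · exact hC k k.2)
    refine condIndepFun_of_indepFun (measurable_subvector s.C) (by fun_prop)
      (by fun_prop) (measurable_linComb w) hl hsum ?_
    exact h1.comp (φ := fun u : Option s.C → ℝ => ((fun k : s.C => u (some k)), u none))
      (by fun_prop) measurable_id

theorem MixedGraph.mem_gaussianModel_iff {G : MixedGraph ι} :
    S ∈ G.gaussianModel ↔ S.PosDef ∧ G.IsMarkov S := by
  unfold gaussianModel IndepModel.gaussianModel
  rw [Set.mem_ofPred_eq]
  refine and_congr_right fun hS => ⟨fun h i j Z hij hi hj hsep => ?_, fun h s hs => ?_⟩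
  · exact (CIStatement.holdsFor_iff ⟨i, j, Z, hij, hi, hj⟩ hS).1 (h _ hsep)
  · exact (s.holdsFor_iff hS).2 (h _ _ _ s.i_ne_j s.i_notMem s.j_notMem hs)

end Gaussian

/-! ### Second-order expansions -/

section SecondOrder

theorem AnalyticAt.isBigO_sub_sub {E F : Type*} [NormedAddCommGroup E] [NormedSpace ℝ E]
    [NormedAddCommGroup F] [NormedSpace ℝ F] {f : E → F} {x : E} {f' : E →L[ℝ] F}
    (hf : AnalyticAt ℝ f x) (hf' : HasFDerivAt f f' x) :
    (fun y => f (x + y) - f x - f' y) =O[𝓝 0] fun y => ‖y‖ ^ 2 := by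
  obtain ⟨p, hp⟩ := hf
  have h1 := hp.isBigO_sub_partialSum_pow 2
  refine h1.congr_left fun y => ?_
  rw [← hp.hasFDerivAt.unique hf', FormalMultilinearSeries.partialSum, Finset.sum_range_succ,
    Finset.sum_range_one, hp.coeff_zero, sub_sub]
  rfl

variable {V A : Type*} [NormedAddCommGroup V] [NormedSpace ℝ V] [NormedRing A] [NormedAlgebra ℝ A]
  [CompleteSpace A]

theorem hasFDerivAt_inverse_add (X : Aˣ) (b : V →L[ℝ] A) :
    HasFDerivAt (fun v => Ring.inverse (X + b v))
      ((-ContinuousLinearMap.mulLeftRight ℝ A ↑X⁻¹ ↑X⁻¹).comp b) 0 := by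
  have h1 : HasFDerivAt (fun v => (X : A) + b v) b 0 := b.hasFDerivAt.const_add _
  have h2 := hasFDerivAt_ringInverse (𝕜 := ℝ) X
  have h3 : (X : A) + b 0 = X := by simp
  rw [← h3] at h2
  exact h2.comp 0 h1

theorem analyticAt_inverse_add (X : Aˣ) (b : V →L[ℝ] A) :
    AnalyticAt ℝ (fun v => Ring.inverse (X + b v)) 0 := by
  have h1 : AnalyticAt ℝ (fun v => (X : A) + b v) 0 := analyticAt_const.add (b.analyticAt 0)
  have h2 := analyticAt_inverse (𝕜 := ℝ) X
  have h3 : (X : A) + b 0 = X := by simp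
  rw [← h3] at h2
  exact AnalyticAt.comp (g := Ring.inverse) (f := fun v => (X : A) + b v) h2 h1

theorem analyticAt_sandwich (X Y Z : Aˣ) (b k o c : V →L[ℝ] A) :
    AnalyticAt ℝ (fun v => Ring.inverse (X + b v) * (Ring.inverse (Y + k v) + o v) *
      Ring.inverse (Z + c v)) 0 :=
  ((analyticAt_inverse_add X b).mul ((analyticAt_inverse_add Y k).add (o.analyticAt 0))).mul
    (analyticAt_inverse_add Z c)

/-- The product rule for the shape of `chart`, where `X`, `Y`, `Z` become `T`, `Φ⁻¹`, `Tᵀ`. -/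
theorem hasFDerivAt_sandwich (X Y Z : Aˣ) (b k o c : V →L[ℝ] A) :
    ∃ L : V →L[ℝ] A, HasFDerivAt (fun v => Ring.inverse (X + b v) *
      (Ring.inverse (Y + k v) + o v) * Ring.inverse (Z + c v)) L 0 ∧
      ∀ v, L v = (↑X⁻¹ : A) * (o v - ↑Y⁻¹ * k v * ↑Y⁻¹) * ↑Z⁻¹ -
        ↑X⁻¹ * b v * (↑X⁻¹ * ↑Y⁻¹ * ↑Z⁻¹) - ↑X⁻¹ * ↑Y⁻¹ * ↑Z⁻¹ * c v * ↑Z⁻¹ := by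
  refine ⟨_, ((hasFDerivAt_inverse_add X b).mul' ((hasFDerivAt_inverse_add Y k).add
    o.hasFDerivAt)).mul' (hasFDerivAt_inverse_add Z c), fun v => ?_⟩
  simp
  noncomm_ring

end SecondOrder

section Matrices

variable {ι : Type*} [Fintype ι]

/-- A linear endomorphism of the space of matrices, as a continuous linear map. -/
noncomputable def Matrix.pattern (c : Matrix ι ι ℝ) : Matrix ι ι ℝ →L[ℝ] Matrix ι ι ℝ :=
  LinearMap.toContinuousLinearMap
    { toFun := fun E => Matrix.of fun i j => c i j * E i j
      map_add' := fun E F => by ext; simp [mul_add]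
      map_smul' := fun r E => by ext; simp [mul_left_comm] }

theorem Matrix.pattern_apply (c E : Matrix ι ι ℝ) (i j : ι) : c.pattern E i j = c i j * E i j := rfl

variable [DecidableEq ι]

theorem Matrix.norm_pattern_le (c E : Matrix ι ι ℝ) (hc : ∀ i j, |c i j| ≤ 1) : ‖c.pattern E‖ ≤ ‖E‖ := by
  rw [frobenius_norm_def, frobenius_norm_def]
  gcongr with i _ j _
  rw [pattern_apply, norm_mul]
  exact mul_le_of_le_one_left (norm_nonneg _) (hc i j)

end Matrices

/-! ### Charts of the Gaussian models -/

namespace MixedGraph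

variable {ι : Type*} {G : MixedGraph ι}

open Classical in
/-- The coefficients of the perturbation of a recursion along the directed edges. -/
noncomputable def directedCoeff (G : MixedGraph ι) (d : ι → ℝ) : Matrix ι ι ℝ :=
  Matrix.of fun i j => if G.Directed j i then -(d j)⁻¹ else 0

open Classical in
/-- The coefficients of the perturbation of a concentration matrix along the undirected edges. -/
noncomputable def undirectedCoeff (G : MixedGraph ι) (d : ι → ℝ) : Matrix ι ι ℝ :=
  Matrix.of fun i j =>
    if G.Undirected i j ∨ (i = j ∧ G.IsHeadless i) then -((d i)⁻¹ * (d j)⁻¹) else 0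

open Classical in
/-- The coefficients of the perturbation of a covariance matrix along the bidirected edges. -/
noncomputable def bidirectedCoeff (G : MixedGraph ι) : Matrix ι ι ℝ :=
  Matrix.of fun i j => if G.Bidirected i j ∨ (i = j ∧ ¬ G.IsHeadless i) then 1 else 0

open Classical in
/-- The adjacency pattern of the graph, with the diagonal included. -/
noncomputable def adjCoeff (G : MixedGraph ι) : Matrix ι ι ℝ :=
  Matrix.of fun i j => if G.skeleton.Adj i j ∨ i = j then 1 else 0

variable [Fintype ι]

theorem directedCoeff_pattern_of_not {d : ι → ℝ} (E : Matrix ι ι ℝ) {i j : ι} (h : ¬ G.Directed j i) :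
    (G.directedCoeff d).pattern E i j = 0 := by
  simp [pattern_apply, directedCoeff, h]

theorem undirectedCoeff_pattern_of_not {d : ι → ℝ} (E : Matrix ι ι ℝ) {i j : ι}
    (h : ¬ (G.Undirected i j ∨ (i = j ∧ G.IsHeadless i))) :
    (G.undirectedCoeff d).pattern E i j = 0 := by
  simp only [pattern_apply, undirectedCoeff, of_apply, if_neg h, zero_mul]

theorem bidirectedCoeff_pattern_of_not (E : Matrix ι ι ℝ) {i j : ι}
    (h : ¬ (G.Bidirected i j ∨ (i = j ∧ ¬ G.IsHeadless i))) :
    G.bidirectedCoeff.pattern E i j = 0 := by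
  simp only [pattern_apply, bidirectedCoeff, of_apply, if_neg h, zero_mul]

theorem undirectedCoeff_pattern_isSymm {d : ι → ℝ} {E : Matrix ι ι ℝ} (hE : E.IsSymm) :
    ((G.undirectedCoeff d).pattern E).IsSymm := by
  ext i j
  rw [transpose_apply, pattern_apply, pattern_apply, hE.apply]
  congr 1
  classical
  unfold undirectedCoeff
  rw [of_apply, of_apply, mul_comm (d j)⁻¹]
  classical
  refine if_congr (or_congr ⟨?_, ?_⟩ ⟨?_, ?_⟩) rfl rfl
  · exact fun h => ⟨h.1.symm, h.2.2, h.2.1⟩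
  · exact fun h => ⟨h.1.symm, h.2.2, h.2.1⟩
  · rintro ⟨rfl, h⟩; exact ⟨rfl, h⟩
  · rintro ⟨rfl, h⟩; exact ⟨rfl, h⟩

theorem bidirectedCoeff_pattern_isSymm {E : Matrix ι ι ℝ} (hE : E.IsSymm) :
    (G.bidirectedCoeff.pattern E).IsSymm := by
  ext i j
  rw [transpose_apply, pattern_apply, pattern_apply, hE.apply]
  congr 1
  unfold bidirectedCoeff
  rw [of_apply, of_apply]
  classical
  refine if_congr (or_congr ⟨?_, ?_⟩ ⟨?_, ?_⟩) rfl rfl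
  · exact fun h => ⟨h.2, h.1⟩
  · exact fun h => ⟨h.2, h.1⟩
  · rintro ⟨rfl, h⟩; exact ⟨rfl, h⟩
  · rintro ⟨rfl, h⟩; exact ⟨rfl, h⟩

variable [DecidableEq ι] {d : ι → ℝ} {T Φ : Matrix ι ι ℝ}

/-- The perturbation of the error covariance matrix. -/
noncomputable def errorChart (G : MixedGraph ι) (d : ι → ℝ) (Φ E : Matrix ι ι ℝ) : Matrix ι ι ℝ :=
  (Φ⁻¹ + (G.undirectedCoeff d).pattern E)⁻¹ + G.bidirectedCoeff.pattern E

/-- A family of covariance matrices in the Gaussian model of a graph. -/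
noncomputable def chart (G : MixedGraph ι) (d : ι → ℝ) (T Φ E : Matrix ι ι ℝ) : Matrix ι ι ℝ :=
  (T + (G.directedCoeff d).pattern E)⁻¹ * G.errorChart d Φ E *
    (Tᵀ + (G.directedCoeff d)ᵀ.pattern E)⁻¹

theorem IsRecursion.add_directedCoeff (hT : G.IsRecursion T) (d : ι → ℝ) (E : Matrix ι ι ℝ) :
    G.IsRecursion (T + (G.directedCoeff d).pattern E) where
  diag i := by
    rw [Matrix.add_apply, hT.diag, directedCoeff_pattern_of_not _ (fun h => h.2 h.1), add_zero]
  off i k hik hk := by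
    rw [Matrix.add_apply, hT.off i k hik hk, directedCoeff_pattern_of_not _ hk, add_zero]

/-- The zero pattern of the perturbation of an error covariance matrix. -/
theorem isErrorCov_of_inv (hG : G.IsAncestral) (hΦ : G.IsErrorCov Φ) {K W : Matrix ι ι ℝ}
    (hK : ∀ i j, ¬ (G.Undirected i j ∨ (i = j ∧ G.IsHeadless i)) → K i j = 0)
    (hW : ∀ i j, ¬ (G.Bidirected i j ∨ (i = j ∧ ¬ G.IsHeadless i)) → W i j = 0)
    (hu : IsUnit (Φ⁻¹ + K)) (hpd : ((Φ⁻¹ + K)⁻¹ + W).PosDef) :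
    G.IsErrorCov ((Φ⁻¹ + K)⁻¹ + W) := by
  have hK1 : ∀ i j, ¬ G.IsHeadless i → K i j = 0 := by
    refine fun i j hi => hK i j ?_
    rintro (h | h)
    · exact hi (hG.isHeadless_of_undirected h)
    · exact hi h.2
  have hK2 : ∀ i j, ¬ G.IsHeadless j → K i j = 0 := by
    refine fun i j hj => hK i j ?_
    rintro (h | ⟨rfl, h⟩)
    · exact hj (hG.isHeadless_of_undirected ⟨h.1.symm, h.2.2, h.2.1⟩)
    · exact hj h
  have hW1 : ∀ i j, G.IsHeadless i → W i j = 0 := by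
    refine fun i j hi => hW i j ?_
    rintro (h | h)
    · exact hi _ h.2
    · exact h.2 hi
  have hΦu := (isUnit_iff_isUnit_det _).1 hΦ.posDef.isUnit
  have hinv : ∀ i j, G.IsHeadless i → ¬ G.IsHeadless j → Φ⁻¹ i j = 0 := fun i j hi hj => by
    have := hΦ.posDef.inv.1.apply j i
    rw [star_trivial] at this
    rw [this]
    exact hΦ.inv_mixed hj hi
  have hud := (isUnit_iff_isUnit_det _).1 hu
  refine ⟨hpd, fun i j hi hj => ?_, fun i j hi hj hij hb => ?_, fun i j hi hj hij hne => ?_⟩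
  · rw [Matrix.add_apply, hW1 i j hi, add_zero]
    refine inv_eq_zero_of_block hu G.IsHeadless (fun x y hx hy => ?_) hi hj
    rw [Matrix.add_apply, hinv x y hx hy, hK2 x y hy, add_zero]
  -- By this resolvent identity the block on vertices with arrowheads does not change: `Φ * K`
  -- vanishes in their rows.
  · have h1 : (Φ⁻¹ + K)⁻¹ = Φ - Φ * K * (Φ⁻¹ + K)⁻¹ := by
      have h2 : Φ * ((Φ⁻¹ + K) * (Φ⁻¹ + K)⁻¹) = Φ := by
        rw [mul_nonsing_inv _ hud, Matrix.mul_one]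
      rw [← Matrix.mul_assoc, Matrix.mul_add, mul_nonsing_inv _ hΦu, Matrix.add_mul,
        Matrix.one_mul] at h2
      exact eq_sub_of_add_eq h2
    rw [Matrix.add_apply, hW i j (by rintro (h | h); exacts [hb h, hij h.1]), add_zero, h1,
      Matrix.sub_apply, hΦ.bidirected i j hi hj hij hb, zero_sub, neg_eq_zero, mul_apply]
    refine Finset.sum_eq_zero fun b _ => ?_
    rw [mul_apply, Finset.sum_eq_zero, zero_mul]
    intro a _
    by_cases ha : G.IsHeadless a
    · rw [hΦ.symm, hΦ.mixed a i ha hi, zero_mul]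
    · rw [hK1 a b ha, mul_zero]
  · set P := (Φ⁻¹ + K)⁻¹ + W with hP
    have hPd := (isUnit_iff_isUnit_det _).1 hpd.isUnit
    -- Likewise, adding `W` does not change the headless block of the concentration matrix.
    have h1 : P⁻¹ = (Φ⁻¹ + K) - (Φ⁻¹ + K) * W * P⁻¹ := by
      have h2 : (Φ⁻¹ + K) * (P * P⁻¹) = Φ⁻¹ + K := by
        rw [mul_nonsing_inv _ hPd, Matrix.mul_one]
      rw [← Matrix.mul_assoc] at h2
      have h3 : (Φ⁻¹ + K) * P = 1 + (Φ⁻¹ + K) * W := by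
        rw [hP, Matrix.mul_add, mul_nonsing_inv _ hud]
      rw [h3, Matrix.add_mul, Matrix.one_mul] at h2
      exact eq_sub_of_add_eq h2
    rw [h1, Matrix.sub_apply, Matrix.add_apply, hΦ.undirected i j hi hj hij hne,
      hK i j (by rintro (h | h); exacts [hne h, hij h.1]), add_zero, zero_sub, neg_eq_zero,
      mul_apply]
    refine Finset.sum_eq_zero fun b _ => ?_
    rw [mul_apply, Finset.sum_eq_zero, zero_mul]
    intro a _
    by_cases ha : G.IsHeadless a
    · rw [hW1 a b ha, mul_zero]
    · rw [Matrix.add_apply, hinv i a hi ha, hK2 i a ha, add_zero, zero_mul]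

theorem chart_mem_gaussianModel (hG : G.IsAncestral) (hT : G.IsRecursion T) {E : Matrix ι ι ℝ}
    (hE : E.IsSymm) (hΨ : G.IsErrorCov (G.errorChart d Φ E)) :
    G.chart d T Φ E ∈ G.gaussianModel := by
  have hR := hT.add_directedCoeff d E
  set R := T + (G.directedCoeff d).pattern E with hRdef
  have hRt : Tᵀ + (G.directedCoeff d)ᵀ.pattern E = Rᵀ := by
    rw [hRdef, transpose_add]
    congr 1
    ext i j
    rw [transpose_apply, pattern_apply, pattern_apply, transpose_apply, hE.apply]
  have hRu := hR.isUnit hG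
  have hRd := (isUnit_iff_isUnit_det _).1 hRu
  have hch : G.chart d T Φ E = R⁻¹ * G.errorChart d Φ E * (R⁻¹)ᵀ := by
    rw [chart, hRt, transpose_nonsing_inv]
  rw [mem_gaussianModel_iff]
  refine ⟨?_, isMarkov_of_isErrorCov hG hR hΨ ?_⟩
  · have := hΨ.posDef.mul_mul_conjTranspose_same (B := R⁻¹)
      (vecMul_injective_iff_isUnit.2 (isUnit_nonsing_inv_iff.2 hRu))
    rwa [conjTranspose_eq_transpose_of_trivial, ← hch] at this
  · rw [hch, transpose_nonsing_inv]
    have h1 : R * (R⁻¹ * G.errorChart d Φ E * Rᵀ⁻¹) * Rᵀ =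
        (R * R⁻¹) * G.errorChart d Φ E * (Rᵀ⁻¹ * Rᵀ) := by simp only [Matrix.mul_assoc]
    rw [h1, mul_nonsing_inv _ hRd, nonsing_inv_mul _ (by rwa [det_transpose]), Matrix.one_mul,
      Matrix.mul_one]

theorem continuousAt_errorChart (hΦ : Φ.PosDef) : ContinuousAt (G.errorChart d Φ) 0 := by
  unfold errorChart
  refine ContinuousAt.add ?_ (ContinuousLinearMap.continuous _).continuousAt
  have h := (analyticAt_inverse_add hΦ.inv.isUnit.unit
    (G.undirectedCoeff d).pattern).continuousAt
  simp only [← nonsing_inv_eq_ringInverse, IsUnit.unit_spec] at h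
  exact h

theorem eventually_chart_mem (hG : G.IsAncestral) (hT : G.IsRecursion T) (hΦ : G.IsErrorCov Φ)
    (d : ι → ℝ) : ∀ᶠ E in 𝓝 0, E.IsSymm → G.chart d T Φ E ∈ G.gaussianModel := by
  have h0 : G.errorChart d Φ 0 = Φ := by
    rw [errorChart, map_zero, map_zero, add_zero, add_zero,
      nonsing_inv_nonsing_inv _ ((isUnit_iff_isUnit_det _).1 hΦ.posDef.isUnit)]
  have h1 : ∀ᶠ E in 𝓝 0, (G.errorChart d Φ E).IsHermitian → (G.errorChart d Φ E).PosDef := by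
    have := (continuousAt_errorChart (G := G) (d := d) hΦ.posDef)
    rw [ContinuousAt, h0] at this
    exact this.eventually hΦ.posDef.eventually_nhds
  have h2 : ∀ᶠ E in 𝓝 0, IsUnit (Φ⁻¹ + (G.undirectedCoeff d).pattern E) := by
    have hc : Continuous fun E => Φ⁻¹ + (G.undirectedCoeff d).pattern E :=
      continuous_const.add (ContinuousLinearMap.continuous _)
    have : Tendsto (fun E => Φ⁻¹ + (G.undirectedCoeff d).pattern E) (𝓝 0) (𝓝 Φ⁻¹) := by
      have := hc.tendsto 0
      rwa [map_zero, add_zero] at this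
    exact this.eventually (Units.isOpen.mem_nhds hΦ.posDef.inv.isUnit)
  filter_upwards [h1, h2] with E h1 h2 hE
  have hΦs : (Φ⁻¹).IsSymm := by
    have := hΦ.posDef.inv.1
    rwa [IsHermitian, conjTranspose_eq_transpose_of_trivial] at this
  refine chart_mem_gaussianModel hG hT hE (isErrorCov_of_inv hG hΦ
    (fun i j => undirectedCoeff_pattern_of_not E) (fun i j => bidirectedCoeff_pattern_of_not E) h2
    (h1 ?_))
  rw [IsHermitian, conjTranspose_eq_transpose_of_trivial, errorChart, transpose_add,
    transpose_nonsing_inv, transpose_add, hΦs.eq, (undirectedCoeff_pattern_isSymm hE).eq,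
    (bidirectedCoeff_pattern_isSymm hE).eq]

theorem chart_zero (hΦ : Φ.PosDef) : G.chart d T Φ 0 = T⁻¹ * Φ * Tᵀ⁻¹ := by
  rw [chart, errorChart, map_zero, map_zero, map_zero, map_zero, add_zero, add_zero, add_zero, add_zero,
      nonsing_inv_nonsing_inv _ ((isUnit_iff_isUnit_det _).1 hΦ.isUnit)]

theorem analyticAt_chart (hT : IsUnit T) (hΦ : Φ.PosDef) : AnalyticAt ℝ (G.chart d T Φ) 0 := by
  have h := analyticAt_sandwich hT.unit hΦ.inv.isUnit.unit ((isUnit_transpose T).2 hT).unit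
    (G.directedCoeff d).pattern (G.undirectedCoeff d).pattern G.bidirectedCoeff.pattern
    (G.directedCoeff d)ᵀ.pattern
  simp only [← nonsing_inv_eq_ringInverse, IsUnit.unit_spec] at h
  exact h

/-- The derivative of `chart` at `0`. -/
noncomputable def chartDeriv (G : MixedGraph ι) (d : ι → ℝ) (T Φ E : Matrix ι ι ℝ) :
    Matrix ι ι ℝ :=
  T⁻¹ * (G.bidirectedCoeff.pattern E - Φ * (G.undirectedCoeff d).pattern E * Φ) * Tᵀ⁻¹ -
    T⁻¹ * (G.directedCoeff d).pattern E * (T⁻¹ * Φ * Tᵀ⁻¹) -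
    T⁻¹ * Φ * Tᵀ⁻¹ * (G.directedCoeff d)ᵀ.pattern E * Tᵀ⁻¹

theorem hasFDerivAt_chart (hT : IsUnit T) (hΦ : Φ.PosDef) :
    ∃ L : Matrix ι ι ℝ →L[ℝ] Matrix ι ι ℝ, HasFDerivAt (G.chart d T Φ) L 0 ∧
      ∀ E, L E = G.chartDeriv d T Φ E := by
  obtain ⟨L, h, hL⟩ := hasFDerivAt_sandwich hT.unit hΦ.inv.isUnit.unit ((isUnit_transpose T).2 hT).unit
    (G.directedCoeff d).pattern (G.undirectedCoeff d).pattern G.bidirectedCoeff.pattern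
    (G.directedCoeff d)ᵀ.pattern
  simp only [← nonsing_inv_eq_ringInverse, IsUnit.unit_spec] at h
  refine ⟨L, h, fun E => ?_⟩
  refine (hL E).trans ?_
  rw [chartDeriv]
  simp only [coe_units_inv, IsUnit.unit_spec,
    nonsing_inv_nonsing_inv _ ((isUnit_iff_isUnit_det _).1 hΦ.isUnit)]
  rfl

/-- The weights in the coefficient matrices are made for this formula: they cancel the factors that
the product rule produces at `T = 1` and `Φ = diagonal d`. To first order the kind of an edge is
forgotten. -/
theorem chartDeriv_diagonal (hd : ∀ i, 0 < d i) (E : Matrix ι ι ℝ) :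
    G.chartDeriv d 1 (diagonal d) E = G.adjCoeff.pattern E := by
  unfold chartDeriv
  simp only [transpose_one, inv_one, Matrix.one_mul, Matrix.mul_one]
  ext i j
  rw [Matrix.sub_apply, Matrix.sub_apply, Matrix.sub_apply, mul_diagonal, mul_diagonal,
    diagonal_mul, diagonal_mul]
  simp only [pattern_apply, transpose_apply, adjCoeff, bidirectedCoeff, undirectedCoeff,
    directedCoeff, of_apply, Undirected, Directed, Bidirected]
  have hi := (hd i).ne'
  have hj := (hd j).ne'
  by_cases hij : i = j
  · subst hij
    have hl : ¬ G.head i i := fun h => (G.adj_of_head _ _ h).ne rfl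
    by_cases hh : G.IsHeadless i
    · simp [hl, hh]
      field_simp
    · simp [hl, hh]
  · by_cases ha : G.skeleton.Adj i j
    · by_cases h1 : G.head i j <;> by_cases h2 : G.head j i <;> simp [hij, ha, h1, h2]
      · field_simp
      · field_simp
      · field_simp
    · have h1 : ¬ G.head i j := fun h => ha (G.adj_of_head _ _ h)
      have h2 : ¬ G.head j i := fun h => ha (G.adj_of_head _ _ h).symm
      simp [hij, ha, h1, h2]

theorem isRecursion_one : G.IsRecursion (1 : Matrix ι ι ℝ) where
  diag _ := one_apply_eq _
  off _ _ h _ := one_apply_ne h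

theorem isErrorCov_diagonal (hd : ∀ i, 0 < d i) : G.IsErrorCov (diagonal d) where
  posDef := PosDef.diagonal hd
  mixed i j hi hj := diagonal_apply_ne _ fun h => hj (h ▸ hi)
  bidirected _ _ _ _ h _ := diagonal_apply_ne _ h
  undirected _ _ _ _ h _ := by
    rw [inv_diagonal]
    exact diagonal_apply_ne _ h

end MixedGraph

/-! ### Polynomials in the matrix entries and their derivatives -/

section PolynomialDerivative

variable {ι : Type*} [Fintype ι]

/-- An entry of a matrix, as a continuous linear map. -/
noncomputable def Matrix.entryCLM (e : ι × ι) : Matrix ι ι ℝ →L[ℝ] ℝ :=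
  LinearMap.toContinuousLinearMap
    { toFun := fun S => S e.1 e.2
      map_add' := fun _ _ => rfl
      map_smul' := fun _ _ => rfl }

theorem Matrix.entryCLM_apply (e : ι × ι) (S : Matrix ι ι ℝ) : entryCLM e S = S e.1 e.2 := rfl

/-- The value at `S` of a polynomial in the entries. -/
noncomputable def Matrix.evalEntries (p : MvPolynomial (ι × ι) ℝ) (S : Matrix ι ι ℝ) : ℝ :=
  MvPolynomial.eval (fun e : ι × ι => S e.1 e.2) p

/-- The derivative at `S` of a polynomial in the entries. -/
noncomputable def Matrix.derivEntries (p : MvPolynomial (ι × ι) ℝ) (S : Matrix ι ι ℝ) :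
    Matrix ι ι ℝ →L[ℝ] ℝ :=
  ∑ e : ι × ι, evalEntries (MvPolynomial.pderiv e p) S • entryCLM e

theorem Matrix.derivEntries_apply (p : MvPolynomial (ι × ι) ℝ) (S E : Matrix ι ι ℝ) :
    derivEntries p S E = ∑ e : ι × ι, evalEntries (MvPolynomial.pderiv e p) S * E e.1 e.2 := by
  rw [derivEntries, _root_.sum_apply]
  rfl

theorem Matrix.hasStrictFDerivAt_evalEntries (p : MvPolynomial (ι × ι) ℝ) (S : Matrix ι ι ℝ) :
    HasStrictFDerivAt (evalEntries p) (derivEntries p S) S := by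
  classical
  induction p using MvPolynomial.induction_on with
  | C a =>
    have h1 : evalEntries (MvPolynomial.C a : MvPolynomial (ι × ι) ℝ) = fun _ => a := by
      funext S; simp [evalEntries]
    have h2 : derivEntries (MvPolynomial.C a : MvPolynomial (ι × ι) ℝ) S = 0 := by
      ext E; simp [derivEntries_apply, evalEntries]
    rw [h1, h2]
    exact hasStrictFDerivAt_const _ _
  | add p q hp hq =>
    have h1 : evalEntries (p + q) = fun S => evalEntries p S + evalEntries q S := by
      funext S; simp [evalEntries]
    have h2 : derivEntries (p + q) S = derivEntries p S + derivEntries q S := by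
      ext E
      rw [_root_.add_apply]
      simp only [derivEntries_apply, evalEntries, map_add, add_mul, Finset.sum_add_distrib]
    rw [h1, h2]
    exact hp.add hq
  | mul_X p e hp =>
    have h1 : evalEntries (p * MvPolynomial.X e) = fun S => evalEntries p S * entryCLM e S := by
      funext S; simp [evalEntries, entryCLM_apply]
    have h2 : derivEntries (p * MvPolynomial.X e) S =
        evalEntries p S • entryCLM e + entryCLM e S • derivEntries p S := by
      ext E
      rw [_root_.add_apply, _root_.smul_apply,
        _root_.smul_apply]
      simp only [derivEntries_apply, evalEntries, Derivation.leibniz, map_add, smul_eq_mul,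
        MvPolynomial.pderiv_X, map_mul, add_mul, Finset.sum_add_distrib, entryCLM_apply,
        MvPolynomial.eval_X, Finset.mul_sum]
      congr 1
      · rw [Finset.sum_eq_single e]
        · simp
        · intro x _ hx
          simp [Ne.symm hx]
        · simp
      · exact Finset.sum_congr rfl fun x _ => by ring
    rw [h1, h2]
    exact hp.mul (entryCLM e).hasStrictFDerivAt

theorem Matrix.analyticAt_evalEntries (p : MvPolynomial (ι × ι) ℝ) (S : Matrix ι ι ℝ) :
    AnalyticAt ℝ (evalEntries p) S :=
  AnalyticOnNhd.eval_continuousLinearMap' (fun e : ι × ι => entryCLM e) p S trivial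

end PolynomialDerivative

/-! ### The polynomial equation of a conditional independence -/

section RegressionPolynomial

variable {ι : Type*} [Fintype ι] [DecidableEq ι] {Z : Finset ι} {i j : ι} {S : Matrix ι ι ℝ}

/-- The cofactors of the matrix of the regression on the variables in `Z`, as polynomials. -/
noncomputable def regressionCofactor (Z : Finset ι) (b i : ι) : MvPolynomial (ι × ι) ℝ :=
  adjugate (regressionMatrix (Matrix.of fun a b => MvPolynomial.X (a, b)) Z) b i

/-- The polynomial whose vanishing is equivalent to the conditional independence of `X_i` and `X_j`
given `X_Z`. -/
noncomputable def regressionPoly (Z : Finset ι) (i j : ι) : MvPolynomial (ι × ι) ℝ :=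
  ∑ b ∈ Finset.univ.erase j, MvPolynomial.X (j, b) * regressionCofactor Z b i

theorem evalEntries_regressionCofactor (S : Matrix ι ι ℝ) (b i : ι) :
    evalEntries (regressionCofactor Z b i) S = adjugate (regressionMatrix S Z) b i := by
  unfold evalEntries regressionCofactor
  set f := MvPolynomial.eval (fun e : ι × ι => S e.1 e.2)
  have h := congrFun (congrFun (f.map_adjugate
    (regressionMatrix (Matrix.of fun a b => MvPolynomial.X (a, b)) Z)) b) i
  rw [RingHom.mapMatrix_apply, map_apply] at h
  suffices hR : f.mapMatrix (regressionMatrix (Matrix.of fun a b => MvPolynomial.X (a, b)) Z) =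
      regressionMatrix S Z by rw [h, hR]
  ext x y
  by_cases hx : x ∈ Z
  · simp [regressionMatrix, hx, f]
  · by_cases hxy : x = y
    · subst hxy
      simp [regressionMatrix, hx]
    · simp [regressionMatrix, hx, hxy]

/-- Row `j` already is the unit vector that the cofactor puts in row `i`, so two rows agree. Hence
the term `b = j` may be left out of `regressionPoly`. -/
theorem adjugate_regressionMatrix (hij : i ≠ j) (hj : j ∉ Z) :
    adjugate (regressionMatrix S Z) j i = 0 := by
  rw [adjugate_apply]
  refine det_zero_of_row_eq hij ?_
  rw [updateRow_self, updateRow_ne hij.symm]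
  funext x
  simp [regressionMatrix, hj, one_apply, Pi.single_apply, eq_comm]

theorem evalEntries_regressionPoly (S : Matrix ι ι ℝ) :
    evalEntries (regressionPoly Z i j) S =
      ∑ b ∈ Finset.univ.erase j, S j b * adjugate (regressionMatrix S Z) b i := by
  simp only [← evalEntries_regressionCofactor]
  simp [evalEntries, regressionPoly]

theorem PartialUncorrelated.evalEntries_eq_zero (h : PartialUncorrelated S i j Z) (hS : S.PosDef)
    (hij : i ≠ j) (hi : i ∉ Z) (hj : j ∉ Z) : evalEntries (regressionPoly Z i j) S = 0 := by
  have h1 := (partialUncorrelated_iff hS hi).1 h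
  have hu := (isUnit_iff_isUnit_det _).1 (regressionMatrix_isUnit hS Z)
  have h2 : ∀ b, adjugate (regressionMatrix S Z) b i =
      (regressionMatrix S Z).det * regressionResidual S Z i b := by
    intro b
    rw [regressionResidual, mulVec_single_one, col_apply, inv_def, Matrix.smul_apply, smul_eq_mul,
      ← mul_assoc, Ring.mul_inverse_cancel _ hu, one_mul]
  rw [evalEntries_regressionPoly, Finset.sum_erase]
  · rw [mulVec, dotProduct] at h1
    rw [← mul_zero (regressionMatrix S Z).det, ← h1, Finset.mul_sum]
    refine Finset.sum_congr rfl fun b _ => ?_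
    rw [h2]; ring
  · rw [adjugate_regressionMatrix hij hj, mul_zero]

theorem regressionMatrix_diagonal (d : ι → ℝ) :
    regressionMatrix (diagonal d) Z = diagonal fun k => if k ∈ Z then d k else 1 := by
  ext a b
  by_cases ha : a ∈ Z <;> by_cases hab : a = b <;>
    simp [regressionMatrix, ha, hab, one_apply]

/-- Since `b = j` is left out, each factor `S j b` is zero at a diagonal matrix, and only its
derivative counts, weighted by a cofactor. The cofactor matrix is diagonal there, which leaves the
term `b = i`. -/
theorem derivEntries_regressionPoly {d : ι → ℝ} (hd : ∀ k, 0 < d k) (hij : i ≠ j) :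
    ∃ c : ℝ, 0 < c ∧ ∀ E, derivEntries (regressionPoly Z i j) (diagonal d) E = c * E j i := by
  have h1 : HasFDerivAt (evalEntries (regressionPoly Z i j))
      (∑ b ∈ Finset.univ.erase j, (entryCLM (j, b) (diagonal d) •
        derivEntries (regressionCofactor Z b i) (diagonal d) +
          evalEntries (regressionCofactor Z b i) (diagonal d) • entryCLM (j, b))) (diagonal d) := by
    have h2 : evalEntries (regressionPoly Z i j) = fun S => ∑ b ∈ Finset.univ.erase j,
        entryCLM (j, b) S * evalEntries (regressionCofactor Z b i) S := by
      funext S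
      simp only [evalEntries_regressionPoly, evalEntries_regressionCofactor, entryCLM_apply]
    rw [h2]
    exact HasFDerivAt.fun_sum fun b _ => (entryCLM (j, b)).hasFDerivAt.mul
      (hasStrictFDerivAt_evalEntries _ _).hasFDerivAt
  have h3 := (hasStrictFDerivAt_evalEntries (regressionPoly Z i j) (diagonal d)).hasFDerivAt.unique h1
  refine ⟨∏ k ∈ Finset.univ.erase i, if k ∈ Z then d k else 1,
    Finset.prod_pos fun k _ => ?_, fun E => ?_⟩
  · split_ifs
    exacts [hd k, one_pos]
  · rw [h3, _root_.sum_apply,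
      Finset.sum_eq_single_of_mem i (Finset.mem_erase.2 ⟨hij, Finset.mem_univ _⟩)]
    · rw [_root_.add_apply, _root_.smul_apply,
        _root_.smul_apply, evalEntries_regressionCofactor, regressionMatrix_diagonal,
        adjugate_diagonal, diagonal_apply_eq, entryCLM_apply, entryCLM_apply,
        diagonal_apply_ne _ hij.symm, zero_smul, zero_add, smul_eq_mul]
    · intro b hb hbi
      rw [_root_.add_apply, _root_.smul_apply,
        _root_.smul_apply, evalEntries_regressionCofactor, regressionMatrix_diagonal,
        adjugate_diagonal, diagonal_apply_ne _ hbi, entryCLM_apply,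
        diagonal_apply_ne _ (Finset.ne_of_mem_erase hb).symm, zero_smul, zero_smul, add_zero]

end RegressionPolynomial

theorem Matrix.isBigO_of_entries {ι α : Type*} [Fintype ι] {l : Filter α}
    {N : α → Matrix ι ι ℝ} {q : α → ℝ} (h : ∀ i j, (fun a => N a i j) =O[l] q) : N =O[l] q := by
  classical
  have h1 : N = fun a => ∑ i, ∑ j, N a i j • Matrix.single i j (1 : ℝ) := by
    funext a
    conv_lhs => rw [matrix_eq_sum_single (N a)]
    simp [smul_single]
  rw [h1]
  refine Asymptotics.IsBigO.fun_sum fun i _ => Asymptotics.IsBigO.fun_sum fun j _ => ?_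
  have h2 : (fun _ : α => Matrix.single i j (1 : ℝ)) =O[l] fun _ => (1 : ℝ) :=
    Asymptotics.isBigO_const_const _ one_ne_zero _
  simpa using (h i j).smul h2

/-! ### Equal adjacencies: 2-near-equivalence -/

namespace MixedGraph

variable {ι : Type*} [Fintype ι] [DecidableEq ι] {G H : MixedGraph ι} {d : ι → ℝ}

theorem IsMAG.exists_separator (hG : G.IsMAG) {i j : ι} (hij : i ≠ j)
    (hadj : ¬ G.skeleton.Adj i j) :
    ∃ Z : Finset ι, i ∉ Z ∧ j ∉ Z ∧ ∀ S ∈ G.gaussianModel,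
      evalEntries (regressionPoly Z i j) S = 0 := by
  obtain ⟨Z, hi, hj, hsep⟩ := hG.2 i j hij hadj
  refine ⟨Z, hi, hj, fun S hS => ?_⟩
  rw [mem_gaussianModel_iff] at hS
  exact (hS.2 i j Z hij hi hj hsep).evalEntries_eq_zero hS.1 hij hi hj

theorem diagonal_mem_gaussianModel (hG : G.IsAncestral) (hd : ∀ i, 0 < d i) :
    diagonal d ∈ G.gaussianModel := by
  rw [mem_gaussianModel_iff]
  refine ⟨PosDef.diagonal hd,
    isMarkov_of_isErrorCov hG isRecursion_one (isErrorCov_diagonal hd) ?_⟩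
  rw [Matrix.one_mul, transpose_one, Matrix.mul_one]

theorem adjCoeff_pattern_of_adj {i j : ι} (h : G.skeleton.Adj i j ∨ i = j) (E : Matrix ι ι ℝ) :
    G.adjCoeff.pattern E i j = E i j := by
  simp only [pattern_apply, adjCoeff, of_apply, if_pos h, one_mul]

theorem adjCoeff_pattern_of_not_adj {i j : ι} (h : ¬ (G.skeleton.Adj i j ∨ i = j))
    (E : Matrix ι ι ℝ) : G.adjCoeff.pattern E i j = 0 := by
  simp only [pattern_apply, adjCoeff, of_apply, if_neg h, zero_mul]

/-- Near a diagonal matrix the entries at nonadjacent pairs are of second order. -/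
theorem IsMAG.isBigO_sub_pattern (hG : G.IsMAG) (hd : ∀ i, 0 < d i) :
    (fun S => S - diagonal d - G.adjCoeff.pattern (S - diagonal d))
      =O[𝓝[G.gaussianModel] (diagonal d)] fun S => ‖S - diagonal d‖ ^ 2 := by
  refine isBigO_of_entries fun i j => ?_
  by_cases hadj : G.skeleton.Adj i j ∨ i = j
  · refine (Asymptotics.isBigO_zero _ _).congr_left fun S => ?_
    rw [Matrix.sub_apply, adjCoeff_pattern_of_adj hadj, sub_self]
  · have hne : ¬ G.skeleton.Adj j i := fun h => hadj (Or.inl h.symm)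
    have hji : j ≠ i := fun h => hadj (Or.inr h.symm)
    obtain ⟨Z, hi, hj, hZ⟩ := hG.exists_separator hji hne
    obtain ⟨c, hc, hcE⟩ := derivEntries_regressionPoly (Z := Z) hd hji
    have h1 := (analyticAt_evalEntries (regressionPoly Z j i) (diagonal d)).isBigO_sub_sub
      (hasStrictFDerivAt_evalEntries _ _).hasFDerivAt
    have h2 : Tendsto (fun S => S - diagonal d) (𝓝[G.gaussianModel] (diagonal d)) (𝓝 0) := by
      have : Tendsto (fun S => S - diagonal d) (𝓝 (diagonal d)) (𝓝 (diagonal d - diagonal d)) :=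
        (continuous_id.sub continuous_const).tendsto _
      rw [sub_self] at this
      exact this.mono_left nhdsWithin_le_nhds
    -- The polynomial vanishes at `S` and at the diagonal matrix, so the Taylor remainder equals
    -- `-c` times the entry in question.
    have h3 := (h1.comp_tendsto h2).const_mul_left (-c⁻¹)
    refine h3.congr' ?_ (EventuallyEq.refl _ _)
    filter_upwards [self_mem_nhdsWithin] with S hS
    rw [Matrix.sub_apply, adjCoeff_pattern_of_not_adj hadj, sub_zero, Function.comp_apply,
      add_sub_cancel, hZ S hS, hZ _ (diagonal_mem_gaussianModel hG.1 hd)]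
    refine (congrArg (fun x => -c⁻¹ * (0 - 0 - x)) (hcE _)).trans ?_
    field_simp
    ring

theorem isBigO_chart_sub (hd : ∀ i, 0 < d i) :
    (fun E => G.chart d 1 (diagonal d) E - diagonal d - G.adjCoeff.pattern E)
      =O[𝓝 0] fun E => ‖E‖ ^ 2 := by
  obtain ⟨L, h1, h2⟩ := hasFDerivAt_chart (G := G) (d := d) (T := 1) isUnit_one (PosDef.diagonal hd)
  have h3 := (analyticAt_chart isUnit_one (PosDef.diagonal hd)).isBigO_sub_sub h1
  refine h3.congr_left fun E => ?_
  rw [zero_add, chart_zero (PosDef.diagonal hd)]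
  have h4 : L E = G.adjCoeff.pattern E := (h2 E).trans (chartDeriv_diagonal hd E)
  rw [inv_one, transpose_one, inv_one, Matrix.one_mul, Matrix.mul_one]
  exact congrArg _ h4

/-- `S` is O(ε²)-close to its projection onto the adjacent entries, and the chart of `H` realises
this projection up to O(ε²). -/
theorem exists_dist_le (hG : G.IsMAG) (hH : H.IsAncestral)
    (hadj : ∀ a b, G.skeleton.Adj a b ↔ H.skeleton.Adj a b) (hd : ∀ i, 0 < d i) :
    ∃ C, 0 ≤ C ∧ ∀ᶠ ε in 𝓝[>] (0 : ℝ), ∀ S ∈ G.gaussianModel ∩ Metric.ball (diagonal d) ε,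
      ∃ S' ∈ H.gaussianModel ∩ Metric.ball (diagonal d) ε, dist S S' ≤ C * ε ^ 2 := by
  obtain ⟨C₁, hC₁, h1⟩ := (hG.isBigO_sub_pattern hd).exists_nonneg
  obtain ⟨C₂, hC₂, h2⟩ := (isBigO_chart_sub (G := H) hd).exists_nonneg
  have h3 := eventually_chart_mem hH isRecursion_one (isErrorCov_diagonal hd) d
  have h1 := eventually_nhdsWithin_iff.1 h1.bound
  obtain ⟨δ₁, hδ₁, h1⟩ := Metric.eventually_nhds_iff.1 h1
  obtain ⟨δ₂, hδ₂, h2⟩ := Metric.eventually_nhds_iff.1 h2.bound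
  obtain ⟨δ₃, hδ₃, h3⟩ := Metric.eventually_nhds_iff.1 h3
  -- The chart could leave the ball by `C₂ * ε ^ 2`. Shrinking the projection by the factor `1 - K *
  -- ε` gains `K * ε ^ 2`, which is enough, and costs only O(ε²).
  set K := C₂ + 1 with hK
  have hK0 : 0 < K := by positivity
  refine ⟨C₁ + K + C₂, by positivity, ?_⟩
  have hmin : 0 < min (min δ₁ δ₂) (min δ₃ K⁻¹) := by positivity
  filter_upwards [self_mem_nhdsWithin, nhdsWithin_le_nhds (Iio_mem_nhds hmin)] with ε hε0 hεm S hS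
  have hε0 : 0 < ε := hε0
  have hεm : ε < min (min δ₁ δ₂) (min δ₃ K⁻¹) := hεm
  rw [lt_min_iff, lt_min_iff, lt_min_iff] at hεm
  obtain ⟨⟨hε1, hε2⟩, hε3, hε4⟩ := hεm
  have hKε : K * ε < 1 := by
    have := mul_lt_mul_of_pos_left hε4 hK0
    rwa [mul_inv_cancel₀ hK0.ne'] at this
  have hSD : ‖S - diagonal d‖ < ε := by rw [← dist_eq_norm]; exact hS.2
  have hpat : H.adjCoeff = G.adjCoeff := by
    have hsk : H.skeleton = G.skeleton := by
      ext a b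
      exact (hadj a b).symm
    unfold adjCoeff
    rw [hsk]
  set W := G.adjCoeff.pattern (S - diagonal d) with hW
  have hWn : ‖W‖ ≤ ‖S - diagonal d‖ := norm_pattern_le _ _ fun i j => by
    unfold adjCoeff
    rw [of_apply]
    split_ifs <;> simp
  set y := (1 - K * ε) • W with hy
  have hyn : ‖y‖ ≤ (1 - K * ε) * ε := by
    rw [hy, norm_smul, Real.norm_of_nonneg (by linarith)]
    exact mul_le_mul_of_nonneg_left (hWn.trans hSD.le) (by linarith)
  have hyε : ‖y‖ ≤ ε := hyn.trans (mul_le_of_le_one_left hε0.le (by linarith [mul_pos hK0 hε0]))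
  have hPy : H.adjCoeff.pattern y = y := by
    rw [hpat]
    ext i j
    by_cases hij : G.skeleton.Adj i j ∨ i = j
    · rw [adjCoeff_pattern_of_adj hij]
    · rw [adjCoeff_pattern_of_not_adj hij, hy, Matrix.smul_apply, hW,
        adjCoeff_pattern_of_not_adj hij, smul_zero]
  have hSs : S.IsSymm := by
    have := (mem_gaussianModel_iff.1 hS.1).1.1
    rwa [IsHermitian, conjTranspose_eq_transpose_of_trivial] at this
  have hys : y.IsSymm := by
    have hSd : (S - diagonal d).IsSymm := hSs.sub (isSymm_diagonal d)
    refine IsSymm.ext fun i j => ?_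
    rw [hy, Matrix.smul_apply, Matrix.smul_apply]
    congr 1
    by_cases hij : G.skeleton.Adj i j ∨ i = j
    · rw [hW, adjCoeff_pattern_of_adj hij,
        adjCoeff_pattern_of_adj (hij.imp SimpleGraph.Adj.symm Eq.symm), hSd.apply]
    · rw [hW, adjCoeff_pattern_of_not_adj hij,
        adjCoeff_pattern_of_not_adj fun h => hij (h.imp SimpleGraph.Adj.symm Eq.symm)]
  have hq : ‖y‖ ^ 2 ≤ ε ^ 2 := pow_le_pow_left₀ (norm_nonneg _) hyε 2
  have e2 : ‖H.chart d 1 (diagonal d) y - diagonal d - y‖ ≤ C₂ * ε ^ 2 := by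
    have := h2 (y := y) (by rw [dist_zero_right]; linarith)
    rw [hPy, norm_pow, norm_norm] at this
    exact this.trans (mul_le_mul_of_nonneg_left hq hC₂)
  have e1 : ‖S - diagonal d - W‖ ≤ C₁ * ε ^ 2 := by
    have := h1 (y := S) (by rw [dist_eq_norm]; linarith) hS.1
    rw [norm_pow, norm_norm] at this
    exact this.trans (mul_le_mul_of_nonneg_left (pow_le_pow_left₀ (norm_nonneg _) hSD.le 2) hC₁)
  refine ⟨H.chart d 1 (diagonal d) y, ⟨h3 (by rw [dist_zero_right]; linarith) hys, ?_⟩, ?_⟩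
  · rw [Metric.mem_ball, dist_eq_norm]
    have : H.chart d 1 (diagonal d) y - diagonal d =
        (H.chart d 1 (diagonal d) y - diagonal d - y) + y := by abel
    rw [this]
    calc _ ≤ C₂ * ε ^ 2 + (1 - K * ε) * ε := (norm_add_le _ _).trans (add_le_add e2 hyn)
      _ = ε - ε ^ 2 := by rw [hK]; ring
      _ < ε := by linarith [pow_pos hε0 2]
  · rw [dist_eq_norm]
    have : S - H.chart d 1 (diagonal d) y = (S - diagonal d - W) + (K * ε) • W -
        (H.chart d 1 (diagonal d) y - diagonal d - y) := by
      rw [hy, sub_smul, one_smul]; abel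
    rw [this]
    have e3 : ‖(K * ε) • W‖ ≤ K * ε ^ 2 := by
      rw [norm_smul, Real.norm_of_nonneg (by positivity), pow_two, ← mul_assoc]
      exact mul_le_mul_of_nonneg_left (hWn.trans hSD.le) (by positivity)
    calc _ ≤ (C₁ * ε ^ 2 + K * ε ^ 2) + C₂ * ε ^ 2 :=
          (norm_sub_le _ _).trans (add_le_add ((norm_add_le _ _).trans (add_le_add e1 e3)) e2)
      _ = _ := by ring

/-- Maximal ancestral graphs with the same adjacencies are 2-near-equivalent at the points of total
independence. -/
theorem IsMAG.nearEquivalentAt (hG : G.IsMAG) (hH : H.IsMAG)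
    (hadj : ∀ a b, G.skeleton.Adj a b ↔ H.skeleton.Adj a b) (hd : ∀ i, 0 < d i) :
    NearEquivalentAt 2 G.gaussianModel H.gaussianModel (diagonal d) := by
  refine ⟨⟨diagonal_mem_gaussianModel hG.1 hd, diagonal_mem_gaussianModel hH.1 hd⟩, ?_⟩
  obtain ⟨C₁, hC₁, h1⟩ := exists_dist_le hG hH.1 hadj hd
  obtain ⟨C₂, hC₂, h2⟩ := exists_dist_le hH hG.1 (fun a b => (hadj a b).symm) hd
  refine Asymptotics.IsBigO.of_bound (max C₁ C₂) ?_
  filter_upwards [h1, h2, self_mem_nhdsWithin] with ε h1 h2 hε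
  have hε : 0 < ε := hε
  rw [localHausdorffDist, Real.norm_of_nonneg Metric.hausdorffDist_nonneg, Real.rpow_two,
    Real.norm_of_nonneg (by positivity)]
  refine Metric.hausdorffDist_le_of_mem_dist (by positivity) (fun S hS => ?_) fun S hS => ?_
  · obtain ⟨S', hS', h⟩ := h1 S hS
    exact ⟨S', hS', h.trans (by gcongr; exact le_max_left _ _)⟩
  · obtain ⟨S', hS', h⟩ := h2 S hS
    exact ⟨S', hS', h.trans (by gcongr; exact le_max_right _ _)⟩

end MixedGraph

/-! ### 1-equivalence and tangent vectors -/

section FirstOrder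

theorem EquivalentAt.symm {E : Type*} [PseudoMetricSpace E] {c : ℝ} {M₁ M₂ : Set E} {θ : E}
    (h : EquivalentAt c M₁ M₂ θ) : EquivalentAt c M₂ M₁ θ := by
  refine ⟨h.1.symm, ?_⟩
  have := h.2
  unfold localHausdorffDist at this ⊢
  simpa only [Metric.hausdorffDist_comm] using this

/-- Curves in `M₁` are tangent to the level sets of the functions that vanish on a 1-equivalent
set `M₂`. -/
theorem EquivalentAt.deriv_eq_zero {E : Type*} [NormedAddCommGroup E] [NormedSpace ℝ E]
    {M₁ M₂ : Set E} {θ : E} (h : EquivalentAt 1 M₁ M₂ θ) {γ : ℝ → E} {τ : E}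
    (hγ : HasDerivAt γ τ 0) (hγ0 : γ 0 = θ) (hγM : ∀ᶠ t in 𝓝[>] (0 : ℝ), γ t ∈ M₁) {g : E → ℝ}
    {g' : E →L[ℝ] ℝ} (hg : HasStrictFDerivAt g g' θ) (hgM : ∀ x ∈ M₂, g x = 0) : g' τ = 0 := by
  -- The speed of the curve is `‖τ‖`, so `γ t` lies in the ball of radius `a * t` for small `t`.
  set a := ‖τ‖ + 1 with ha
  have ha0 : 0 < a := by positivity
  have hγt : (fun t : ℝ => γ t - θ - t • τ) =o[𝓝 0] fun t => t := by
    have := hasDerivAt_iff_isLittleO_nhds_zero.1 hγ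
    simpa [hγ0] using this
  have hball : ∀ᶠ t in 𝓝[>] (0 : ℝ), γ t ∈ M₁ ∩ Metric.ball θ (a * t) := by
    have h1 := (hγt.def (c := 1 / 2) (by norm_num)).filter_mono (nhdsWithin_le_nhds (s := Set.Ioi 0))
    filter_upwards [h1, hγM, self_mem_nhdsWithin] with t h1 h2 ht
    have ht : 0 < t := ht
    refine ⟨h2, ?_⟩
    rw [Metric.mem_ball, dist_eq_norm]
    have h3 : γ t - θ = (γ t - θ - t • τ) + t • τ := by abel
    rw [h3]
    calc _ ≤ 1 / 2 * ‖t‖ + ‖t • τ‖ := (norm_add_le _ _).trans (by gcongr)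
      _ = (‖τ‖ + 1 / 2) * t := by rw [norm_smul, Real.norm_of_nonneg ht.le]; ring
      _ < a * t := by rw [ha]; nlinarith
  -- An almost nearest point of `M₂`; the slack `t ^ 2` is there because the infimum need not be
  -- attained.
  have hex : ∀ t, ∃ y, (0 < t → γ t ∈ M₁ ∩ Metric.ball θ (a * t) → y ∈ M₂ ∩ Metric.ball θ (a * t) ∧
      dist (γ t) y ≤ localHausdorffDist M₁ M₂ θ (a * t) + t ^ 2) := by
    intro t
    by_cases ht : 0 < t ∧ γ t ∈ M₁ ∩ Metric.ball θ (a * t)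
    · obtain ⟨ht0, ht⟩ := ht
      have hne : (M₂ ∩ Metric.ball θ (a * t)).Nonempty :=
        ⟨θ, h.1.2, Metric.mem_ball_self (by positivity)⟩
      have hfin : Metric.hausdorffEDist (M₁ ∩ Metric.ball θ (a * t)) (M₂ ∩ Metric.ball θ (a * t)) ≠ ⊤ :=
        Metric.hausdorffEDist_ne_top_of_nonempty_of_bounded ⟨_, ht⟩ hne
          (Metric.isBounded_ball.subset Set.inter_subset_right)
          (Metric.isBounded_ball.subset Set.inter_subset_right)
      have h1 := Metric.infDist_le_hausdorffDist_of_mem ht hfin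
      have h2 : Metric.infDist (γ t) (M₂ ∩ Metric.ball θ (a * t)) <
          localHausdorffDist M₁ M₂ θ (a * t) + t ^ 2 := lt_of_le_of_lt h1 (by
        unfold localHausdorffDist; linarith [pow_pos ht0 2])
      obtain ⟨y, hy, hd⟩ := (Metric.infDist_lt_iff hne).1 h2
      exact ⟨y, fun _ _ => ⟨hy, hd.le⟩⟩
    · exact ⟨θ, fun h1 h2 => absurd ⟨h1, h2⟩ ht⟩
  choose y hy using hex
  have hyM : ∀ᶠ t in 𝓝[>] (0 : ℝ), y t ∈ M₂ ∩ Metric.ball θ (a * t) ∧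
      dist (γ t) (y t) ≤ localHausdorffDist M₁ M₂ θ (a * t) + t ^ 2 := by
    filter_upwards [hball, self_mem_nhdsWithin] with t h1 ht
    exact hy t ht h1
  have hat : Tendsto (fun t : ℝ => a * t) (𝓝[>] 0) (𝓝[>] 0) := by
    refine tendsto_nhdsWithin_iff.2 ⟨?_, ?_⟩
    · have : Tendsto (fun t : ℝ => a * t) (𝓝 0) (𝓝 (a * 0)) := (continuous_const_mul a).tendsto 0
      rw [mul_zero] at this
      exact this.mono_left nhdsWithin_le_nhds
    · filter_upwards [self_mem_nhdsWithin] with t ht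
      exact mul_pos ha0 ht
  have hid : Tendsto (fun t : ℝ => t) (𝓝[>] 0) (𝓝 0) := tendsto_id.mono_left nhdsWithin_le_nhds
  have hdist : (fun t => γ t - y t) =o[𝓝[>] (0 : ℝ)] fun t => t := by
    have h1 : (fun t => γ t - y t) =O[𝓝[>] (0 : ℝ)]
        fun t => localHausdorffDist M₁ M₂ θ (a * t) + t ^ 2 := by
      refine Asymptotics.IsBigO.of_bound 1 ?_
      filter_upwards [hyM] with t ht
      rw [one_mul, ← dist_eq_norm]
      exact ht.2.trans (le_abs_self _)
    refine h1.trans_isLittleO ?_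
    refine Asymptotics.isLittleO_of_tendsto' ?_ ?_
    · filter_upwards [self_mem_nhdsWithin] with t ht h0
      exact absurd h0 (ne_of_gt ht)
    · have h2 := ((h.2.comp hat).const_mul a).add hid
      rw [mul_zero, add_zero] at h2
      refine h2.congr' ?_
      filter_upwards [self_mem_nhdsWithin] with t ht
      have ht : 0 < t := ht
      rw [Function.comp_apply, Real.rpow_neg_one]
      field_simp
  have hγS : Tendsto γ (𝓝[>] 0) (𝓝 θ) := by
    have := hγ.continuousAt.tendsto
    rw [hγ0] at this
    exact this.mono_left nhdsWithin_le_nhds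
  have hyS : Tendsto y (𝓝[>] 0) (𝓝 θ) := by
    have := hγS.sub (hdist.trans_tendsto hid)
    simpa using this
  -- Since `g (y t) = 0`, this is a difference of values at two moving points, for which strict
  -- differentiability is needed.
  have h1 : (fun t => g (γ t)) =o[𝓝[>] (0 : ℝ)] fun t => t := by
    have h2 := (hg.isBigO_sub.comp_tendsto (hγS.prodMk_nhds hyS)).trans_isLittleO hdist
    refine h2.congr' ?_ (EventuallyEq.refl _ _)
    filter_upwards [hyM] with t ht
    rw [Function.comp_apply, hgM _ ht.1.1, sub_zero]
  have h2 : HasDerivAt (g ∘ γ) (g' τ) 0 := by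
    rw [← hγ0] at hg
    exact hg.hasFDerivAt.comp_hasDerivAt 0 hγ
  have h3 : (fun t : ℝ => g (γ t) - t * g' τ) =o[𝓝[>] (0 : ℝ)] fun t => t := by
    have := (hasDerivAt_iff_isLittleO_nhds_zero.1 h2).mono (nhdsWithin_le_nhds (s := Set.Ioi 0))
    simpa [hγ0, hgM θ h.1.2] using this
  have h4 : (fun t : ℝ => t * g' τ) =o[𝓝[>] (0 : ℝ)] fun t => t :=
    (h1.sub h3).congr_left fun t => by ring
  have h5 := h4.tendsto_div_nhds_zero
  refine tendsto_nhds_unique (tendsto_const_nhds.congr' ?_) h5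
  filter_upwards [self_mem_nhdsWithin] with t ht
  have ht : 0 < t := ht
  field_simp

end FirstOrder

/-! ### Rational functions regular on the positive definite matrices -/

section Rational

variable {ι : Type*} [Fintype ι]

theorem evalEntries_mul (p q : MvPolynomial (ι × ι) ℝ) (S : Matrix ι ι ℝ) :
    evalEntries (p * q) S = evalEntries p S * evalEntries q S := by
  simp [evalEntries]

theorem evalEntries_add (p q : MvPolynomial (ι × ι) ℝ) (S : Matrix ι ι ℝ) :
    evalEntries (p + q) S = evalEntries p S + evalEntries q S := by
  simp [evalEntries]

/-- The rational functions of the entries that are regular on the positive definite matrices. -/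
def rationalSubring (ι : Type*) [Fintype ι] : Subring ({S : Matrix ι ι ℝ // S.PosDef} → ℝ) where
  carrier := {f | ∃ p q : MvPolynomial (ι × ι) ℝ, ∀ S : {S : Matrix ι ι ℝ // S.PosDef},
    evalEntries q S.1 ≠ 0 ∧ f S * evalEntries q S.1 = evalEntries p S.1}
  mul_mem' := by
    rintro f g ⟨p, q, h⟩ ⟨p', q', h'⟩
    refine ⟨p * p', q * q', fun S => ?_⟩
    rw [evalEntries_mul, evalEntries_mul, ← (h S).2, ← (h' S).2, Pi.mul_apply]
    exact ⟨mul_ne_zero (h S).1 (h' S).1, by ring⟩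
  one_mem' := ⟨1, 1, fun S => by simp [evalEntries]⟩
  add_mem' := by
    rintro f g ⟨p, q, h⟩ ⟨p', q', h'⟩
    refine ⟨p * q' + p' * q, q * q', fun S => ?_⟩
    rw [evalEntries_add, evalEntries_mul, evalEntries_mul, evalEntries_mul, ← (h S).2, ← (h' S).2,
      Pi.add_apply]
    exact ⟨mul_ne_zero (h S).1 (h' S).1, by ring⟩
  zero_mem' := ⟨0, 1, fun S => by simp [evalEntries]⟩
  neg_mem' := by
    rintro f ⟨p, q, h⟩
    refine ⟨-p, q, fun S => ⟨(h S).1, ?_⟩⟩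
    have : evalEntries (-p) S.1 = - evalEntries p S.1 := by simp [evalEntries]
    rw [this, ← (h S).2, Pi.neg_apply, neg_mul]

theorem evalEntries_mem_rationalSubring (p : MvPolynomial (ι × ι) ℝ) :
    (fun S : {S : Matrix ι ι ℝ // S.PosDef} => evalEntries p S.1) ∈ rationalSubring ι :=
  ⟨p, 1, fun S => by simp [evalEntries]⟩

theorem const_mem_rationalSubring (r : ℝ) :
    (fun _ : {S : Matrix ι ι ℝ // S.PosDef} => r) ∈ rationalSubring ι :=
  ⟨MvPolynomial.C r, 1, fun S => by simp [evalEntries]⟩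

theorem inv_mem_rationalSubring {f : {S : Matrix ι ι ℝ // S.PosDef} → ℝ}
    (hf : f ∈ rationalSubring ι) (h0 : ∀ S, f S ≠ 0) : (fun S => (f S)⁻¹) ∈ rationalSubring ι := by
  obtain ⟨p, q, h⟩ := hf
  refine ⟨q, p, fun S => ?_⟩
  have := h S
  have hf := h0 S
  rw [← this.2]
  exact ⟨mul_ne_zero hf this.1, by field_simp⟩

theorem sum_mem_rationalSubring {κ : Type*} {s : Finset κ}
    {f : κ → {S : Matrix ι ι ℝ // S.PosDef} → ℝ} (hf : ∀ k ∈ s, f k ∈ rationalSubring ι) :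
    (fun S => ∑ k ∈ s, f k S) ∈ rationalSubring ι := by
  have := sum_mem hf
  convert this using 1
  funext S
  rw [Finset.sum_apply]

theorem prod_mem_rationalSubring {κ : Type*} {s : Finset κ}
    {f : κ → {S : Matrix ι ι ℝ // S.PosDef} → ℝ} (hf : ∀ k ∈ s, f k ∈ rationalSubring ι) :
    (fun S => ∏ k ∈ s, f k S) ∈ rationalSubring ι := by
  have := prod_mem hf
  convert this using 1
  funext S
  rw [Finset.prod_apply]

/-- The entries of `A S` are rational functions of `S` that are regular on the positive definite
matrices. -/
def IsRationalMatrix (A : {S : Matrix ι ι ℝ // S.PosDef} → Matrix ι ι ℝ) : Prop :=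
  ∀ i j, (fun S => A S i j) ∈ rationalSubring ι

namespace IsRationalMatrix

variable {A B : {S : Matrix ι ι ℝ // S.PosDef} → Matrix ι ι ℝ}

theorem coe : IsRationalMatrix (fun S : {S : Matrix ι ι ℝ // S.PosDef} => S.1) := fun i j => by
  have := evalEntries_mem_rationalSubring (MvPolynomial.X (i, j) : MvPolynomial (ι × ι) ℝ)
  simpa [evalEntries] using this

theorem const (C : Matrix ι ι ℝ) : IsRationalMatrix fun _ => C := fun _ _ =>
  const_mem_rationalSubring _

theorem mul (hA : IsRationalMatrix A) (hB : IsRationalMatrix B) :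
    IsRationalMatrix fun S => A S * B S := fun i j => by
  simp only [mul_apply]
  exact sum_mem_rationalSubring fun k _ => mul_mem (hA i k) (hB k j)

theorem sub (hA : IsRationalMatrix A) (hB : IsRationalMatrix B) :
    IsRationalMatrix fun S => A S - B S := fun i j => sub_mem (hA i j) (hB i j)

theorem transpose (hA : IsRationalMatrix A) : IsRationalMatrix fun S => (A S)ᵀ := fun i j => hA j i

variable [DecidableEq ι]

theorem det (hA : IsRationalMatrix A) : (fun S => (A S).det) ∈ rationalSubring ι := by
  simp only [det_apply']
  exact sum_mem_rationalSubring fun σ _ =>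
    mul_mem (const_mem_rationalSubring _) (prod_mem_rationalSubring fun i _ => hA _ _)

theorem inv (hA : IsRationalMatrix A) (hu : ∀ S, IsUnit (A S)) :
    IsRationalMatrix fun S => (A S)⁻¹ := fun i j => by
  have hd : ∀ S, (A S).det ≠ 0 := fun S => ((isUnit_iff_isUnit_det _).1 (hu S)).ne_zero
  simp only [inv_def, Matrix.smul_apply, smul_eq_mul, Ring.inverse_eq_inv', adjugate_apply]
  refine mul_mem (inv_mem_rationalSubring hA.det hd)
    (det (A := fun S => (A S).updateRow j (Pi.single i 1)) fun a b => ?_)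
  by_cases ha : a = j
  · subst ha
    simp only [updateRow_self]
    exact const_mem_rationalSubring _
  · simp only [updateRow_ne ha]
    exact hA a b

end IsRationalMatrix

end Rational

/-! ### Different adjacencies: 1-equivalence almost nowhere -/

namespace MixedGraph

variable {ι : Type*} [Fintype ι] [DecidableEq ι] {G H : MixedGraph ι} {d : ι → ℝ}

theorem isRationalMatrix_recursion (G : MixedGraph ι) :
    IsRationalMatrix fun S : {S : Matrix ι ι ℝ // S.PosDef} => G.recursion S.1 := fun i k => by
  have h1 : IsRationalMatrix fun S : {S : Matrix ι ι ℝ // S.PosDef} =>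
      regressionMatrix S.1 (G.parents i) := fun a b => by
    by_cases ha : a ∈ G.parents i
    · simp only [regressionMatrix, of_apply, if_pos ha]
      exact IsRationalMatrix.coe a b
    · simp only [regressionMatrix, of_apply, if_neg ha]
      exact const_mem_rationalSubring _
  have h2 := h1.inv (fun S => regressionMatrix_isUnit S.2 _) k i
  simpa only [recursion, of_apply, regressionResidual, mulVec_single_one, col_apply] using h2

/-- The formula for the tangent vectors makes sense at all positive definite matrices, in the model
or not. Being rational, it leads to one polynomial condition valid on the whole exceptional set. -/
theorem isRationalMatrix_chartDeriv (hG : G.IsAncestral) (d : ι → ℝ) (E : Matrix ι ι ℝ) :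
    IsRationalMatrix fun S : {S : Matrix ι ι ℝ // S.PosDef} =>
      G.chartDeriv d (G.recursion S.1) (G.errorCov S.1) E := by
  have hT := G.isRationalMatrix_recursion
  have hΦ : IsRationalMatrix fun S : {S : Matrix ι ι ℝ // S.PosDef} => G.errorCov S.1 :=
    (hT.mul .coe).mul hT.transpose
  have hu : ∀ S : {S : Matrix ι ι ℝ // S.PosDef}, IsUnit (G.recursion S.1) := fun S =>
    (isRecursion_recursion S.2).isUnit hG
  have hTi := hT.inv hu
  have hTt := hT.transpose.inv fun S => (isUnit_transpose _).2 (hu S)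
  exact (((hTi.mul ((IsRationalMatrix.const _).sub ((hΦ.mul (.const _)).mul hΦ))).mul hTt).sub
    ((hTi.mul (.const _)).mul ((hTi.mul hΦ).mul hTt))).sub
      ((((hTi.mul hΦ).mul hTt).mul (.const _)).mul hTt)

theorem recursion_diagonal (hd : ∀ i, 0 < d i) : G.recursion (diagonal d) = 1 := by
  ext i k
  have h := eq_residual (P := G.parents i) (PosDef.diagonal hd) notMem_parents_self
    (w := Pi.single i 1) (Pi.single_eq_same _ _) (fun k hk _ => Pi.single_eq_of_ne hk _)
    (fun k hk => by
      have hki : k ≠ i := fun h => notMem_parents_self (h ▸ hk)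
      rw [mulVec_single_one, col_apply, diagonal_apply_ne _ hki])
  change regressionResidual (diagonal d) (G.parents i) i k = _
  rw [← h, one_apply, Pi.single_apply]
  exact if_congr eq_comm rfl rfl

theorem chart_recursion_zero (hG : G.IsAncestral) {S : Matrix ι ι ℝ} (hS : S.PosDef) :
    G.chart d (G.recursion S) (G.errorCov S) 0 = S := by
  have hu := (isUnit_iff_isUnit_det _).1 ((isRecursion_recursion (G := G) hS).isUnit hG)
  rw [chart_zero (posDef_errorCov hS hG), errorCov]
  have : (G.recursion S)⁻¹ * (G.recursion S * S * (G.recursion S)ᵀ) * ((G.recursion S)ᵀ)⁻¹ =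
      ((G.recursion S)⁻¹ * G.recursion S) * S * ((G.recursion S)ᵀ * ((G.recursion S)ᵀ)⁻¹) := by
    simp only [Matrix.mul_assoc]
  rw [this, nonsing_inv_mul _ hu, mul_nonsing_inv _ (by rwa [det_transpose]), Matrix.one_mul,
    Matrix.mul_one]

/-- The tangent vectors of the family `chart` are annihilated by the equations of a 1-equivalent
model. -/
theorem IsMAG.derivEntries_chartDeriv (hG : G.IsMAG) {M₂ : Set (Matrix ι ι ℝ)} {S : Matrix ι ι ℝ}
    (hS : EquivalentAt 1 G.gaussianModel M₂ S) {g : MvPolynomial (ι × ι) ℝ}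
    (hg : ∀ S ∈ M₂, evalEntries g S = 0) (d : ι → ℝ) {E : Matrix ι ι ℝ} (hE : E.IsSymm) :
    derivEntries g S (G.chartDeriv d (G.recursion S) (G.errorCov S) E) = 0 := by
  obtain ⟨hpd, hM⟩ := mem_gaussianModel_iff.1 hS.1.1
  have hT : G.IsRecursion (G.recursion S) := isRecursion_recursion hpd
  have hΦ := hM.isErrorCov hpd hG
  obtain ⟨L, hL, hLE⟩ := hasFDerivAt_chart (G := G) (d := d) (hT.isUnit hG.1) hΦ.posDef
  have hline : HasDerivAt (fun t : ℝ => t • E) E 0 := by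
    have := (hasDerivAt_id (0 : ℝ)).smul_const E
    rw [one_smul] at this
    exact this
  have hγ : HasDerivAt (fun t : ℝ => G.chart d (G.recursion S) (G.errorCov S) (t • E))
      (G.chartDeriv d (G.recursion S) (G.errorCov S) E) 0 := by
    rw [← zero_smul ℝ E] at hL
    have := hL.comp_hasDerivAt (0 : ℝ) hline
    exact (hLE E) ▸ this
  refine hS.deriv_eq_zero hγ ?_ ?_ (hasStrictFDerivAt_evalEntries g S) hg
  · simp only [zero_smul]
    exact chart_recursion_zero hG.1 hpd
  · have h0 : Tendsto (fun t : ℝ => t • E) (𝓝[>] 0) (𝓝 0) := by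
      have := hline.continuousAt.tendsto
      rw [zero_smul] at this
      exact this.mono_left nhdsWithin_le_nhds
    filter_upwards [h0.eventually (eventually_chart_mem hG.1 hT hΦ d)] with t ht
    exact ht (hE.smul t)

/-- An edge of `G` that is missing in `H` makes 1-equivalence rare. -/
theorem IsMAG.isNullWithin_of_adj (hG : G.IsMAG) (hH : H.IsMAG) {i j : ι}
    (hadj : G.skeleton.Adj i j) (hn : ¬ H.skeleton.Adj i j) {M : Set (Matrix ι ι ℝ)}
    (hM : IsIrreducibleModel M) (hd : ∀ k, 0 < d k) (hdM : diagonal d ∈ M) :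
    IsNullWithin {S | EquivalentAt 1 G.gaussianModel H.gaussianModel S} M := by
  have hij : i ≠ j := hadj.ne
  obtain ⟨Z, -, -, hZ⟩ := hH.exists_separator hij hn
  obtain ⟨c, hc, hcE⟩ := derivEntries_regressionPoly (Z := Z) hd hij
  set E : Matrix ι ι ℝ := Matrix.single i j 1 + Matrix.single j i 1 with hE
  have hEs : E.IsSymm := by
    rw [hE, IsSymm, transpose_add, transpose_single, transpose_single, add_comm]
  have hrat : (fun S : {S : Matrix ι ι ℝ // S.PosDef} => derivEntries (regressionPoly Z i j) S.1
      (G.chartDeriv d (G.recursion S.1) (G.errorCov S.1) E)) ∈ rationalSubring ι := by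
    simp only [derivEntries_apply]
    exact sum_mem_rationalSubring fun e _ => mul_mem (evalEntries_mem_rationalSubring _)
      (isRationalMatrix_chartDeriv hG.1 d E e.1 e.2)
  -- The numerator `p` vanishes wherever 1-equivalence holds. At the diagonal matrix the tangent
  -- vector has entry 1 at `(j, i)`, so `p` is nonzero there.
  obtain ⟨p, q, hpq⟩ := hrat
  refine isNullWithin_of_eval_eq_zero hM p hdM ?_ fun S hS _ => ?_
  · have h := hpq ⟨diagonal d, PosDef.diagonal hd⟩
    change evalEntries p (diagonal d) ≠ 0
    rw [← h.2]
    refine mul_ne_zero ?_ h.1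
    have herr : G.errorCov (diagonal d) = diagonal d := by
      rw [errorCov, recursion_diagonal hd, Matrix.one_mul, transpose_one, Matrix.mul_one]
    change derivEntries (regressionPoly Z i j) (diagonal d)
      (G.chartDeriv d (G.recursion (diagonal d)) (G.errorCov (diagonal d)) E) ≠ 0
    rw [recursion_diagonal hd, herr, chartDeriv_diagonal hd, hcE,
      adjCoeff_pattern_of_adj (Or.inl hadj.symm)]
    have : E j i = 1 := by simp [hE, hij]
    rw [this, mul_one]
    exact hc.ne'
  · have hS : EquivalentAt 1 G.gaussianModel H.gaussianModel S := hS
    have h := hpq ⟨S, (mem_gaussianModel_iff.1 hS.1.1).1⟩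
    change evalEntries p S = 0
    rw [← h.2]
    exact mul_eq_zero_of_left (hG.derivEntries_chartDeriv hS hZ d hEs) _

theorem IsMAG.isNullWithin (hG : G.IsMAG) (hH : H.IsMAG)
    (h : ¬ ∀ a b, G.skeleton.Adj a b ↔ H.skeleton.Adj a b) {M : Set (Matrix ι ι ℝ)}
    (hM : IsIrreducibleModel M) (hd : ∀ k, 0 < d k) (hdM : diagonal d ∈ M) :
    IsNullWithin {S | EquivalentAt 1 G.gaussianModel H.gaussianModel S} M := by
  push Not at h
  obtain ⟨a, b, ⟨h1, h2⟩ | ⟨h1, h2⟩⟩ := h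
  · exact hG.isNullWithin_of_adj hH h1 h2 hM hd hdM
  · have h3 : {S | EquivalentAt 1 G.gaussianModel H.gaussianModel S} =
        {S | EquivalentAt 1 H.gaussianModel G.gaussianModel S} :=
      Set.ext fun S => ⟨EquivalentAt.symm, EquivalentAt.symm⟩
    rw [h3]
    exact hH.isNullWithin_of_adj hG h2 h1 hM hd hdM

end MixedGraph

theorem mainTheorem10 {ι : Type*} [Fintype ι] [DecidableEq ι] (G H : MixedGraph ι)
    (hG : G.IsMAG) (hH : H.IsMAG) :
    -- adjacency in the graph is adjacency in the independence model
    ((∀ a b, G.skeleton.Adj a b ↔ G.indepModel.Adjacent a b) ∧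
      (∀ a b, H.skeleton.Adj a b ↔ H.indepModel.Adjacent a b)) ∧
    -- same adjacencies: 2-near-equivalence at every point of total independence
    ((∀ a b, G.skeleton.Adj a b ↔ H.skeleton.Adj a b) →
      ∀ d : ι → ℝ, (∀ i, 0 < d i) →
        NearEquivalentAt 2 G.gaussianModel H.gaussianModel (Matrix.diagonal d)) ∧
    -- different adjacencies: 1-equivalence almost nowhere
    (¬ (∀ a b, G.skeleton.Adj a b ↔ H.skeleton.Adj a b) →
      ∀ M : Set (Matrix ι ι ℝ), IsIrreducibleModel M →
        (∃ d : ι → ℝ, (∀ i, 0 < d i) ∧ Matrix.diagonal d ∈ M) →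
          IsNullWithin {S | EquivalentAt 1 G.gaussianModel H.gaussianModel S} M) := by
  exact ⟨⟨hG.adj_iff_adjacent, hH.adj_iff_adjacent⟩,
    fun hadj _ hd => hG.nearEquivalentAt hH hadj hd,
    fun hadj _ hM ⟨_, hd, hdM⟩ => hG.isNullWithin hH hadj hM hd hdM⟩
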